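/- **Setting.** Units belong to a countable population $\mathcal P$. On one probability space there are, for every unit $i$, a treatment $D_i\in\{0,1\}$, covariates $Z_i=(Z_i^c,Z_i^d)$ with $Z^c_i\in\mathbb R^q$ and $Z^d_i$ finitely valued, an error $\varepsilon_i$, the finite set $\mathcal N_i^*$ of its neighbours in an undirected latent network, and two observed proxies $\mathcal N_i,\tilde{\mathcal N}_i$ of that set (a unit is never its own neighbour). Put $S_i^*=\sum_{j\in\mathcal N_i^*}D_j$, $S_i=\sum_{j\in\mathcal N_i}D_j$, and $Y_i=\tilde r(i,\mathbf D,\mathbf A^*,\mathbf Z,\varepsilon_i)$ with $\tilde r$ real-valued and measurable. $\Omega_X$ denotes the support of $X$ and $f_{X|V}$ a conditional probability function; as functions of $z\in\Omega_Z$, conditional probabilities and means given $Z_i=z$ are the continuous versions. **Assumptions.** 1. (Interference) $Y_i$ depends on its arguments only through $(D_i,S_i^*,Z_i,|\mathcal N_i^*|,\varepsilon_i)$, in the same way for all units. 2. The $D_i$ are i.i.d. with $0<\Pr(D_i=1)<1$; the family $\{D_i\}$ is independent of $\{(\varepsilon_j,Z_j,\mathcal N_j^*,\mathcal N_j,\tilde{\mathcal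 N}_j)\}_j$; and for each $i$, conditionally on $(Z_i,|\mathcal N_i^*|)$, $\varepsilon_i$ is independent of $\mathcal N_i^*,\mathcal N_i,\tilde{\mathcal N}_i$ and of the treatments of their members, jointly. 3. The $Z_i$ are i.i.d.; the conditional laws of $|\mathcal N_i^*|$ given $Z_i$, and of $\varepsilon_i$, of $|\mathcal N_i|$ and of $|\tilde{\mathcal N}_i|$ given $(Z_i,|\mathcal N_i^*|)$, do not depend on $i$. 4. $|\mathcal N_i|$ and $|\tilde{\mathcal N}_i|$ are independent given $(Z_i,|\mathcal N_i^*|)$. 5. The three degrees have the same support $\{0,\dots,K-1\}$. 6. For every $z\in\Omega_Z$ and $n^*<K$: $f_{|\mathcal N^*||Z=z}(n^*)>0$; the $K\times K$ matrices with entries $f_{|\mathcal N||Z=z,|\mathcal N^*|=n^*}(n)$ and $f_{|\tilde{\mathcal N}||Z=z,|\mathcal N^*|=n^*}(n)$ have rank $K$; the means $E[Y|Z=z,|\mathcal N^*|=n^*]$ are distinct for distinct $n^*$; and in each of the two matrices the entry $n=n^*$ of column $n^*$ is strictly larger than every other entry of that column. 7. For each $i$, either $\mathcal N_i\subset\mathcal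 N_i^*$ almost surely or $\mathcal N_i^*\subset\mathcal N_i$ almost surely. 8. The support $\Omega_{W^c}$ of $(Y,Z^c)$ is compact and convex. On the supports the elements of $\gamma^0=(f_{|\tilde{\mathcal N}|,|\mathcal N|,Y,Z},\,f_{|\tilde{\mathcal N}|,|\mathcal N|,Z},\,f_{S,|\mathcal N|,Z},\,f_{|\mathcal N|,Z},\,f_Z)$ are densities (Lebesgue in the continuous, counting in the discrete arguments) that are bounded and twice continuously differentiable in the continuous arguments, with bounded derivatives, on an open set containing $\Omega_{W^c}$ (or its projection). 9. $\kappa\ge0$ is a symmetric differentiable kernel with bounded derivative, $\int\kappa=1$, and $\int v^2\kappa(v)\,dv$, $\int\kappa^2$ finite and positive. The bandwidths satisfy $h_N>0$. 10. $f_Z>0$ on $\Omega_Z$, and for some $\epsilon>0$, $f_{|\mathcal N||Z=z}(n)>\epsilon$ for all $n<K$ and $z\in\Omega_Z$. **Estimator.** $\hat\gamma_N$ replaces each element $f_W(w)$ of $\gamma^0$ by $\frac1N\sum_{i\le N}h_N^{-Q}\prod_{l=1}^{Q}\kappa\big((W^c_{i,l}-w^c_l)/h_N\big)1[W_i^d=w^d]$,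 the sum being over $N$ sampled units and $Q$ being the number of continuous components of $W$. For $\gamma=(\gamma_1,\dots,\gamma_5)$ and $z\in\Omega_Z$ let $\mathbf F(\gamma)=[\gamma_2(\tilde n,n,z)/\gamma_5(z)]_{\tilde n,n}$ and $\mathbf E(\gamma)=[\int y\,\gamma_1(\tilde n,n,y,z)/\gamma_5(z)\,dy]_{\tilde n,n}$, the integral being over $\{y:(y,z^c)\in\Omega_{W^c}\}$. Let $\psi(\gamma)$ be the matrix of eigenvectors of $\mathbf E(\gamma)'(\mathbf F(\gamma)')^{-1}$ with distinct eigenvalues, each column normalized to sum one and the columns ordered so that the largest entry of column $n^*$ is entry $n^*$. Write $b(s,n)=\gamma_3(s,n,z)/\gamma_4(n,z)$. The map $\phi$ is $$\phi(\gamma)=\frac{\varphi_1\varphi_2\varphi_3\varphi_4}{\varphi_5\varphi_6},$$ where $\varphi_3=\psi(\gamma)_{n,n^*}$, $\varphi_6=\gamma_4(n,z)/\gamma_5(z)$, $\varphi_4$ is entry $n^*$ of $\psi(\gamma)^{-1}[\gamma_4(\cdot,z)/\gamma_5(z)]$, $\varphi_5=b(s,n)$, $\varphi_2=b(s^*,n^*)$,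 and, with $\Delta s=|s-s^*|$, $\Delta n=|n-n^*|$: if $n^*\le n$, $\varphi_1=b(\Delta s,\Delta n)$ when $s^*\le s$ and $\Delta s\le\Delta n$, and $0$ otherwise; if $n<n^*$, $\varphi_1=b(\Delta s,\Delta n)\,b(s,n)/b(s^*,n^*)$ when $s\le s^*$ and $\Delta s\le\Delta n$, and $0$ otherwise. Put $\hat\phi_N=\phi(\hat\gamma_N)$ and $\phi^0=\phi(\gamma^0)$. The norm $\|\cdot\|_\infty$ is the supremum over all components and all arguments in the supports. **Claim.** $\phi^0$ is the true latent distribution $f_{S^*,|\mathcal N^*||D,S,Z,|\mathcal N|}$, and for every $\eta=\eta_N\to0$ as $N\to\infty$, $$\sup_{\|\hat\gamma_N-\gamma^0\|_\infty\le\eta}\big\|\hat\phi_N-\phi^0\big\|_\infty=O_p\big(\|\hat\gamma_N-\gamma^0\|_\infty\big).$$ More precisely, there is a constant $C$, not depending on $(\eta_N)$, such that for all large $N$, $\|\phi(\gamma)-\phi^0\|_\infty\le C\|\gamma-\gamma^0\|_\infty$ for every $\gamma$ (with $\gamma_1$ measurable in $y$) such that $\|\gamma-\gamma^0\|_\infty\le\eta_N$;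 and $\|\hat\phi_N-\phi^0\|_\infty\,1[\|\hat\gamma_N-\gamma^0\|_\infty\le\eta_N]=O_p(\|\hat\gamma_N-\gamma^0\|_\infty)$. -/

import Mathlib

open MeasureTheory ProbabilityTheory Filter Topology
open scoped ENNReal NNReal

noncomputable section

namespace NetMis

/-- Values of the covariate vector: `q` continuous coordinates and a discrete part with finitely
many values, labelled by `Fin r`. -/
abbrev Cov (q r : ℕ) : Type := (Fin q → ℝ) × Fin r

/-- An undirected network without self links, given by its neighbour sets. -/
def IsNetwork {P : Type*} (A : P → Finset P) : Prop :=
  (∀ i j, j ∈ A i ↔ i ∈ A j) ∧ ∀ i, i ∉ A i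

/-- The number of treated units in the neighbour set `A`. -/
def treatedCount {P : Type*} (D : P → Bool) (A : Finset P) : ℕ :=
  (A.filter (fun j => D j = true)).card

/-- The random elements of the model: treatments, latent network, two observed network proxies,
covariates, unobserved errors, and the (unknown) structural function. -/
structure Model (P Ω E : Type*) (q r : ℕ) where
  /-- treatment status -/
  D : P → Ω → Bool
  /-- neighbours in the true latent network -/
  Nstar : P → Ω → Finset P
  /-- neighbours in the first network proxy -/
  N : P → Ω → Finset P
  /-- neighbours in the second network proxy -/
  Nt : P → Ω → Finset P
  /-- covariates -/
  Z : P → Ω → Cov q r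
  /-- unobserved error -/
  eps : P → Ω → E
  /-- outcome function of (unit, all treatments, network, all covariates, own error) -/
  rt : P → (P → Bool) → (P → Finset P) → (P → Cov q r) → E → ℝ

/-- `X` and `V` are conditionally independent given the sigma-algebra generated by `U`. -/
def IndepGiven {Ω α β γ : Type*} [MeasurableSpace Ω] [MeasurableSpace α] [MeasurableSpace β]
    [mγ : MeasurableSpace γ] (μ : Measure Ω) (X : Ω → α) (V : Ω → β) (U : Ω → γ) : Prop :=
  ∀ (A : Set α) (B : Set β), MeasurableSet A → MeasurableSet B →
    (μ⟦X ⁻¹' A ∩ V ⁻¹' B | mγ.comap U⟧) =ᵐ[μ]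
      fun ω => (μ⟦X ⁻¹' A | mγ.comap U⟧) ω * (μ⟦V ⁻¹' B | mγ.comap U⟧) ω

/-- `f` is the conditional mean of `X` given the event `U` and `Z = z`, for `z` in `S`, in the
version that is continuous in `z`. With `X` the indicator of an event it is the conditional
probability of that event. -/
def IsCondMean {Ω : Type*} [MeasurableSpace Ω] {q r : ℕ} (μ : Measure Ω) (X : Ω → ℝ) (U : Set Ω)
    (Z : Ω → Cov q r) (S : Set (Cov q r)) (f : Cov q r → ℝ) : Prop :=
  ContinuousOn f S ∧ ∀ B : Set (Cov q r), MeasurableSet B →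
    ∫ ω in U ∩ Z ⁻¹' B, X ω ∂μ = ∫ ω in U ∩ Z ⁻¹' B, f (Z ω) ∂μ

/-- `f z` is the conditional probability of the event `A` given the event `U` and `Z = z`. -/
def IsCondProb {Ω : Type*} [MeasurableSpace Ω] {q r : ℕ} (μ : Measure Ω) (A U : Set Ω)
    (Z : Ω → Cov q r) (S : Set (Cov q r)) (f : Cov q r → ℝ) : Prop :=
  IsCondMean μ (A.indicator fun _ => (1 : ℝ)) U Z S f

/-- `f` is bounded and twice continuously differentiable with bounded derivatives on an open set
containing `S`. -/
def SmoothNear {V : Type*} [NormedAddCommGroup V] [NormedSpace ℝ V] (f : V → ℝ) (S : Set V) :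
    Prop :=
  ∃ O : Set V, IsOpen O ∧ S ⊆ O ∧ ContDiffOn ℝ 2 f O ∧
    ∃ C : ℝ, ∀ x ∈ O, ∀ k : ℕ, k ≤ 2 → ‖iteratedFDeriv ℝ k f x‖ ≤ C

namespace Model

variable {P Ω E : Type*} {q r : ℕ}

/-- The outcome. -/
def Y (M : Model P Ω E q r) (i : P) (ω : Ω) : ℝ :=
  M.rt i (fun j => M.D j ω) (fun j => M.Nstar j ω) (fun j => M.Z j ω) (M.eps i ω)

/-- The number of treated neighbours in the latent network. -/
def Sstar (M : Model P Ω E q r) (i : P) (ω : Ω) : ℕ :=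
  treatedCount (fun j => M.D j ω) (M.Nstar i ω)

/-- The number of treated neighbours in the first proxy. -/
def S (M : Model P Ω E q r) (i : P) (ω : Ω) : ℕ :=
  treatedCount (fun j => M.D j ω) (M.N i ω)

/-- The vector of continuous observables `(Y, Z^c)`. -/
def YZc (M : Model P Ω E q r) (i : P) (ω : Ω) : ℝ × (Fin q → ℝ) := (M.Y i ω, (M.Z i ω).1)

/-- The treated members of a neighbour set. Together with the neighbour set it carries the same
information as the set and the treatments of its members. -/
def treatedIn (M : Model P Ω E q r) (A : P → Ω → Finset P) (i : P) (ω : Ω) : Finset P :=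
  (A i ω).filter (fun j => M.D j ω = true)

/-- The conditioning variable `(Z, |N*|)`. -/
def ZN (M : Model P Ω E q r) (i : P) (ω : Ω) : Cov q r × ℕ := (M.Z i ω, (M.Nstar i ω).card)

variable [MeasurableSpace Ω] [MeasurableSpace E]

/-- Standing conventions: everything is measurable, the latent network is undirected, and no unit
is its own neighbour. -/
structure Regular (M : Model P Ω E q r) : Prop where
  measD : ∀ i, Measurable (M.D i)
  measNstar : ∀ i, Measurable (M.Nstar i)
  measN : ∀ i, Measurable (M.N i)
  measNt : ∀ i, Measurable (M.Nt i)
  measZ : ∀ i, Measurable (M.Z i)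
  measEps : ∀ i, Measurable (M.eps i)
  measRt : ∀ i, Measurable
    (fun x : (P → Bool) × (P → Finset P) × (P → Cov q r) × E => M.rt i x.1 x.2.1 x.2.2.1 x.2.2.2)
  network : ∀ ω, IsNetwork (fun i => M.Nstar i ω)
  noSelf : ∀ i ω, i ∉ M.N i ω ∧ i ∉ M.Nt i ω

/-- Network interference: the outcome depends only on the own treatment, the degree, the number of
treated neighbours, the own covariates and the own error. -/
def Interference [TopologicalSpace E] (M : Model P Ω E q r) (μ : Measure Ω) : Prop :=
  ∀ (i k : P) (D D' : P → Bool) (A A' : P → Finset P) (z z' : P → Cov q r),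
    IsNetwork A → IsNetwork A' →
    ∀ e ∈ (μ.map (M.eps i)).support ∪ (μ.map (M.eps k)).support,
      D i = D' k → (A i).card = (A' k).card →
      treatedCount D (A i) = treatedCount D' (A' k) → z i = z' k →
      M.rt i D A z e = M.rt k D' A' z' e

/-- Randomized treatment (with both treatment arms present) and unconfounded network. -/
structure Unconfounded (M : Model P Ω E q r) (μ : Measure Ω) : Prop where
  indepD : iIndepFun (fun i => M.D i) μ
  identD : ∀ i j, IdentDistrib (M.D i) (M.D j) μ μ
  overlap : ∀ i, 0 < μ {ω | M.D i ω = true} ∧ 0 < μ {ω | M.D i ω = false}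
  randomized : IndepFun (fun ω i => M.D i ω) (fun ω j => (M.eps j ω, M.Z j ω, M.Nstar j ω)) μ
  network : ∀ i, IndepGiven μ (M.eps i)
    (fun ω => (M.Nstar i ω, M.treatedIn M.Nstar i ω)) (M.ZN i)

/-- Distribution: `Z` is i.i.d., the conditional law of `|N*|` given `Z`, and that of the error
given `(Z, |N*|)`, do not depend on the unit (equivalently, the joint laws do not). -/
structure Distribution (M : Model P Ω E q r) (μ : Measure Ω) : Prop where
  indepZ : iIndepFun (fun i => M.Z i) μ
  identZ : ∀ i j, IdentDistrib (M.Z i) (M.Z j) μ μ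
  identNstar : ∀ i j, IdentDistrib (M.ZN i) (M.ZN j) μ μ
  identEps : ∀ i j, IdentDistrib (fun ω => (M.eps i ω, M.ZN i ω))
    (fun ω => (M.eps j ω, M.ZN j ω)) μ μ

/-- Nondifferential misclassification, satisfied by the two proxies. -/
structure Nondifferential (M : Model P Ω E q r) (μ : Measure Ω) : Prop where
  randomized : IndepFun (fun ω i => M.D i ω)
    (fun ω j => (M.eps j ω, M.Z j ω, M.Nstar j ω, M.N j ω, M.Nt j ω)) μ
  network : ∀ i, IndepGiven μ (M.eps i)
    (fun ω => (M.Nstar i ω, M.treatedIn M.Nstar i ω, M.N i ω, M.treatedIn M.N i ω,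
      M.Nt i ω, M.treatedIn M.Nt i ω)) (M.ZN i)
  identN : ∀ i j, IdentDistrib (fun ω => ((M.N i ω).card, M.ZN i ω))
    (fun ω => ((M.N j ω).card, M.ZN j ω)) μ μ
  identNt : ∀ i j, IdentDistrib (fun ω => ((M.Nt i ω).card, M.ZN i ω))
    (fun ω => ((M.Nt j ω).card, M.ZN j ω)) μ μ

/-- Exclusion restriction: the two observed degrees are independent given `(Z, |N*|)`. -/
def Exclusion (M : Model P Ω E q r) (μ : Measure Ω) : Prop :=
  ∀ i, IndepGiven μ (fun ω => (M.N i ω).card) (fun ω => (M.Nt i ω).card) (M.ZN i)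

/-- Sparsity: the three degrees have the same finite support `{0, ..., K - 1}`. -/
def Sparse (M : Model P Ω E q r) (μ : Measure Ω) (K : ℕ) : Prop :=
  ∀ i, ∀ n : ℕ, (0 < μ {ω | (M.Nstar i ω).card = n} ↔ n < K) ∧
    (0 < μ {ω | (M.N i ω).card = n} ↔ n < K) ∧ (0 < μ {ω | (M.Nt i ω).card = n} ↔ n < K)

/-- One type of measurement error: no false positives or no false negatives. -/
def OneType (M : Model P Ω E q r) (μ : Measure Ω) : Prop :=
  ∀ i, (∀ᵐ ω ∂μ, M.N i ω ⊆ M.Nstar i ω) ∨ (∀ᵐ ω ∂μ, M.Nstar i ω ⊆ M.N i ω)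

/-- The support of `(Y, Z^c)`. -/
def suppC (M : Model P Ω E q r) (μ : Measure Ω) (i : P) : Set (ℝ × (Fin q → ℝ)) :=
  (μ.map (M.YZc i)).support

/-- The support of `Z`. -/
def suppZ (M : Model P Ω E q r) (μ : Measure Ω) (i : P) : Set (Cov q r) :=
  (μ.map (M.Z i)).support

/-- The latent functions of unit `i`: `pS n z` is the probability of `|N*| = n`, `F n m z` that of
`|N| = n` given `|N*| = m`, `Ft n m z` that of `|Nt| = n` given `|N*| = m`, and `T m z` the mean of
`Y` given `|N*| = m`, all given `Z = z`. The event `|N*| = m` that is conditioned on has positive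
conditional probability at every `z`. -/
structure IsLatent (M : Model P Ω E q r) (μ : Measure Ω) (i : P) (K : ℕ)
    (pS : Fin K → Cov q r → ℝ) (F Ft : Fin K → Fin K → Cov q r → ℝ) (T : Fin K → Cov q r → ℝ) :
    Prop where
  condNstar : ∀ m : Fin K,
    IsCondProb μ {ω | (M.Nstar i ω).card = (m : ℕ)} Set.univ (M.Z i) (M.suppZ μ i) (pS m)
  pos : ∀ m : Fin K, ∀ z ∈ M.suppZ μ i, 0 < pS m z
  condN : ∀ n m : Fin K,
    IsCondProb μ {ω | (M.N i ω).card = (n : ℕ)} {ω | (M.Nstar i ω).card = (m : ℕ)}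
      (M.Z i) (M.suppZ μ i) (F n m)
  condNt : ∀ n m : Fin K,
    IsCondProb μ {ω | (M.Nt i ω).card = (n : ℕ)} {ω | (M.Nstar i ω).card = (m : ℕ)}
      (M.Z i) (M.suppZ μ i) (Ft n m)
  condY : ∀ m : Fin K,
    IsCondMean μ (M.Y i) {ω | (M.Nstar i ω).card = (m : ℕ)} (M.Z i) (M.suppZ μ i) (T m)

end Model

/-- Rank condition on the matrices of conditional probabilities of the observed degrees. -/
def RankCondition {q r K : ℕ} (supp : Set (Cov q r)) (F Ft : Fin K → Fin K → Cov q r → ℝ) : Prop :=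
  ∀ z ∈ supp, (Matrix.of fun n m => F n m z).rank = K ∧ (Matrix.of fun n m => Ft n m z).rank = K

/-- Conditions for the eigen-decomposition: the conditional means of `Y` are distinct, and correct
reporting of the degree is more likely than any other report. -/
def EigenCondition {q r K : ℕ} (supp : Set (Cov q r)) (F Ft : Fin K → Fin K → Cov q r → ℝ)
    (T : Fin K → Cov q r → ℝ) : Prop :=
  ∀ z ∈ supp, (∀ m m', m ≠ m' → T m z ≠ T m' z) ∧
    ∀ m n, n ≠ m → F n m z < F m m z ∧ Ft n m z < Ft m m z

/-- Candidate values of the nuisance parameter: five functions in the place of the probability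
functions of `(|Nt|, |N|, Y, Z)`, `(|Nt|, |N|, Z)`, `(S, |N|, Z)`, `(|N|, Z)` and `Z`. -/
structure Nuisance (q r : ℕ) where
  fNNYZ : ℕ → ℕ → ℝ → Cov q r → ℝ
  fNNZ : ℕ → ℕ → Cov q r → ℝ
  fSNZ : ℕ → ℕ → Cov q r → ℝ
  fNZ : ℕ → Cov q r → ℝ
  fZ : Cov q r → ℝ

/-- Lebesgue measure times counting measure for `(Y, Z)`, on the set where `(Y, Z^c)` lies
in `C`. -/
def baseYZ {q : ℕ} (r : ℕ) (C : Set (ℝ × (Fin q → ℝ))) : Measure (ℝ × Cov q r) :=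
  ((volume : Measure ℝ).prod ((volume : Measure (Fin q → ℝ)).prod Measure.count)).restrict
    {w | (w.1, w.2.1) ∈ C}

/-- Lebesgue measure times counting measure for `Z`, on the set where `Z^c` lies in the projection
of `C`. -/
def baseZ {q : ℕ} (r : ℕ) (C : Set (ℝ × (Fin q → ℝ))) : Measure (Cov q r) :=
  ((volume : Measure (Fin q → ℝ)).prod Measure.count).restrict {z | z.1 ∈ Prod.snd '' C}

/-- `g` is the nonnegative density, with respect to `base`, of the law of `X` on the event `A`. -/
def IsDensityOn {Ω α : Type*} [MeasurableSpace Ω] [MeasurableSpace α] (μ : Measure Ω) (A : Set Ω)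
    (X : Ω → α) (base : Measure α) (g : α → ℝ) : Prop :=
  (μ.restrict A).map X = base.withDensity (fun x => ENNReal.ofReal (g x))

/-- `g0` collects the true probability functions of the observables of unit `i`. -/
structure IsTrueNuisance {P Ω E : Type*} {q r : ℕ} [MeasurableSpace Ω] [MeasurableSpace E]
    (M : Model P Ω E q r) (μ : Measure Ω) (i : P) (K : ℕ) (g0 : Nuisance q r) : Prop where
  nnyz : ∀ a < K, ∀ b < K, IsDensityOn μ {ω | (M.Nt i ω).card = a ∧ (M.N i ω).card = b}
    (fun ω => (M.Y i ω, M.Z i ω)) (baseYZ r (M.suppC μ i)) (fun w => g0.fNNYZ a b w.1 w.2)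
  nnz : ∀ a < K, ∀ b < K, IsDensityOn μ {ω | (M.Nt i ω).card = a ∧ (M.N i ω).card = b}
    (M.Z i) (baseZ r (M.suppC μ i)) (g0.fNNZ a b)
  snz : ∀ n < K, ∀ s ≤ n, IsDensityOn μ {ω | M.S i ω = s ∧ (M.N i ω).card = n}
    (M.Z i) (baseZ r (M.suppC μ i)) (g0.fSNZ s n)
  nz : ∀ n < K, IsDensityOn μ {ω | (M.N i ω).card = n}
    (M.Z i) (baseZ r (M.suppC μ i)) (g0.fNZ n)
  z : IsDensityOn μ Set.univ (M.Z i) (baseZ r (M.suppC μ i)) g0.fZ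

/-- All elements of `g0` are nonnegative on the supports, and bounded and twice continuously
differentiable in the continuous arguments, with bounded derivatives, on an open set containing the
support `C` of `(Y, Z^c)`, respectively its projection. -/
structure SmoothNuisance {q r : ℕ} (C : Set (ℝ × (Fin q → ℝ))) (K : ℕ) (g0 : Nuisance q r) :
    Prop where
  nnyz : ∀ a < K, ∀ b < K, ∀ d : Fin r, (∀ w ∈ C, 0 ≤ g0.fNNYZ a b w.1 (w.2, d)) ∧
    SmoothNear (fun w : ℝ × (Fin q → ℝ) => g0.fNNYZ a b w.1 (w.2, d)) C
  nnz : ∀ a < K, ∀ b < K, ∀ d : Fin r, (∀ x ∈ Prod.snd '' C, 0 ≤ g0.fNNZ a b (x, d)) ∧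
    SmoothNear (fun x : Fin q → ℝ => g0.fNNZ a b (x, d)) (Prod.snd '' C)
  snz : ∀ n < K, ∀ s ≤ n, ∀ d : Fin r, (∀ x ∈ Prod.snd '' C, 0 ≤ g0.fSNZ s n (x, d)) ∧
    SmoothNear (fun x : Fin q → ℝ => g0.fSNZ s n (x, d)) (Prod.snd '' C)
  nz : ∀ n < K, ∀ d : Fin r, (∀ x ∈ Prod.snd '' C, 0 ≤ g0.fNZ n (x, d)) ∧
    SmoothNear (fun x : Fin q → ℝ => g0.fNZ n (x, d)) (Prod.snd '' C)
  z : ∀ d : Fin r, (∀ x ∈ Prod.snd '' C, 0 ≤ g0.fZ (x, d)) ∧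
    SmoothNear (fun x : Fin q → ℝ => g0.fZ (x, d)) (Prod.snd '' C)

namespace Nuisance

variable {q r : ℕ}

/-- Sup-norm distance of two nuisance parameters: the supremum over all components and all
arguments in the supports. `C` is the support of `(Y, Z^c)` and `supp` that of `Z`. -/
def dist (K : ℕ) (C : Set (ℝ × (Fin q → ℝ))) (supp : Set (Cov q r)) (g g' : Nuisance q r) : ℝ≥0∞ :=
  (⨆ (a : Fin K) (b : Fin K) (y : ℝ) (z : Cov q r) (_ : z ∈ supp) (_ : (y, z.1) ∈ C),
    ‖g.fNNYZ a b y z - g'.fNNYZ a b y z‖ₑ) ⊔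
  (⨆ (a : Fin K) (b : Fin K) (z : Cov q r) (_ : z ∈ supp), ‖g.fNNZ a b z - g'.fNNZ a b z‖ₑ) ⊔
  (⨆ (n : Fin K) (s : ℕ) (_ : s ≤ n) (z : Cov q r) (_ : z ∈ supp),
    ‖g.fSNZ s n z - g'.fSNZ s n z‖ₑ) ⊔
  (⨆ (n : Fin K) (z : Cov q r) (_ : z ∈ supp), ‖g.fNZ n z - g'.fNZ n z‖ₑ) ⊔
  (⨆ (z : Cov q r) (_ : z ∈ supp), ‖g.fZ z - g'.fZ z‖ₑ)

/-- The density component is measurable in `y`, so that its integral over `y` makes sense. -/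
def Admissible (g : Nuisance q r) : Prop := ∀ a b z, Measurable fun y => g.fNNYZ a b y z

/-- The matrix of `f(|Nt| = a, |N| = b | Z = z)`. -/
def matF (K : ℕ) (g : Nuisance q r) (z : Cov q r) : Matrix (Fin K) (Fin K) ℝ :=
  Matrix.of fun a b => g.fNNZ a b z / g.fZ z

/-- The matrix of the integrals of `y * f(|Nt| = a, |N| = b, y | Z = z)` over `y`. -/
def matE (K : ℕ) (C : Set (ℝ × (Fin q → ℝ))) (g : Nuisance q r) (z : Cov q r) :
    Matrix (Fin K) (Fin K) ℝ :=
  Matrix.of fun a b => ∫ y in {y : ℝ | (y, z.1) ∈ C}, y * (g.fNNYZ a b y z / g.fZ z)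

/-- The matrix whose eigenvectors are the columns `f(|N| = · | Z = z, |N*| = m)`. The first index
of `matE` and `matF` is that of the second proxy, hence the transposes. -/
def matB (K : ℕ) (C : Set (ℝ × (Fin q → ℝ))) (g : Nuisance q r) (z : Cov q r) :
    Matrix (Fin K) (Fin K) ℝ :=
  (g.matE K C z).transpose * ((g.matF K z).transpose)⁻¹

/-- The columns of `V` are eigenvectors of `B` for distinct eigenvalues, normalized to have sum
one, and ordered so that the largest entry of the `m`-th column is its `m`-th entry. -/
def _root_.NetMis.IsEigenSystem {K : ℕ} (B V : Matrix (Fin K) (Fin K) ℝ) : Prop :=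
  (∃ lam : Fin K → ℝ, Function.Injective lam ∧ B * V = V * Matrix.diagonal lam) ∧
  (∀ m, ∑ n, V n m = 1) ∧ ∀ m n, n ≠ m → V n m < V m m

open Classical in
/-- The normalized and ordered eigenvector matrix of `matB`, i.e. the plug-in value of
`f(|N| = n | Z = z, |N*| = m)` (zero if there is no such eigenvector matrix; it is unique if it
exists). -/
def psi (K : ℕ) (C : Set (ℝ × (Fin q → ℝ))) (g : Nuisance q r) (z : Cov q r) :
    Matrix (Fin K) (Fin K) ℝ :=
  if h : ∃ V, IsEigenSystem (g.matB K C z) V then h.choose else 0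

/-- Plug-in value of `f(S = s | Z = z, |N| = n)`, which is also that of
`f(S* = s | Z = z, |N*| = n)`: both are the same binomial probability. -/
def binS (g : Nuisance q r) (s n : ℕ) (z : Cov q r) : ℝ := g.fSNZ s n z / g.fNZ n z

/-- Plug-in value of `f(|N| = n | Z = z)`. -/
def fNgZ (g : Nuisance q r) (n : ℕ) (z : Cov q r) : ℝ := g.fNZ n z / g.fZ z

/-- Plug-in value of `f(|N*| = m | Z = z)`. -/
def fNstar (K : ℕ) (C : Set (ℝ × (Fin q → ℝ))) (g : Nuisance q r) (z : Cov q r) : Fin K → ℝ :=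
  Matrix.mulVec (g.psi K C z)⁻¹ (fun n : Fin K => g.fNgZ n z)

/-- Plug-in value of `f(S = s | S* = s', Z = z, |N*| = n', |N| = n)`. If `n' ≤ n`, it is the
binomial probability of `s - s'` treated units among `n - n'`. If `n < n'`, the conditional
probability of `S* = s'` given `S = s` is the binomial probability of `s' - s` treated units among
`n' - n`, which is then rescaled. -/
def fSgS (g : Nuisance q r) (s' n' s n : ℕ) (z : Cov q r) : ℝ :=
  if n' ≤ n then
    if s' ≤ s ∧ s - s' ≤ n - n' then g.binS (s - s') (n - n') z else 0
  else
    if s ≤ s' ∧ s' - s ≤ n' - n then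
      g.binS (s' - s) (n' - n) z * g.binS s n z / g.binS s' n' z
    else 0

/-- The map `phi` from nuisance parameters to the latent distribution, i.e. the plug-in value of
`f(S* = s', |N*| = n' | D = d, S = s, Z = z, |N| = n)`, which does not depend on `d`. -/
def phi (K : ℕ) (C : Set (ℝ × (Fin q → ℝ))) (g : Nuisance q r) (s' : ℕ) (n' : Fin K) (s : ℕ)
    (n : Fin K) (z : Cov q r) : ℝ :=
  g.fSgS s' n' s n z * g.binS s' n' z * g.psi K C z n n' * g.fNstar K C z n' /
    (g.binS s n z * g.fNgZ n z)

end Nuisance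

/-- Candidate latent distribution functions: arguments `s', n', s, n, z`. -/
abbrev LatentDist (q r K : ℕ) : Type := ℕ → Fin K → ℕ → Fin K → Cov q r → ℝ

/-- Sup-norm distance of two latent distribution functions. -/
def latentDist {q r K : ℕ} (supp : Set (Cov q r)) (p p' : LatentDist q r K) : ℝ≥0∞ :=
  ⨆ (n' : Fin K) (s' : ℕ) (_ : s' ≤ n') (n : Fin K) (s : ℕ) (_ : s ≤ n) (z : Cov q r)
    (_ : z ∈ supp), ‖p s' n' s n z - p' s' n' s n z‖ₑ

/-- `p` is the true latent distribution of `(S*, |N*|)` given `(D, S, Z, |N|)` of unit `i`. -/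
def IsLatentDist {P Ω E : Type*} {q r : ℕ} [MeasurableSpace Ω] [MeasurableSpace E]
    (M : Model P Ω E q r) (μ : Measure Ω) (i : P) (K : ℕ) (p : LatentDist q r K) : Prop :=
  ∀ (d : Bool) (n' : Fin K) (s' : ℕ) (n : Fin K) (s : ℕ), s' ≤ n' → s ≤ n →
    IsCondProb μ {ω | M.Sstar i ω = s' ∧ (M.Nstar i ω).card = n'}
      {ω | M.D i ω = d ∧ M.S i ω = s ∧ (M.N i ω).card = n} (M.Z i) (M.suppZ μ i) (p s' n' s n)

/-- Kernel functions: nonnegative, differentiable with bounded derivative, symmetric, integrating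
to one, with finite and positive second moment and square integral. -/
structure IsKernel (κ : ℝ → ℝ) : Prop where
  nonneg : ∀ v, 0 ≤ κ v
  diff : Differentiable ℝ κ
  derivBdd : ∃ C, ∀ v, |deriv κ v| ≤ C
  integrable : Integrable κ
  integral_one : ∫ v, κ v = 1
  symm : ∀ v, κ v = κ (-v)
  integrable_sq_mul : Integrable fun v => v ^ 2 * κ v
  second_pos : 0 < ∫ v, v ^ 2 * κ v
  integrable_sq : Integrable fun v => κ v ^ 2
  square_pos : 0 < ∫ v, κ v ^ 2

open Classical in
/-- Kernel estimator of a probability function with `Q` continuous arguments from `N`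
observations: `Wc j` are the continuous variables of observation `j`, and `hit j` says that its
discrete variables match. -/
def kernelEst {Q : ℕ} (κ : ℝ → ℝ) (h : ℝ) (N : ℕ) (Wc : ℕ → Fin Q → ℝ) (hit : ℕ → Prop)
    (w : Fin Q → ℝ) : ℝ :=
  (1 / (N : ℝ)) * ∑ j ∈ Finset.range N,
    (1 / h ^ Q * ∏ l, κ ((Wc j l - w l) / h)) * (if hit j then 1 else 0)

/-- The kernel estimator of the nuisance parameter from the first `N` sampled units. -/
def gammaHat {P Ω E : Type*} {q r : ℕ} (M : Model P Ω E q r) (unit : ℕ → P) (κ : ℝ → ℝ) (h : ℝ)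
    (N : ℕ) (ω : Ω) : Nuisance q r where
  fNNYZ a b y z := kernelEst κ h N
    (fun j => (Fin.cons (M.Y (unit j) ω) (M.Z (unit j) ω).1 : Fin (q + 1) → ℝ))
    (fun j => (M.Nt (unit j) ω).card = a ∧ (M.N (unit j) ω).card = b ∧ (M.Z (unit j) ω).2 = z.2)
    (Fin.cons y z.1)
  fNNZ a b z := kernelEst κ h N (fun j => (M.Z (unit j) ω).1)
    (fun j => (M.Nt (unit j) ω).card = a ∧ (M.N (unit j) ω).card = b ∧ (M.Z (unit j) ω).2 = z.2)
    z.1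
  fSNZ s n z := kernelEst κ h N (fun j => (M.Z (unit j) ω).1)
    (fun j => M.S (unit j) ω = s ∧ (M.N (unit j) ω).card = n ∧ (M.Z (unit j) ω).2 = z.2) z.1
  fNZ n z := kernelEst κ h N (fun j => (M.Z (unit j) ω).1)
    (fun j => (M.N (unit j) ω).card = n ∧ (M.Z (unit j) ω).2 = z.2) z.1
  fZ z := kernelEst κ h N (fun j => (M.Z (unit j) ω).1)
    (fun j => (M.Z (unit j) ω).2 = z.2) z.1

/-- `X N = O_p(R N)` as `N` tends to infinity. -/
def IsBigOp {Ω : Type*} [MeasurableSpace Ω] (μ : Measure Ω) (X R : ℕ → Ω → ℝ≥0∞) : Prop :=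
  ∀ δ : ℝ≥0∞, 0 < δ → ∃ c : ℝ≥0, ∀ᶠ N in atTop, μ {ω | (c : ℝ≥0∞) * R N ω < X N ω} ≤ δ

end NetMis

end

/-!
The proof has two halves: the plug-in map `phi` reproduces the latent distribution at the true
probability functions, and it is Lipschitz there, uniformly over the covariate values.

*Identification.* Fix a covariate value `z` and let `A` and `At` be the matrices of conditional
probabilities of the two reported degrees given the latent degree, `w` the distribution of the
latent degree and `t` the conditional means of the outcome. The two reported degrees are
independent given the latent one, so `F' = A diag(w) At'`. After averaging over the randomized
treatments, the outcome is a function of the error and the covariates once the latent degree is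
given, and the error is independent of the reported degrees; so `E' = A diag(t) diag(w) At'`. Hence
`E' (F')⁻¹ = A diag(t) A⁻¹`, whose normalized and ordered eigenvector matrix is `A`, and `w` is
`A⁻¹` applied to the distribution of the reported degree (`LatentFactors.psi_eq`,
`LatentFactors.fNstar_eq`). Since treatments are independent of everything else, the number of
treated units in a set of `n` neighbours is binomial, and if one neighbour set contains the other,
the treated units of the smaller set and of the difference are independent binomials. This gives
the joint law of the latent and the reported quantities (`Model.sameMean_D_Sstar_S`), and `phi` is
its ratio to the law of the reported ones (`LatentFactors.phi_mul_eq`).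

All statements about conditional means are expressed by `SameMean`: two variables have the same
integrals over all events determined by the covariates, within a given event. Identities between
functions continuous on the support of the covariates then hold at every point of it
(`SameMean.eqOn_support`). The integral of `y` against the density over the section
`{y | (y, z.1) ∈ C}` is not obviously continuous in `z`, since the sections vary with `z`.
Because `C` is convex, it is continuous along segments (`tendsto_integral_fiber`), and this
suffices to pass from almost every `z` to every `z` (`integral_fiber_eq`).

*Lipschitz bound.* At a fixed `z`, `phi` depends on the nuisance parameter through finitely many
numbers only, its `LocalValues`, and these are Lipschitz in the nuisance parameter because `C` is
bounded. As a function of these numbers `phi` is built from quotients, matrix inverses and the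
eigenvector matrix, and the latter is continuously differentiable at a matrix with simple
eigenvalues by the inverse function theorem (`contDiffAt_eigMat`). The local values of the true
nuisance parameter form a compact set as `z` runs through the support, so one Lipschitz constant
and one radius serve for all `z` (`exists_uniform_lipschitz`, `exists_latentDist_le`). The radius
and the constant do not involve the sequence `η`, and the stochastic statement follows because the
kernel estimator is an admissible nuisance parameter: outside the neighbourhood there is nothing to
bound, inside it the bound holds for every outcome of the sample.
-/


noncomputable section

namespace NetMis

/-! ### Eigenvectors as a function of the matrix -/

section plugInMap

attribute [local instance] Matrix.linftyOpNormedRing Matrix.linftyOpNormedAlgebra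

variable {K : ℕ}

/-- Uniqueness of the normalized and ordered eigenvector matrix, if one such matrix is invertible:
its eigenvalues are then all the eigenvalues and are simple, so every column of another such matrix
is one of its columns, and the position of the largest entry says which one. -/
theorem IsEigenSystem.eq_of_det_ne_zero {B V V' : Matrix (Fin K) (Fin K) ℝ}
    (h : IsEigenSystem B V) (hV : V.det ≠ 0) (h' : IsEigenSystem B V') : V' = V := by
  obtain ⟨⟨lam, hinj, hB⟩, hsum, hmax⟩ := h
  obtain ⟨⟨lam', -, hB'⟩, hsum', hmax'⟩ := h'
  have hu : IsUnit V.det := isUnit_iff_ne_zero.2 hV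
  set X := V⁻¹ * V' with hX
  have hVX : V * X = V' := by rw [hX, ← Matrix.mul_assoc, Matrix.mul_nonsing_inv _ hu, one_mul]
  have hcomm : Matrix.diagonal lam * X = X * Matrix.diagonal lam' := by
    have : V * (Matrix.diagonal lam * X) = V * (X * Matrix.diagonal lam') := by
      rw [← Matrix.mul_assoc, ← hB, Matrix.mul_assoc, hVX, hB', ← hVX, Matrix.mul_assoc]
    have h2 := congrArg (fun A => V⁻¹ * A) this
    simpa [← Matrix.mul_assoc, Matrix.nonsing_inv_mul _ hu] using h2
  have hent : ∀ k j, (lam k - lam' j) * X k j = 0 := by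
    intro k j
    have := congrFun (congrFun hcomm k) j
    rw [Matrix.diagonal_mul, Matrix.mul_diagonal] at this
    linarith
  have hcol : ∀ j, ∃ k, ∀ n, V' n j = V n k := by
    intro j
    have hne : ∃ k, X k j ≠ 0 := by
      by_contra! hall
      have : ∑ n, V' n j = 0 := by
        refine Finset.sum_eq_zero fun n _ => ?_
        rw [← hVX, Matrix.mul_apply]
        exact Finset.sum_eq_zero fun k _ => by rw [hall k, mul_zero]
      rw [hsum' j] at this
      exact one_ne_zero this
    obtain ⟨k, hk⟩ := hne
    have hlk : lam k = lam' j := by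
      have := (mul_eq_zero.1 (hent k j)).resolve_right hk
      linarith
    have hz : ∀ l, l ≠ k → X l j = 0 := by
      intro l hl
      refine (mul_eq_zero.1 (hent l j)).resolve_left fun h0 => hl (hinj ?_)
      linarith
    have hval : ∀ n, V' n j = V n k * X k j := by
      intro n
      rw [← hVX, Matrix.mul_apply, Finset.sum_eq_single k]
      · intro l _ hl; rw [hz l hl, mul_zero]
      · simp
    have hone : X k j = 1 := by
      have h1 := hsum' j
      simp_rw [hval, ← Finset.sum_mul, hsum k, one_mul] at h1
      exact h1
    exact ⟨k, fun n => by rw [hval, hone, mul_one]⟩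
  ext n j
  obtain ⟨k, hk⟩ := hcol j
  have hkj : k = j := by
    by_contra hne
    have h1 := hmax' j k hne
    have h2 := hmax k j (Ne.symm hne)
    rw [hk, hk] at h1
    exact lt_asymm h1 h2
  rw [hk, hkj]

open Classical in
/-- The normalized and ordered eigenvector matrix of `B`, zero if there is none. -/
def eigMat (B : Matrix (Fin K) (Fin K) ℝ) : Matrix (Fin K) (Fin K) ℝ :=
  if h : ∃ V, IsEigenSystem B V then h.choose else 0

theorem Nuisance.psi_eq_eigMat {q r : ℕ} (C : Set (ℝ × (Fin q → ℝ))) (g : Nuisance q r)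
    (z : Cov q r) : g.psi K C z = eigMat (g.matB K C z) := rfl

theorem IsEigenSystem.eigMat_eq {B V : Matrix (Fin K) (Fin K) ℝ}
    (h : IsEigenSystem B V) (hV : V.det ≠ 0) : eigMat B = V := by
  have hex : ∃ V, IsEigenSystem B V := ⟨V, h⟩
  rw [eigMat, dif_pos hex]
  exact h.eq_of_det_ne_zero hV hex.choose_spec

/-- The eigenvector equations as a map of the matrix `B`, the eigenvectors `V` and the eigenvalues
`lam`: a normalized eigenvector matrix of `B` with eigenvalues `lam` is a solution of
`eigMap (B, V, lam) = (B, 0, 1)`. The first component is kept so that the inverse function theorem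
applies. -/
def eigMap (x : Matrix (Fin K) (Fin K) ℝ × Matrix (Fin K) (Fin K) ℝ × (Fin K → ℝ)) :
    Matrix (Fin K) (Fin K) ℝ × Matrix (Fin K) (Fin K) ℝ × (Fin K → ℝ) :=
  (x.1, x.1 * x.2.1 - x.2.1 * Matrix.diagonal x.2.2, fun j => ∑ n, x.2.1 n j)

theorem contDiff_entry (n j : Fin K) {m : WithTop ℕ∞} :
    ContDiff ℝ m (fun V : Matrix (Fin K) (Fin K) ℝ => V n j) :=
  (LinearMap.toContinuousLinearMap (Matrix.entryLinearMap ℝ ℝ n j)).contDiff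

/-- Column sums as a continuous linear map. -/
def colSum : Matrix (Fin K) (Fin K) ℝ →L[ℝ] (Fin K → ℝ) :=
  LinearMap.toContinuousLinearMap
    { toFun := fun V j => ∑ n, V n j
      map_add' := fun V W => by ext j; simp [Finset.sum_add_distrib]
      map_smul' := fun c V => by ext j; simp [Finset.mul_sum] }

/-- The embedding of vectors as diagonal matrices, as a continuous linear map. -/
def diagL : (Fin K → ℝ) →L[ℝ] Matrix (Fin K) (Fin K) ℝ :=
  LinearMap.toContinuousLinearMap (Matrix.diagonalLinearMap (Fin K) ℝ ℝ)

theorem contDiff_eigMap {m : WithTop ℕ∞} : ContDiff ℝ m (eigMap (K := K)) := by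
  have h1 : ContDiff ℝ m (fun x : Matrix (Fin K) (Fin K) ℝ × Matrix (Fin K) (Fin K) ℝ ×
      (Fin K → ℝ) => x.1) := contDiff_fst
  have h2 : ContDiff ℝ m (fun x : Matrix (Fin K) (Fin K) ℝ × Matrix (Fin K) (Fin K) ℝ ×
      (Fin K → ℝ) => x.2.1) := contDiff_fst.comp contDiff_snd
  have h3 : ContDiff ℝ m (fun x : Matrix (Fin K) (Fin K) ℝ × Matrix (Fin K) (Fin K) ℝ ×
      (Fin K → ℝ) => diagL x.2.2) := diagL.contDiff.comp (contDiff_snd.comp contDiff_snd)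
  exact h1.prodMk (((h1.mul h2).sub (h2.mul h3)).prodMk (colSum.contDiff.comp h2))

theorem fderiv_eigMap (B V H W : Matrix (Fin K) (Fin K) ℝ) (lam mu : Fin K → ℝ) :
    fderiv ℝ eigMap (B, V, lam) (H, W, mu) =
      (H, B * W + H * V - (V * Matrix.diagonal mu + W * Matrix.diagonal lam),
        fun j => ∑ n, W n j) := by
  set x := (B, V, lam)
  have h1 : HasFDerivAt (fun x : Matrix (Fin K) (Fin K) ℝ × Matrix (Fin K) (Fin K) ℝ ×
      (Fin K → ℝ) => x.1) (ContinuousLinearMap.fst ℝ _ _) x := hasFDerivAt_fst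
  have h2 : HasFDerivAt (fun x : Matrix (Fin K) (Fin K) ℝ × Matrix (Fin K) (Fin K) ℝ ×
      (Fin K → ℝ) => x.2.1) ((ContinuousLinearMap.fst ℝ _ _).comp
        (ContinuousLinearMap.snd ℝ _ _)) x :=
    hasFDerivAt_fst.comp x hasFDerivAt_snd
  have h3 : HasFDerivAt (fun x : Matrix (Fin K) (Fin K) ℝ × Matrix (Fin K) (Fin K) ℝ ×
      (Fin K → ℝ) => diagL x.2.2) (diagL.comp ((ContinuousLinearMap.snd ℝ _ _).comp
        (ContinuousLinearMap.snd ℝ _ _))) x :=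
    diagL.hasFDerivAt.comp x (hasFDerivAt_snd.comp x hasFDerivAt_snd)
  have h4 := (colSum (K := K)).hasFDerivAt.comp x h2
  have h := h1.prodMk (((h1.mul' h2).sub (h2.mul' h3)).prodMk h4)
  have h5 : HasFDerivAt eigMap _ x := h
  rw [h5.fderiv]
  rfl

/-- The inverse function theorem applies to `eigMap` at simple eigenvalues: in the eigenbasis `V`, a
first-order change of the eigenvectors has no off-diagonal part because the eigenvalues differ, and
no diagonal part because of the normalization. -/
theorem fderiv_eigMap_injective {B V : Matrix (Fin K) (Fin K) ℝ} {lam : Fin K → ℝ}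
    (hinj : Function.Injective lam) (hB : B * V = V * Matrix.diagonal lam)
    (hsum : ∀ m, ∑ n, V n m = 1) (hV : V.det ≠ 0) :
    Function.Injective (fderiv ℝ eigMap (B, V, lam)) := by
  have hu : IsUnit V.det := isUnit_iff_ne_zero.2 hV
  rw [injective_iff_map_eq_zero]
  rintro ⟨H, W, mu⟩ h0
  rw [fderiv_eigMap] at h0
  simp only [Prod.mk_eq_zero] at h0
  obtain ⟨rfl, h1, h2⟩ := h0
  set X := V⁻¹ * W with hX
  have hVX : V * X = W := by rw [hX, ← Matrix.mul_assoc, Matrix.mul_nonsing_inv _ hu, one_mul]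
  have h3 : Matrix.diagonal lam * X = Matrix.diagonal mu + X * Matrix.diagonal lam := by
    have : V * (Matrix.diagonal lam * X) = V * (Matrix.diagonal mu + X * Matrix.diagonal lam) := by
      rw [← Matrix.mul_assoc, ← hB, Matrix.mul_assoc, hVX, mul_add, ← Matrix.mul_assoc, hVX]
      rw [zero_mul, add_zero] at h1
      exact sub_eq_zero.1 h1
    have h2 := congrArg (fun A => V⁻¹ * A) this
    simpa [← Matrix.mul_assoc, Matrix.nonsing_inv_mul _ hu] using h2
  have hmu : mu = 0 := by
    ext j
    have := congrFun (congrFun h3 j) j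
    rw [Matrix.diagonal_mul, Matrix.add_apply, Matrix.mul_diagonal,
      Matrix.diagonal_apply_eq] at this
    simp only [Pi.zero_apply]
    linarith
  have hoff : ∀ k j, k ≠ j → X k j = 0 := by
    intro k j hkj
    have := congrFun (congrFun h3 k) j
    rw [Matrix.diagonal_mul, Matrix.add_apply, Matrix.mul_diagonal,
      Matrix.diagonal_apply_ne _ hkj] at this
    have h4 : (lam k - lam j) * X k j = 0 := by linarith
    exact (mul_eq_zero.1 h4).resolve_left fun h => hkj (hinj (by linarith))
  have hval : ∀ n j, W n j = V n j * X j j := by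
    intro n j
    rw [← hVX, Matrix.mul_apply, Finset.sum_eq_single j]
    · intro l _ hl; rw [hoff l j hl, mul_zero]
    · simp
  have hdiag : ∀ j, X j j = 0 := by
    intro j
    have := congrFun h2 j
    simp_rw [hval, ← Finset.sum_mul, hsum j, one_mul] at this
    exact this
  have hW : W = 0 := by
    ext n j; rw [hval, hdiag, mul_zero]; rfl
  rw [hW, hmu]; rfl

/-- The normalized and ordered eigenvector matrix is a continuously differentiable function of the
matrix: the local inverse of `eigMap` provides normalized eigenvectors, and the order of the
columns, the distinctness of the eigenvalues and the invertibility are open conditions. -/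
theorem contDiffAt_eigMat {B V : Matrix (Fin K) (Fin K) ℝ} (h : IsEigenSystem B V)
    (hV : V.det ≠ 0) : ContDiffAt ℝ 1 eigMat B := by
  obtain ⟨⟨lam, hinj, hB⟩, hsum, hmax⟩ := h
  set x := (B, V, lam) with hx
  have hc : ContDiffAt ℝ 1 eigMap x := contDiff_eigMap.contDiffAt
  set f' := (LinearEquiv.ofInjectiveEndo (fderiv ℝ eigMap x).toLinearMap
    (fderiv_eigMap_injective hinj hB hsum hV)).toContinuousLinearEquiv with hf'
  have hfd : HasFDerivAt eigMap (f' : _ →L[ℝ] _) x := by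
    have h1 : (f' : (Matrix (Fin K) (Fin K) ℝ × Matrix (Fin K) (Fin K) ℝ × (Fin K → ℝ)) →L[ℝ]
      Matrix (Fin K) (Fin K) ℝ × Matrix (Fin K) (Fin K) ℝ × (Fin K → ℝ)) = fderiv ℝ eigMap x := by
      exact ContinuousLinearMap.ext fun y => rfl
    rw [h1]
    exact (hc.differentiableAt one_ne_zero).hasFDerivAt
  have hval : eigMap x = (B, 0, fun _ => 1) := by
    simp only [eigMap, hx, hB, sub_self]
    refine Prod.ext rfl (Prod.ext rfl ?_)
    ext j; exact hsum j
  set L := hc.localInverse hfd one_ne_zero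
  have hLc : ContDiffAt ℝ 1 L (B, 0, fun _ => 1) := by
    have := hc.to_localInverse hfd one_ne_zero
    rwa [hval] at this
  have hLx : L (B, 0, fun _ => 1) = x := by
    have := hc.localInverse_apply_image hfd one_ne_zero
    rwa [hval] at this
  have hright : ∀ᶠ y in 𝓝 ((B, 0, fun _ => 1) : Matrix (Fin K) (Fin K) ℝ ×
      Matrix (Fin K) (Fin K) ℝ × (Fin K → ℝ)), eigMap (L y) = y := by
    have := (hc.hasStrictFDerivAt' hfd one_ne_zero).eventually_right_inverse
    rw [hval] at this
    exact this
  set ι : Matrix (Fin K) (Fin K) ℝ → Matrix (Fin K) (Fin K) ℝ ×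
      Matrix (Fin K) (Fin K) ℝ × (Fin K → ℝ) := fun A => (A, 0, fun _ => 1)
  have hιc : ContDiff ℝ 1 ι := contDiff_id.prodMk contDiff_const
  have hcomp : ContDiffAt ℝ 1 (fun A => L (ι A)) B := hLc.comp B hιc.contDiffAt
  have hsmooth : ContDiffAt ℝ 1 (fun A => (L (ι A)).2.1) B :=
    (contDiff_fst.comp contDiff_snd).contDiffAt.comp B hcomp
  refine hsmooth.congr_of_eventuallyEq ?_
  have hcont : ContinuousAt (fun A => L (ι A)) B := hcomp.continuousAt
  have hLB : L (ι B) = x := hLx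
  have e1 : ∀ᶠ A in 𝓝 B, eigMap (L (ι A)) = ι A :=
    hιc.continuous.continuousAt.eventually hright
  have hcV : ContinuousAt (fun A => (L (ι A)).2.1) B := hsmooth.continuousAt
  have hcVe : ∀ n j, ContinuousAt (fun A => (L (ι A)).2.1 n j) B := fun n j =>
    ((contDiff_entry n j (m := 0)).continuous.continuousAt).comp hcV
  have hcl : ∀ j, ContinuousAt (fun A => (L (ι A)).2.2 j) B := fun j =>
    ((continuous_apply j).continuousAt).comp
      ((continuous_snd.comp continuous_snd).continuousAt.comp hcont)
  have e2 : ∀ᶠ A in 𝓝 B, (L (ι A)).2.1.det ≠ 0 := by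
    have : ContinuousAt (fun A => (L (ι A)).2.1.det) B :=
      (Continuous.matrix_det continuous_id).continuousAt.comp hcV
    refine this.eventually_ne ?_
    rw [hLB]; exact hV
  have e3 : ∀ᶠ A in 𝓝 B, ∀ m n, n ≠ m → (L (ι A)).2.1 n m < (L (ι A)).2.1 m m := by
    refine eventually_all.2 fun m => eventually_all.2 fun n => ?_
    by_cases hnm : n = m
    · exact Eventually.of_forall fun A hA => (hA hnm).elim
    · refine ((hcVe n m).eventually_lt (hcVe m m) ?_).mono fun A hA _ => hA
      rw [hLB]; exact hmax m n hnm
  have e4 : ∀ᶠ A in 𝓝 B, ∀ m n, n ≠ m → (L (ι A)).2.2 n ≠ (L (ι A)).2.2 m := by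
    refine eventually_all.2 fun m => eventually_all.2 fun n => ?_
    by_cases hnm : n = m
    · exact Eventually.of_forall fun A hA => (hA hnm).elim
    · have : ContinuousAt (fun A => (L (ι A)).2.2 n - (L (ι A)).2.2 m) B := (hcl n).sub (hcl m)
      refine (this.eventually_ne ?_).mono fun A hA _ => sub_ne_zero.1 hA
      rw [hLB]; exact sub_ne_zero.2 fun h => hnm (hinj h)
  filter_upwards [e1, e2, e3, e4] with A h1 h2 h3 h4
  refine IsEigenSystem.eigMat_eq ?_ h2
  have h1a : (L (ι A)).1 = A := congrArg Prod.fst h1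
  have h1b := congrArg (fun y => y.2.1) h1
  have h1c := congrArg (fun y => y.2.2) h1
  simp only [eigMap] at h1b h1c
  rw [h1a] at h1b
  refine ⟨⟨(L (ι A)).2.2, fun a b hab => by_contra fun hne => h4 b a hne hab,
    sub_eq_zero.1 h1b⟩, fun m => congrFun h1c m, h3⟩

/-- A map that is continuously differentiable at every point of a compact set is Lipschitz at
those points, with a constant and a radius that hold for all of them. -/
theorem exists_uniform_lipschitz {X Y : Type*} [NormedAddCommGroup X] [NormedSpace ℝ X]
    [NormedAddCommGroup Y] [NormedSpace ℝ Y] {S : Set X} (hS : IsCompact S) {Φ : X → Y}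
    (hΦ : ∀ x ∈ S, ContDiffAt ℝ 1 Φ x) :
    ∃ c : ℝ≥0, ∃ δ : ℝ, 0 < δ ∧ ∀ x ∈ S, ∀ y, ‖y - x‖ < δ → ‖Φ y - Φ x‖ ≤ c * ‖y - x‖ := by
  choose! L t ht hL using fun x hx => (hΦ x hx).exists_lipschitzOnWith
  obtain ⟨s, hs, hcov⟩ := hS.elim_nhds_subcover (fun x => interior (t x))
    (fun x hx => interior_mem_nhds.2 (ht x hx))
  obtain ⟨δ, hδ, hball⟩ := lebesgue_number_lemma_of_metric (ι := s)
    (c := fun x => interior (t x)) hS (fun x => isOpen_interior) (by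
      intro x hx
      obtain ⟨y, hy, hxy⟩ := Set.mem_iUnion₂.1 (hcov hx)
      exact Set.mem_iUnion.2 ⟨⟨y, hy⟩, hxy⟩)
  refine ⟨∑ x ∈ s, L x, δ, hδ, fun x hx y hy => ?_⟩
  obtain ⟨⟨w, hw⟩, hsub⟩ := hball x hx
  have hyt : y ∈ t w := interior_subset (hsub (by rwa [Metric.mem_ball, dist_eq_norm]))
  have hxt : x ∈ t w := interior_subset (hsub (Metric.mem_ball_self hδ))
  have := (hL w (hs w hw)).dist_le_mul y hyt x hxt
  rw [dist_eq_norm, dist_eq_norm] at this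
  refine this.trans (mul_le_mul_of_nonneg_right ?_ (norm_nonneg _))
  exact_mod_cast Finset.single_le_sum (f := L) (fun _ _ => zero_le) hw

/-! ### The plug-in map at a point as a function of finitely many numbers -/

/-- The finitely many numbers through which the plug-in map depends on a nuisance parameter at a
given covariate value: the integrals of `y` against the density of `(|Nt|, |N|, Y, Z)`, and the
values of the probability functions of `(|Nt|, |N|, Z)`, `(S, |N|, Z)`, `(|N|, Z)` and `Z`. -/
abbrev LocalValues (K : ℕ) : Type :=
  (Fin K → Fin K → ℝ) × (Fin K → Fin K → ℝ) × (Fin K → Fin K → ℝ) × (Fin K → ℝ) × ℝ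

/-- The numbers through which the plug-in map depends on `g` at `z`. The entries for more treated
neighbours than neighbours are not used and set to zero. -/
def Nuisance.localValues {q r : ℕ} (K : ℕ) (C : Set (ℝ × (Fin q → ℝ))) (g : Nuisance q r)
    (z : Cov q r) : LocalValues K :=
  (fun a b => ∫ y in {y : ℝ | (y, z.1) ∈ C}, y * g.fNNYZ a b y z, fun a b => g.fNNZ a b z,
    fun s n => if s ≤ n then g.fSNZ s n z else 0, fun n => g.fNZ n z, g.fZ z)

namespace LocalValues

/-- Arrays viewed as matrices, as a continuous linear map. -/
def ofL : (Fin K → Fin K → ℝ) →L[ℝ] Matrix (Fin K) (Fin K) ℝ :=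
  LinearMap.toContinuousLinearMap
    { toFun := Matrix.of, map_add' := fun _ _ => rfl, map_smul' := fun _ _ => rfl }

/-- Transposition as a continuous linear map. -/
def transposeL : Matrix (Fin K) (Fin K) ℝ →L[ℝ] Matrix (Fin K) (Fin K) ℝ :=
  LinearMap.toContinuousLinearMap (Matrix.transposeLinearEquiv (Fin K) (Fin K) ℝ ℝ).toLinearMap

/-- The matrix whose eigenvectors are computed. -/
def matB (x : LocalValues K) : Matrix (Fin K) (Fin K) ℝ :=
  transposeL (x.2.2.2.2⁻¹ • ofL x.1) * (transposeL (x.2.2.2.2⁻¹ • ofL x.2.1))⁻¹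

/-- The ratio that stands for the binomial probability of `s` treated units among `n`. -/
def binS (x : LocalValues K) (s n : ℕ) : ℝ :=
  if h : s ≤ n ∧ n < K then x.2.2.1 ⟨s, h.1.trans_lt h.2⟩ ⟨n, h.2⟩ / x.2.2.2.1 ⟨n, h.2⟩ else 0

/-- The plug-in value of `f(S = s | S* = s', Z = z, |N*| = n', |N| = n)`. -/
def fSgS (x : LocalValues K) (s' n' s n : ℕ) : ℝ :=
  if n' ≤ n then
    if s' ≤ s ∧ s - s' ≤ n - n' then x.binS (s - s') (n - n') else 0
  else
    if s ≤ s' ∧ s' - s ≤ n' - n then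
      x.binS (s' - s) (n' - n) * x.binS s n / x.binS s' n'
    else 0

/-- The plug-in value of the latent degree distribution. -/
def fNstar (x : LocalValues K) : Fin K → ℝ :=
  Matrix.mulVec (eigMat x.matB)⁻¹ (fun n => x.2.2.2.1 n / x.2.2.2.2)

/-- The plug-in map as a function of the local values. -/
def phi (x : LocalValues K) (s' : ℕ) (n' : Fin K) (s : ℕ) (n : Fin K) : ℝ :=
  x.fSgS s' n' s n * x.binS s' n' * eigMat x.matB n n' * x.fNstar n' /
    (x.binS s n * (x.2.2.2.1 n / x.2.2.2.2))

end LocalValues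

section plugin

variable {q r : ℕ} (C : Set (ℝ × (Fin q → ℝ))) (g : Nuisance q r) (z : Cov q r)

theorem Nuisance.matE_eq : g.matE K C z = (g.fZ z)⁻¹ • Matrix.of (g.localValues K C z).1 := by
  ext a b
  simp only [Nuisance.matE, Matrix.of_apply, Matrix.smul_apply, smul_eq_mul, Nuisance.localValues]
  rw [← integral_const_mul]
  refine integral_congr_ae (Eventually.of_forall fun y => ?_)
  simp only []
  ring

theorem Nuisance.matF_eq : g.matF K z = (g.fZ z)⁻¹ • Matrix.of (g.localValues K C z).2.1 := by
  ext a b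
  simp only [Nuisance.matF, Matrix.of_apply, Matrix.smul_apply, smul_eq_mul, Nuisance.localValues]
  ring

theorem Nuisance.matB_eq : g.matB K C z = (g.localValues K C z).matB := by
  rw [Nuisance.matB, Nuisance.matE_eq, Nuisance.matF_eq C]
  rfl

theorem Nuisance.binS_eq {s n : ℕ} (hs : s ≤ n) (hn : n < K) :
    g.binS s n z = (g.localValues K C z).binS s n := by
  simp [Nuisance.binS, LocalValues.binS, Nuisance.localValues, hs, hn]

theorem Nuisance.phi_eq {s' s : ℕ} {n' n : Fin K} (hs' : s' ≤ n') (hs : s ≤ n) :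
    g.phi K C s' n' s n z = (g.localValues K C z).phi s' n' s n := by
  have h1 : g.fSgS s' n' s n z = (g.localValues K C z).fSgS s' n' s n := by
    rw [Nuisance.fSgS, LocalValues.fSgS]
    split_ifs with h1 h2 h2
    · exact g.binS_eq C z h2.2 ((Nat.sub_le _ _).trans_lt n.2)
    · rfl
    · rw [g.binS_eq C z h2.2 ((Nat.sub_le _ _).trans_lt n'.2), g.binS_eq C z hs' n'.2,
        g.binS_eq C z hs n.2]
    · rfl
  rw [Nuisance.phi, LocalValues.phi, h1, g.binS_eq C z hs' n'.2, g.binS_eq C z hs n.2,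
    Nuisance.fNstar, LocalValues.fNstar, Nuisance.psi_eq_eigMat, Nuisance.matB_eq]
  rfl

end plugin

namespace LocalValues

/-- The conditions under which the plug-in map is differentiable at `x`. -/
structure Nondegenerate (x : LocalValues K) : Prop where
  fZ : x.2.2.2.2 ≠ 0
  fNZ : ∀ n, x.2.2.2.1 n ≠ 0
  fSNZ : ∀ s n, s ≤ n → x.2.2.1 s n ≠ 0
  fNNZ : (Matrix.of x.2.1).det ≠ 0
  eigen : ∃ V, IsEigenSystem x.matB V ∧ V.det ≠ 0

theorem contDiffAt_inv_matrix {A : Matrix (Fin K) (Fin K) ℝ} (hA : A.det ≠ 0) :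
    ContDiffAt ℝ 1 (fun B : Matrix (Fin K) (Fin K) ℝ => B⁻¹) A := by
  obtain ⟨u, rfl⟩ := (Matrix.isUnit_iff_isUnit_det A).2 (isUnit_iff_ne_zero.2 hA)
  have h := contDiffAt_ringInverse (n := 1) ℝ u
  refine h.congr_of_eventuallyEq (Eventually.of_forall fun B => ?_)
  exact Matrix.nonsing_inv_eq_ringInverse B

theorem contDiffAt_matB {x : LocalValues K} (hx : x.Nondegenerate) :
    ContDiffAt ℝ 1 (matB (K := K)) x := by
  have h1 : ContDiffAt ℝ 1 (fun x : LocalValues K => x.2.2.2.2⁻¹) x :=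
    ContDiffAt.inv (by fun_prop) hx.fZ
  have h2 : ContDiffAt ℝ 1 (fun x : LocalValues K => transposeL (x.2.2.2.2⁻¹ • ofL x.1)) x :=
    transposeL.contDiff.contDiffAt.comp x (h1.smul (ofL.contDiff.comp contDiff_fst).contDiffAt)
  have h3 : ContDiffAt ℝ 1 (fun x : LocalValues K => transposeL (x.2.2.2.2⁻¹ • ofL x.2.1)) x :=
    transposeL.contDiff.contDiffAt.comp x
      (h1.smul (ofL.contDiff.comp (contDiff_fst.comp contDiff_snd)).contDiffAt)
  refine h2.mul ((contDiffAt_inv_matrix ?_).comp x h3)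
  change Matrix.det (Matrix.transpose (x.2.2.2.2⁻¹ • Matrix.of x.2.1)) ≠ 0
  rw [Matrix.det_transpose, Matrix.det_smul]
  exact mul_ne_zero (pow_ne_zero _ (inv_ne_zero hx.fZ)) hx.fNNZ

theorem contDiffAt_binS {x : LocalValues K} (hx : x.Nondegenerate) (s n : ℕ) :
    ContDiffAt ℝ 1 (fun x : LocalValues K => x.binS s n) x := by
  by_cases h : s ≤ n ∧ n < K
  · simp only [binS, dif_pos h]
    exact ContDiffAt.div (by fun_prop) (by fun_prop) (hx.fNZ _)
  · simp only [binS, dif_neg h]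
    exact contDiffAt_const

theorem Nondegenerate.binS_ne_zero {x : LocalValues K} (hx : x.Nondegenerate) {s n : ℕ}
    (hs : s ≤ n) (hn : n < K) : x.binS s n ≠ 0 := by
  rw [binS, dif_pos ⟨hs, hn⟩]
  exact div_ne_zero (hx.fSNZ _ _ hs) (hx.fNZ _)

theorem contDiffAt_phi {x : LocalValues K} (hx : x.Nondegenerate) {s' s : ℕ} {n' n : Fin K}
    (hs' : s' ≤ n') (hs : s ≤ n) : ContDiffAt ℝ 1 (fun x : LocalValues K => x.phi s' n' s n) x := by
  obtain ⟨V, hV, hdet⟩ := hx.eigen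
  have hpsi : ContDiffAt ℝ 1 (fun x : LocalValues K => eigMat x.matB) x :=
    (contDiffAt_eigMat hV hdet).comp x (contDiffAt_matB hx)
  have hpsie : ∀ a b, ContDiffAt ℝ 1 (fun x : LocalValues K => eigMat x.matB a b) x := fun a b =>
    (contDiff_entry a b).contDiffAt.comp x hpsi
  have hinv : ContDiffAt ℝ 1 (fun x : LocalValues K => (eigMat x.matB)⁻¹) x := by
    refine (contDiffAt_inv_matrix ?_).comp x hpsi
    rwa [hV.eigMat_eq hdet]
  have hf : ∀ a, ContDiffAt ℝ 1 (fun x : LocalValues K => x.2.2.2.1 a / x.2.2.2.2) x := fun a =>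
    ContDiffAt.div (by fun_prop) (by fun_prop) hx.fZ
  have hN : ContDiffAt ℝ 1 (fun x : LocalValues K => x.fNstar n') x := by
    simp only [fNstar, Matrix.mulVec, dotProduct]
    exact ContDiffAt.sum fun a _ => ((contDiff_entry n' a).contDiffAt.comp x hinv).mul (hf a)
  have hS : ContDiffAt ℝ 1 (fun x : LocalValues K => x.fSgS s' n' s n) x := by
    unfold fSgS
    split_ifs
    · exact contDiffAt_binS hx _ _
    · exact contDiffAt_const
    · exact ((contDiffAt_binS hx _ _).mul (contDiffAt_binS hx _ _)).div (contDiffAt_binS hx _ _)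
        (hx.binS_ne_zero hs' n'.2)
    · exact contDiffAt_const
  exact (((hS.mul (contDiffAt_binS hx _ _)).mul (hpsie _ _)).mul hN).div
    ((contDiffAt_binS hx _ _).mul (hf n))
    (mul_ne_zero (hx.binS_ne_zero hs n.2) (div_ne_zero (hx.fNZ n) hx.fZ))

/-- Uniform Lipschitz bound for the plug-in map at the points of a compact set of nondegenerate
local values. -/
theorem exists_phi_lipschitz {S : Set (LocalValues K)} (hS : IsCompact S)
    (hnd : ∀ x ∈ S, x.Nondegenerate) :
    ∃ c : ℝ≥0, ∃ δ : ℝ, 0 < δ ∧ ∀ x ∈ S, ∀ y : LocalValues K, ‖y - x‖ < δ →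
      ∀ (s' : ℕ) (n' : Fin K) (s : ℕ) (n : Fin K), s' ≤ n' → s ≤ n →
        ‖y.phi s' n' s n - x.phi s' n' s n‖ ≤ c * ‖y - x‖ := by
  obtain ⟨c, δ, hδ, h⟩ := exists_uniform_lipschitz (Y := Fin K → Fin K → Fin K → Fin K → ℝ) hS
    (Φ := fun x s' n' s n => if s' ≤ n' ∧ s ≤ n then x.phi s' n' s n else 0) (by
      intro x hx
      refine contDiffAt_pi.2 fun s' => contDiffAt_pi.2 fun n' => contDiffAt_pi.2 fun s =>
        contDiffAt_pi.2 fun n => ?_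
      by_cases hc : s' ≤ n' ∧ s ≤ n
      · simp only [if_pos hc]
        exact contDiffAt_phi (hnd x hx) hc.1 hc.2
      · simp only [if_neg hc]
        exact contDiffAt_const)
  refine ⟨c, δ, hδ, fun x hx y hy s' n' s n hs' hs => ?_⟩
  have h1 := h x hx y hy
  have h2 := (norm_le_pi_norm _ (⟨s', hs'.trans_lt n'.2⟩ : Fin K)).trans h1
  have h3 := (norm_le_pi_norm _ n').trans h2
  have h4 := (norm_le_pi_norm _ (⟨s, hs.trans_lt n.2⟩ : Fin K)).trans h3
  have h5 := (norm_le_pi_norm _ n).trans h4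
  have hc : (⟨s', hs'.trans_lt n'.2⟩ : Fin K) ≤ n' ∧ (⟨s, hs.trans_lt n.2⟩ : Fin K) ≤ n :=
    ⟨hs', hs⟩
  simpa only [Pi.sub_apply, if_pos hc] using h5

end LocalValues

end plugInMap

/-! ### The sup norms and the kernel estimator -/

section distance

variable {q r K : ℕ} {C : Set (ℝ × (Fin q → ℝ))} {supp : Set (Cov q r)}

theorem isCompact_fiber (hC : IsCompact C) (x : Fin q → ℝ) : IsCompact {y : ℝ | (y, x) ∈ C} := by
  have h1 : IsCompact (C ∩ Prod.snd ⁻¹' {x}) :=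
    hC.inter_right (isClosed_singleton.preimage continuous_snd)
  convert h1.image continuous_fst using 1
  ext y
  constructor
  · intro hy; exact ⟨(y, x), ⟨hy, rfl⟩, rfl⟩
  · rintro ⟨⟨a, b⟩, ⟨h, hb⟩, rfl⟩
    simp only [Set.mem_preimage, Set.mem_singleton_iff] at hb
    subst hb
    exact h

theorem continuousOn_fiber {f : ℝ → Cov q r → ℝ} {z : Cov q r}
    (hf : ContinuousOn (fun w : ℝ × (Fin q → ℝ) => f w.1 (w.2, z.2)) C) :
    ContinuousOn (fun y => f y z) {y : ℝ | (y, z.1) ∈ C} := by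
  have : ContinuousOn (fun y : ℝ => (y, z.1)) {y : ℝ | (y, z.1) ∈ C} := by fun_prop
  exact hf.comp this fun y hy => hy

theorem norm_integral_fiber_sub_le (hC : IsCompact C) {R ρ : ℝ} (hR : 0 ≤ R)
    (hCR : ∀ w ∈ C, |w.1| ≤ R) {z : Cov q r} {f f0 : ℝ → ℝ} (hf : Measurable f)
    (hf0 : ContinuousOn f0 {y : ℝ | (y, z.1) ∈ C})
    (hd : ∀ y, (y, z.1) ∈ C → ‖f y - f0 y‖ ≤ ρ) (hρ : 0 ≤ ρ) :
    ‖(∫ y in {y : ℝ | (y, z.1) ∈ C}, y * f y) - ∫ y in {y : ℝ | (y, z.1) ∈ C}, y * f0 y‖ ≤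
      (R * (2 * R)) * ρ := by
  have hcf := isCompact_fiber hC z.1
  have hm : MeasurableSet {y : ℝ | (y, z.1) ∈ C} := hcf.measurableSet
  have hsub : {y : ℝ | (y, z.1) ∈ C} ⊆ Set.Icc (-R) R := fun y hy => abs_le.1 (hCR _ hy)
  have hi0 : IntegrableOn (fun y => y * f0 y) {y : ℝ | (y, z.1) ∈ C} :=
    (continuousOn_id.mul hf0).integrableOn_compact hcf
  have hdb : ∀ y, (y, z.1) ∈ C → ‖y * f y - y * f0 y‖ ≤ R * ρ := fun y hy => by
    rw [← mul_sub, norm_mul]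
    exact mul_le_mul (hCR _ hy) (hd y hy) (norm_nonneg _) hR
  have hid : IntegrableOn (fun y => y * f y - y * f0 y) {y : ℝ | (y, z.1) ∈ C} := by
    have : IsFiniteMeasure (volume.restrict {y : ℝ | (y, z.1) ∈ C}) :=
      isFiniteMeasure_restrict.2 hcf.measure_ne_top
    refine Integrable.of_bound (C := R * ρ) ?_ ?_
    · exact (measurable_id.mul hf).aestronglyMeasurable.sub hi0.aestronglyMeasurable
    · exact (ae_restrict_iff' hm).2 (Eventually.of_forall hdb)
  have hi : IntegrableOn (fun y => y * f y) {y : ℝ | (y, z.1) ∈ C} := by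
    refine (hid.add hi0).congr (Eventually.of_forall fun y => ?_)
    simp
  rw [← integral_sub hi hi0]
  refine (norm_setIntegral_le_of_norm_le_const hcf.measure_lt_top hdb).trans ?_
  have hv : volume.real {y : ℝ | (y, z.1) ∈ C} ≤ 2 * R := by
    refine (measureReal_mono hsub (by simp)).trans ?_
    rw [Real.volume_real_Icc_of_le (by linarith)]
    linarith
  calc R * ρ * volume.real {y : ℝ | (y, z.1) ∈ C} ≤ R * ρ * (2 * R) :=
        mul_le_mul_of_nonneg_left hv (mul_nonneg hR hρ)
    _ = _ := by ring

theorem norm_le_toReal_of_enorm_le {x : ℝ} {d : ℝ≥0∞} (hd : d ≠ ∞) (h : ‖x‖ₑ ≤ d) :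
    ‖x‖ ≤ d.toReal := by
  rw [← toReal_enorm]
  exact ENNReal.toReal_mono hd h

/-- The local values depend on the nuisance parameter in a Lipschitz way. The factor `R * (2 * R)`
for the integral of `y` bounds `|y|` by `R` and the length of the section by `2 * R`. -/
theorem Nuisance.norm_localValues_sub_le (hC : IsCompact C) {R : ℝ} (hR : 0 ≤ R)
    (hCR : ∀ w ∈ C, |w.1| ≤ R) {g g0 : Nuisance q r} (hg : g.Admissible)
    (hg0 : ∀ a < K, ∀ b < K, ∀ d : Fin r,
      ContinuousOn (fun w : ℝ × (Fin q → ℝ) => g0.fNNYZ a b w.1 (w.2, d)) C)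
    (hd : g.dist K C supp g0 ≠ ∞) {z : Cov q r} (hz : z ∈ supp) :
    ‖g.localValues K C z - g0.localValues K C z‖ ≤
      (R * (2 * R) + 1) * (g.dist K C supp g0).toReal := by
  set D := g.dist K C supp g0 with hD
  have hD0 : 0 ≤ D.toReal := ENNReal.toReal_nonneg
  have hRR : 0 ≤ R * (2 * R) := by positivity
  have hle : D.toReal ≤ (R * (2 * R) + 1) * D.toReal := by nlinarith
  have h1 : ∀ (a b : Fin K) y, (y, z.1) ∈ C → ‖g.fNNYZ a b y z - g0.fNNYZ a b y z‖ ≤ D.toReal := by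
    intro a b y hy
    refine norm_le_toReal_of_enorm_le hd ?_
    rw [hD, Nuisance.dist]
    refine le_sup_of_le_left (le_sup_of_le_left (le_sup_of_le_left (le_sup_of_le_left ?_)))
    exact le_iSup_of_le a (le_iSup_of_le b (le_iSup_of_le y (le_iSup_of_le z
      (le_iSup_of_le hz (le_iSup_of_le hy le_rfl)))))
  have h2 : ∀ (a b : Fin K), ‖g.fNNZ a b z - g0.fNNZ a b z‖ ≤ D.toReal := by
    intro a b
    refine norm_le_toReal_of_enorm_le hd ?_
    rw [hD, Nuisance.dist]
    refine le_sup_of_le_left (le_sup_of_le_left (le_sup_of_le_left (le_sup_of_le_right ?_)))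
    exact le_iSup_of_le a (le_iSup_of_le b (le_iSup_of_le z (le_iSup_of_le hz le_rfl)))
  have h3 : ∀ (s n : Fin K), s ≤ n → ‖g.fSNZ s n z - g0.fSNZ s n z‖ ≤ D.toReal := by
    intro s n hs
    refine norm_le_toReal_of_enorm_le hd ?_
    rw [hD, Nuisance.dist]
    refine le_sup_of_le_left (le_sup_of_le_left (le_sup_of_le_right ?_))
    exact le_iSup_of_le n (le_iSup_of_le s.1 (le_iSup_of_le hs (le_iSup_of_le z
      (le_iSup_of_le hz le_rfl))))
  have h4 : ∀ (n : Fin K), ‖g.fNZ n z - g0.fNZ n z‖ ≤ D.toReal := by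
    intro n
    refine norm_le_toReal_of_enorm_le hd ?_
    rw [hD, Nuisance.dist]
    refine le_sup_of_le_left (le_sup_of_le_right ?_)
    exact le_iSup_of_le n (le_iSup_of_le z (le_iSup_of_le hz le_rfl))
  have h5 : ‖g.fZ z - g0.fZ z‖ ≤ D.toReal := by
    refine norm_le_toReal_of_enorm_le hd ?_
    rw [hD, Nuisance.dist]
    refine le_sup_of_le_right ?_
    exact le_iSup_of_le z (le_iSup_of_le hz le_rfl)
  have hnn : 0 ≤ (R * (2 * R) + 1) * D.toReal := hD0.trans hle
  refine norm_prod_le_iff.2 ⟨?_, norm_prod_le_iff.2 ⟨?_, norm_prod_le_iff.2 ⟨?_,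
    norm_prod_le_iff.2 ⟨?_, ?_⟩⟩⟩⟩
  · refine (pi_norm_le_iff_of_nonneg hnn).2 fun a => (pi_norm_le_iff_of_nonneg hnn).2 fun b => ?_
    have := norm_integral_fiber_sub_le hC hR hCR (hg a b z)
      (continuousOn_fiber (hg0 a a.2 b b.2 z.2)) (h1 a b) hD0
    refine this.trans ?_
    nlinarith
  · refine (pi_norm_le_iff_of_nonneg hnn).2 fun a => (pi_norm_le_iff_of_nonneg hnn).2 fun b => ?_
    exact (h2 a b).trans hle
  · refine (pi_norm_le_iff_of_nonneg hnn).2 fun s => (pi_norm_le_iff_of_nonneg hnn).2 fun n => ?_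
    by_cases hs : s ≤ n
    · simpa [Nuisance.localValues, hs] using (h3 s n hs).trans hle
    · simpa [Nuisance.localValues, hs] using hnn
  · refine (pi_norm_le_iff_of_nonneg hnn).2 fun n => (h4 n).trans hle
  · exact h5.trans hle

/-- The plug-in map is Lipschitz at `g0`, uniformly over the covariate values, once the local
values of `g0` are nondegenerate and depend continuously on them. -/
theorem exists_latentDist_le (hC : IsCompact C) (hsupp : IsCompact supp) {g0 : Nuisance q r}
    (hg0 : ∀ a < K, ∀ b < K, ∀ d : Fin r,
      ContinuousOn (fun w : ℝ × (Fin q → ℝ) => g0.fNNYZ a b w.1 (w.2, d)) C)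
    (hcont : ContinuousOn (g0.localValues K C) supp)
    (hnd : ∀ z ∈ supp, (g0.localValues K C z).Nondegenerate) :
    ∃ c δ : ℝ≥0, 0 < δ ∧ ∀ g : Nuisance q r, g.Admissible → g.dist K C supp g0 ≤ δ →
      latentDist supp (g.phi K C) (g0.phi K C) ≤ c * g.dist K C supp g0 := by
  obtain ⟨R, hR0, hCR⟩ : ∃ R : ℝ, 0 ≤ R ∧ ∀ w ∈ C, |w.1| ≤ R := by
    obtain ⟨R, hR⟩ := hC.exists_bound_of_continuousOn (f := fun w : ℝ × (Fin q → ℝ) => w.1)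
      continuous_fst.continuousOn
    exact ⟨max R 0, le_max_right _ _, fun w hw => (hR w hw).trans (le_max_left _ _)⟩
  obtain ⟨c, δ, hδ, hlip⟩ := LocalValues.exists_phi_lipschitz (hsupp.image_of_continuousOn hcont)
    (by rintro _ ⟨z, hz, rfl⟩; exact hnd z hz)
  set A : ℝ := R * (2 * R) + 1
  have hA0 : 0 < A := by positivity
  refine ⟨c * ⟨A, hA0.le⟩, ⟨δ / (2 * A), by positivity⟩, ?_, fun g hg hd => ?_⟩
  · exact NNReal.coe_pos.1 (show (0 : ℝ) < δ / (2 * A) by positivity)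
  have hfin : g.dist K C supp g0 ≠ ∞ := (hd.trans_lt ENNReal.coe_lt_top).ne
  have hdr : (g.dist K C supp g0).toReal ≤ δ / (2 * A) := ENNReal.toReal_mono ENNReal.coe_ne_top hd
  refine iSup_le fun n' => iSup_le fun s' => iSup_le fun hs' => iSup_le fun n => iSup_le fun s =>
    iSup_le fun hs => iSup_le fun z => iSup_le fun hz => ?_
  have hx := Nuisance.norm_localValues_sub_le hC hR0 hCR hg hg0 hfin hz
  have hsmall : ‖g.localValues K C z - g0.localValues K C z‖ < δ := by
    refine hx.trans_lt ?_
    calc A * (g.dist K C supp g0).toReal ≤ A * (δ / (2 * A)) :=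
          mul_le_mul_of_nonneg_left hdr hA0.le
      _ = δ / 2 := by field_simp
      _ < δ := by linarith
  have h1 := hlip _ ⟨z, hz, rfl⟩ _ hsmall s' n' s n hs' hs
  rw [← Nuisance.phi_eq C g z hs' hs, ← Nuisance.phi_eq C g0 z hs' hs] at h1
  have h2 : ‖g.phi K C s' n' s n z - g0.phi K C s' n' s n z‖ ≤
      (c * A) * (g.dist K C supp g0).toReal := by
    refine h1.trans ?_
    rw [mul_assoc]
    exact mul_le_mul_of_nonneg_left hx c.2
  rw [← ENNReal.coe_toNNReal hfin, ← ENNReal.coe_mul, enorm_eq_nnnorm, ENNReal.coe_le_coe]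
  exact_mod_cast h2

end distance

section estimator

theorem continuous_kernelEst {Q : ℕ} {κ : ℝ → ℝ} (hκ : Continuous κ) (h : ℝ) (N : ℕ)
    (Wc : ℕ → Fin Q → ℝ) (hit : ℕ → Prop) : Continuous (kernelEst κ h N Wc hit) := by
  unfold kernelEst
  fun_prop

theorem admissible_gammaHat {P Ω E : Type*} {q r : ℕ} (M : Model P Ω E q r) (unit : ℕ → P)
    {κ : ℝ → ℝ} (hκ : Continuous κ) (h : ℝ) (N : ℕ) (ω : Ω) :
    (gammaHat M unit κ h N ω).Admissible := by
  intro a b z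
  refine Continuous.measurable ?_
  refine (continuous_kernelEst hκ h N _ _).comp ?_
  refine continuous_pi fun l => ?_
  refine Fin.cases ?_ (fun l => ?_) l
  · simpa using continuous_id'
  · simpa using continuous_const

/-- A Lipschitz bound near `g0` gives the uniform bound on shrinking neighbourhoods and the
stochastic bound for the kernel estimator. -/
theorem latentDist_bounds {P Ω E : Type*} {q r K : ℕ} [MeasurableSpace Ω] (μ : Measure Ω)
    (M : Model P Ω E q r) {C : Set (ℝ × (Fin q → ℝ))} {supp : Set (Cov q r)} {g0 : Nuisance q r}
    {κ : ℝ → ℝ} (hκ : Continuous κ) (unit : ℕ → P) (h : ℕ → ℝ) {c δ : ℝ≥0} (hδ : 0 < δ)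
    (hlip : ∀ g : Nuisance q r, g.Admissible → g.dist K C supp g0 ≤ δ →
      latentDist supp (g.phi K C) (g0.phi K C) ≤ c * g.dist K C supp g0)
    (η : ℕ → ℝ≥0) (hη : Tendsto η atTop (𝓝 0)) :
    (∀ᶠ N in atTop, ∀ g : Nuisance q r, g.Admissible → g.dist K C supp g0 ≤ η N →
        latentDist supp (g.phi K C) (g0.phi K C) ≤ c * g.dist K C supp g0) ∧
      IsBigOp μ
        (fun N ω => ⨆ _ : (gammaHat M unit κ (h N) N ω).dist K C supp g0 ≤ η N,
          latentDist supp ((gammaHat M unit κ (h N) N ω).phi K C) (g0.phi K C))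
        (fun N ω => (gammaHat M unit κ (h N) N ω).dist K C supp g0) := by
  have hev : ∀ᶠ N in atTop, ∀ g : Nuisance q r, g.Admissible → g.dist K C supp g0 ≤ η N →
      latentDist supp (g.phi K C) (g0.phi K C) ≤ c * g.dist K C supp g0 := by
    filter_upwards [hη.eventually (gt_mem_nhds hδ)] with N hN g hg hd
    exact hlip g hg (hd.trans (ENNReal.coe_le_coe.2 hN.le))
  refine ⟨hev, fun ε _ => ⟨c, ?_⟩⟩
  filter_upwards [hev] with N hN
  have : {ω | (c : ℝ≥0∞) * (gammaHat M unit κ (h N) N ω).dist K C supp g0 <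
      ⨆ _ : (gammaHat M unit κ (h N) N ω).dist K C supp g0 ≤ η N,
        latentDist supp ((gammaHat M unit κ (h N) N ω).phi K C) (g0.phi K C)} = ∅ := by
    ext ω
    simp only [Set.mem_ofPred_eq, Set.mem_empty_iff_false, iff_false, not_lt]
    exact iSup_le fun hd => hN _ (admissible_gammaHat M unit hκ _ _ _) hd
  rw [this]
  simp

end estimator

/-! ### Equality of conditional means -/

section sameMean

variable {Ω α β : Type*} [MeasurableSpace Ω] [MeasurableSpace α] [MeasurableSpace β]
  {μ : Measure Ω} {U V : Set Ω} {Z : Ω → β} {X X₁ X₂ X₃ : Ω → ℝ}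

/-- `X₁` and `X₂` have the same conditional mean given the event `U` and `Z`: their integrals
agree on every event that `Z` determines within `U`. -/
def SameMean (μ : Measure Ω) (U : Set Ω) (Z : Ω → β) (X₁ X₂ : Ω → ℝ) : Prop :=
  ∀ B : Set β, MeasurableSet B → ∫ ω in U ∩ Z ⁻¹' B, X₁ ω ∂μ = ∫ ω in U ∩ Z ⁻¹' B, X₂ ω ∂μ

theorem SameMean.symm (h : SameMean μ U Z X₁ X₂) : SameMean μ U Z X₂ X₁ :=
  fun B hB => (h B hB).symm

theorem SameMean.trans (h : SameMean μ U Z X₁ X₂) (h' : SameMean μ U Z X₂ X₃) :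
    SameMean μ U Z X₁ X₃ := fun B hB => (h B hB).trans (h' B hB)

theorem SameMean.of_ae (hU : MeasurableSet U) (h : ∀ᵐ ω ∂μ, ω ∈ U → X₁ ω = X₂ ω) :
    SameMean μ U Z X₁ X₂ := by
  intro B _
  have h1 : ∀ᵐ ω ∂μ.restrict U, X₁ ω = X₂ ω := (ae_restrict_iff' hU).2 h
  exact integral_congr_ae (ae_mono (Measure.restrict_mono Set.inter_subset_left le_rfl) h1)

theorem sameMean_indicator_iff (hV : MeasurableSet V) :
    SameMean μ U Z (V.indicator X₁) (V.indicator X₂) ↔ SameMean μ (U ∩ V) Z X₁ X₂ := by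
  refine forall₂_congr fun B hB => ?_
  rw [setIntegral_indicator hV, setIntegral_indicator hV, Set.inter_right_comm]

/-- Bounded weights that depend on `Z` alone preserve equality of conditional means. -/
theorem SameMean.mul_left [IsFiniteMeasure μ] (h : SameMean μ U Z X₁ X₂)
    (hZ : Measurable Z) (h₁ : IntegrableOn X₁ U μ) (h₂ : IntegrableOn X₂ U μ) {w : β → ℝ}
    (hw : Measurable w) {c : ℝ} (hc : ∀ z, |w z| ≤ c) :
    SameMean μ U Z (fun ω => w (Z ω) * X₁ ω) (fun ω => w (Z ω) * X₂ ω) := by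
  intro B hB
  set ν := μ.restrict U with hν
  have hm : MeasurableSpace.comap Z inferInstance ≤ (inferInstance : MeasurableSpace Ω) :=
    hZ.comap_le
  set v : Ω → ℝ := fun ω => B.indicator w (Z ω) with hv
  have hvm : StronglyMeasurable[MeasurableSpace.comap Z inferInstance] v :=
    ((hw.indicator hB).comp (comap_measurable Z)).stronglyMeasurable
  have hvb : ∀ ω, ‖v ω‖ ≤ c := fun ω => by
    by_cases hω : Z ω ∈ B
    · simpa [hv, hω] using hc (Z ω)
    · simpa [hv, hω] using (abs_nonneg _).trans (hc (Z ω))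
  have hcond : ν[X₁|MeasurableSpace.comap Z inferInstance] =ᵐ[ν]
      ν[X₂|MeasurableSpace.comap Z inferInstance] := by
    refine ae_eq_condExp_of_forall_setIntegral_eq hm h₂ (fun s _ _ =>
      integrable_condExp.integrableOn) ?_ stronglyMeasurable_condExp.aestronglyMeasurable
    rintro s ⟨T, hT, rfl⟩ -
    rw [setIntegral_condExp hm h₁ ⟨T, hT, rfl⟩, hν, Measure.restrict_restrict (hZ hT),
      Set.inter_comm]
    exact h T hT
  have key : ∀ Y : Ω → ℝ, Integrable Y ν → ∫ ω in U ∩ Z ⁻¹' B, w (Z ω) * Y ω ∂μ =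
      ∫ ω, v ω * (ν[Y|MeasurableSpace.comap Z inferInstance]) ω ∂ν := by
    intro Y hY
    have hvY : Integrable (v * Y) ν := by
      refine hY.bdd_mul (c := c) (hvm.mono hm).aestronglyMeasurable (Eventually.of_forall hvb)
    calc ∫ ω in U ∩ Z ⁻¹' B, w (Z ω) * Y ω ∂μ = ∫ ω in Z ⁻¹' B, w (Z ω) * Y ω ∂ν := by
          rw [hν, Measure.restrict_restrict (hZ hB), Set.inter_comm]
      _ = ∫ ω, (v * Y) ω ∂ν := by
          rw [← integral_indicator (hZ hB)]
          refine integral_congr_ae (Eventually.of_forall fun ω => ?_)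
          by_cases hω : Z ω ∈ B <;> simp [hv, hω, Set.indicator]
      _ = ∫ ω, (ν[v * Y|MeasurableSpace.comap Z inferInstance]) ω ∂ν := (integral_condExp hm).symm
      _ = _ := integral_congr_ae (condExp_mul_of_stronglyMeasurable_left hvm hvY hY)
  rw [key X₁ h₁, key X₂ h₂]
  refine integral_congr_ae ?_
  filter_upwards [hcond] with ω hω
  rw [hω]

theorem SameMean.sum {ι : Type*} (s : Finset ι) {Y₁ Y₂ : ι → Ω → ℝ}
    (h : ∀ k ∈ s, SameMean μ U Z (Y₁ k) (Y₂ k)) (h₁ : ∀ k ∈ s, IntegrableOn (Y₁ k) U μ)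
    (h₂ : ∀ k ∈ s, IntegrableOn (Y₂ k) U μ) :
    SameMean μ U Z (fun ω => ∑ k ∈ s, Y₁ k ω) (fun ω => ∑ k ∈ s, Y₂ k ω) := by
  intro B hB
  have hs : U ∩ Z ⁻¹' B ⊆ U := Set.inter_subset_left
  rw [integral_finsetSum _ fun k hk => (h₁ k hk).mono_set hs,
    integral_finsetSum _ fun k hk => (h₂ k hk).mono_set hs]
  exact Finset.sum_congr rfl fun k hk => h k hk B hB

/-- It suffices to test equality of conditional means given a pair on rectangles. -/
theorem SameMean.of_rectangles {Z' : Ω → α} (hZ' : Measurable Z') (hZ : Measurable Z)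
    (hU : MeasurableSet U) (h₁ : IntegrableOn X₁ U μ) (h₂ : IntegrableOn X₂ U μ)
    (h : ∀ G : Set α, MeasurableSet G → SameMean μ (U ∩ Z' ⁻¹' G) Z X₁ X₂) :
    SameMean μ U (fun ω => (Z' ω, Z ω)) X₁ X₂ := by
  have hp : Measurable fun ω => (Z' ω, Z ω) := hZ'.prodMk hZ
  intro T hT
  induction T, hT using MeasurableSpace.induction_on_inter generateFrom_prod.symm
    isPiSystem_prod with
  | empty => simp
  | basic T hT =>
    obtain ⟨G, hG, B, hB, rfl⟩ := hT
    have := h G hG B hB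
    rwa [Set.inter_assoc] at this
  | compl T hT ih =>
    have huniv := h Set.univ MeasurableSet.univ Set.univ MeasurableSet.univ
    simp only [Set.preimage_univ, Set.inter_univ] at huniv
    have e : ∀ X : Ω → ℝ, IntegrableOn X U μ →
        ∫ ω in U ∩ (fun ω => (Z' ω, Z ω)) ⁻¹' Tᶜ, X ω ∂μ =
          ∫ ω in U, X ω ∂μ - ∫ ω in U ∩ (fun ω => (Z' ω, Z ω)) ⁻¹' T, X ω ∂μ := by
      intro X hX
      rw [← integral_inter_add_sdiff (hp hT) hX, add_sub_cancel_left]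
      rfl
    rw [e _ h₁, e _ h₂, huniv, ih]
  | iUnion T hd hT ih =>
    have e : ∀ X : Ω → ℝ, IntegrableOn X U μ →
        ∫ ω in U ∩ (fun ω => (Z' ω, Z ω)) ⁻¹' (⋃ k, T k), X ω ∂μ =
          ∑' k, ∫ ω in U ∩ (fun ω => (Z' ω, Z ω)) ⁻¹' (T k), X ω ∂μ := by
      intro X hX
      rw [Set.preimage_iUnion, Set.inter_iUnion]
      refine integral_iUnion (fun k => hU.inter (hp (hT k))) ?_
        (hX.mono_set (Set.iUnion_subset fun k => Set.inter_subset_left))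
      intro k l hkl
      exact ((hd hkl).preimage _).mono Set.inter_subset_right Set.inter_subset_right
    rw [e _ h₁, e _ h₂]
    exact tsum_congr ih

end sameMean

section condIndep

variable {Ω α γ β : Type*} [mΩ : MeasurableSpace Ω] [MeasurableSpace α] [MeasurableSpace γ]
  [MeasurableSpace β] {μ : Measure Ω} [IsFiniteMeasure μ] {Z : Ω → β} {deg : Ω → ℕ}

/-- The sigma-algebra generated by `Z` and `deg`. -/
abbrev pairSigma (Z : Ω → β) (deg : Ω → ℕ) : MeasurableSpace Ω :=
  MeasurableSpace.comap (fun ω => (Z ω, deg ω)) inferInstance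

/-- On the event `deg = m`, the conditional expectation given `(Z, deg)` is the conditional mean
given that event and `Z`. -/
theorem condExp_eq_of_sameMean (hZ : Measurable Z) (hdeg : Measurable deg) {m : ℕ} {X : Ω → ℝ}
    (hX : Integrable X μ) {f : β → ℝ} (hf : Measurable f) {c : ℝ} (hc : ∀ z, |f z| ≤ c)
    (h : SameMean μ {ω | deg ω = m} Z X fun ω => f (Z ω)) :
    ∀ᵐ ω ∂μ, deg ω = m →
      (μ[X|pairSigma Z deg]) ω = f (Z ω) := by
  have hp : Measurable fun ω => (Z ω, deg ω) := hZ.prodMk hdeg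
  have hle : pairSigma Z deg ≤ mΩ := hp.comap_le
  have hp' : Measurable[pairSigma Z deg] fun ω => (Z ω, deg ω) := comap_measurable _
  have hD : MeasurableSet[pairSigma Z deg] {ω | deg ω = m} :=
    (measurable_snd.comp hp') (measurableSet_singleton m)
  have hfZ : StronglyMeasurable[pairSigma Z deg] fun ω => f (Z ω) :=
    (hf.comp (measurable_fst.comp hp')).stronglyMeasurable
  have hfi : Integrable (fun ω => f (Z ω)) μ :=
    Integrable.of_bound (hfZ.mono hle).aestronglyMeasurable c (Eventually.of_forall fun ω => hc _)
  have h1 : {ω | deg ω = m}.indicator (fun ω => f (Z ω)) =ᵐ[μ]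
      μ[{ω | deg ω = m}.indicator X|pairSigma Z deg] := by
    refine ae_eq_condExp_of_forall_setIntegral_eq hle (hX.indicator (hle _ hD))
      (fun s _ _ => (hfi.indicator (hle _ hD)).integrableOn) ?_
      (hfZ.indicator hD).aestronglyMeasurable
    rintro s ⟨T, hT, rfl⟩ -
    rw [setIntegral_indicator (hle _ hD), setIntegral_indicator (hle _ hD)]
    have e : (fun ω => (Z ω, deg ω)) ⁻¹' T ∩ {ω | deg ω = m} =
        {ω | deg ω = m} ∩ Z ⁻¹' {z | (z, m) ∈ T} := by
      ext ω
      constructor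
      · rintro ⟨h1, h2⟩
        exact ⟨h2, by rw [← show deg ω = m from h2]; exact h1⟩
      · rintro ⟨h2, h1⟩
        refine ⟨?_, h2⟩
        have h3 : (Z ω, m) ∈ T := h1
        rwa [← show deg ω = m from h2] at h3
    rw [e]
    exact (h _ (measurable_prodMk_right hT)).symm
  filter_upwards [h1, condExp_indicator hX hD] with ω h2 h3 hω
  rw [h3, Set.indicator_of_mem (show ω ∈ {ω | deg ω = m} from hω),
    Set.indicator_of_mem (show ω ∈ {ω | deg ω = m} from hω)] at h2
  exact h2.symm

/-- If `X` and `V` are independent given `(Z, deg)` then, on the event `deg = m`, the indicator of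
an event determined by `V` may be replaced by its conditional probability, also within an event
determined by `X`. -/
theorem IndepGiven.sameMean {X : Ω → α} {V : Ω → γ}
    (h : IndepGiven μ X V fun ω => (Z ω, deg ω)) (hX : Measurable X) (hV : Measurable V)
    (hZ : Measurable Z) (hdeg : Measurable deg) {m : ℕ} {H : Set γ} (hH : MeasurableSet H)
    {f : β → ℝ} (hf : Measurable f) {c : ℝ} (hc : ∀ z, |f z| ≤ c)
    (hfH : SameMean μ {ω | deg ω = m} Z ((V ⁻¹' H).indicator fun _ => 1) fun ω => f (Z ω))
    {G : Set α} (hG : MeasurableSet G) :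
    SameMean μ ({ω | deg ω = m} ∩ X ⁻¹' G) Z ((V ⁻¹' H).indicator fun _ => 1)
      fun ω => f (Z ω) := by
  have hp : Measurable fun ω => (Z ω, deg ω) := hZ.prodMk hdeg
  have hle : pairSigma Z deg ≤ mΩ := hp.comap_le
  have hp' : Measurable[pairSigma Z deg] fun ω => (Z ω, deg ω) := comap_measurable _
  have hD : MeasurableSet[pairSigma Z deg] {ω | deg ω = m} :=
    (measurable_snd.comp hp') (measurableSet_singleton m)
  have hint : ∀ {s : Set Ω}, MeasurableSet s → Integrable (s.indicator fun _ => (1 : ℝ)) μ :=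
    fun hs => (integrable_const 1).indicator hs
  have hXG := hX hG
  have hVH := hV hH
  have hce := condExp_eq_of_sameMean hZ hdeg (hint hVH) hf hc hfH
  have hind : SameMean μ {ω | deg ω = m} Z (μ⟦X ⁻¹' G|pairSigma Z deg⟧)
      ((X ⁻¹' G).indicator fun _ => 1) := by
    intro B hB
    exact setIntegral_condExp hle (hint hXG)
      (hD.inter ((measurable_fst.comp hp') hB))
  have hw := hind.mul_left hZ integrable_condExp.integrableOn
    (hint hXG).integrableOn hf hc
  rw [← sameMean_indicator_iff hXG]
  have e1 : (X ⁻¹' G).indicator ((V ⁻¹' H).indicator fun _ => (1 : ℝ)) =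
      (X ⁻¹' G ∩ V ⁻¹' H).indicator fun _ => 1 := by
    rw [Set.indicator_indicator]
  have e2 : (X ⁻¹' G).indicator (fun ω => f (Z ω)) =
      fun ω => f (Z ω) * (X ⁻¹' G).indicator (fun _ => 1) ω := by
    ext ω
    by_cases hω : ω ∈ X ⁻¹' G <;> simp [hω]
  rw [e1, e2]
  refine SameMean.trans ?_ hw
  refine SameMean.trans (X₂ := μ⟦X ⁻¹' G ∩ V ⁻¹' H|pairSigma Z deg⟧) ?_ ?_
  · intro B hB
    exact (setIntegral_condExp hle (hint (hXG.inter hVH))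
      (hD.inter ((measurable_fst.comp hp') hB))).symm
  · refine SameMean.of_ae (hle _ hD) ?_
    filter_upwards [h G H hG hH, hce] with ω h1 h2 hω
    rw [h1, h2 hω, mul_comm]

end condIndep

/-! ### Binomial probabilities and randomized treatments -/

/-- The binomial probability of `s` successes in `n` trials. -/
def binomProb (p : ℝ) (s n : ℕ) : ℝ := n.choose s * p ^ s * (1 - p) ^ (n - s)

theorem binomProb_pos {p : ℝ} (h0 : 0 < p) (h1 : p < 1) {s n : ℕ} (hs : s ≤ n) :
    0 < binomProb p s n := by
  have := Nat.choose_pos hs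
  have h2 : 0 < 1 - p := by linarith
  unfold binomProb
  positivity

theorem binomProb_eq_zero (p : ℝ) {s n : ℕ} (hs : n < s) : binomProb p s n = 0 := by
  simp [binomProb, Nat.choose_eq_zero_of_lt hs]

/-- The probability of treatment status `d` when treatment has probability `p`. -/
def bernProb (p : ℝ) (d : Bool) : ℝ := if d then p else 1 - p

theorem measurableSet_eval {P : Type*} (j : P) (d : Bool) :
    MeasurableSet {x : P → Bool | x j = d} := by
  have h : Measurable fun x : P → Bool => x j := measurable_pi_apply j
  exact h (measurableSet_singleton d)

theorem measurableSet_filter_eq {P : Type*} (A T : Finset P) :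
    MeasurableSet {x : P → Bool | A.filter (fun j => x j = true) = T} := by
  have e : {x : P → Bool | A.filter (fun j => x j = true) = T} =
      (⋂ j ∈ A, {x : P → Bool | x j = true ↔ j ∈ T}) ∩ {_x | T ⊆ A} := by
    ext x
    simp only [Set.mem_ofPred_eq, Set.mem_inter_iff, Set.mem_iInter]
    constructor
    · rintro rfl
      exact ⟨fun j hj => by simp [hj], Finset.filter_subset _ _⟩
    · rintro ⟨h, hTA⟩
      ext j
      rw [Finset.mem_filter]
      exact ⟨fun hj => (h j hj.1).1 hj.2, fun hj => ⟨hTA hj, (h j (hTA hj)).2 hj⟩⟩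
  rw [e]
  refine MeasurableSet.inter (Finset.measurableSet_biInter _ fun j _ => ?_) (MeasurableSet.const _)
  by_cases hj : j ∈ T
  · simpa only [hj, iff_true] using measurableSet_eval j true
  · simpa only [hj, iff_false, Bool.not_eq_true] using measurableSet_eval j false

section treatments

variable {P Ω : Type*} [MeasurableSpace Ω] {μ : Measure Ω}
  {D : P → Ω → Bool} {p : ℝ}

theorem treatedCount_congr {x y : P → Bool} {A : Finset P} (h : ∀ j ∈ A, x j = y j) :
    treatedCount x A = treatedCount y A := by
  unfold treatedCount
  exact congrArg _ (Finset.filter_congr fun j hj => by rw [h j hj])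

theorem treatedCount_union [DecidableEq P] (x : P → Bool) {A B : Finset P} (h : Disjoint A B) :
    treatedCount x (A ∪ B) = treatedCount x A + treatedCount x B := by
  unfold treatedCount
  rw [Finset.filter_union, Finset.card_union_of_disjoint (Finset.disjoint_filter_filter h)]

/-- Events that depend on the treatments of disjoint sets of units are independent. -/
theorem measureReal_and_of_disjoint (hm : ∀ j, Measurable (D j)) (hind : iIndepFun D μ)
    {S T : Finset P} (hST : Disjoint S T) {φ ψ : (P → Bool) → Prop}
    (hφ : ∀ x y : P → Bool, (∀ j ∈ S, x j = y j) → (φ x ↔ φ y))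
    (hψ : ∀ x y : P → Bool, (∀ j ∈ T, x j = y j) → (ψ x ↔ ψ y)) :
    μ.real {ω | φ (fun j => D j ω) ∧ ψ (fun j => D j ω)} =
      μ.real {ω | φ (fun j => D j ω)} * μ.real {ω | ψ (fun j => D j ω)} := by
  classical
  -- Extend treatments of a finite set of units to all units, so that the events become events of
  -- finitely many treatments.
  let ext : (S : Finset P) → (S → Bool) → P → Bool := fun S x j =>
    if h : j ∈ S then x ⟨j, h⟩ else false
  have h := hind.indepFun_finset S T hST hm
  have h1 := h.measure_inter_preimage_eq_mul {x | φ (ext S x)} {x | ψ (ext T x)}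
    (Set.toFinite _).measurableSet (Set.toFinite _).measurableSet
  have e1 : (fun ω (j : S) => D j ω) ⁻¹' {x | φ (ext S x)} = {ω | φ (fun j => D j ω)} := by
    ext ω
    exact hφ _ _ fun j hj => by simp [ext, hj]
  have e2 : (fun ω (j : T) => D j ω) ⁻¹' {x | ψ (ext T x)} = {ω | ψ (fun j => D j ω)} := by
    ext ω
    exact hψ _ _ fun j hj => by simp [ext, hj]
  rw [e1, e2] at h1
  rw [measureReal_def, measureReal_def, measureReal_def, ← ENNReal.toReal_mul, ← h1]
  rfl

variable [IsProbabilityMeasure μ]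

theorem measureReal_treatment (hm : ∀ j, Measurable (D j))
    (hp : ∀ j, μ.real {ω | D j ω = true} = p) (j : P) (d : Bool) :
    μ.real {ω | D j ω = d} = bernProb p d := by
  cases d with
  | true => simp [bernProb, hp j]
  | false =>
    have h : {ω | D j ω = false} = {ω | D j ω = true}ᶜ := by ext ω; simp
    have hmt : MeasurableSet {ω | D j ω = true} := hm j (measurableSet_singleton true)
    rw [h, probReal_compl_eq_one_sub hmt, hp j]
    simp [bernProb]

/-- The number of treated units in a given set of `n` units is binomial. -/
theorem measureReal_treatedCount (hm : ∀ j, Measurable (D j)) (hind : iIndepFun D μ)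
    (hp : ∀ j, μ.real {ω | D j ω = true} = p) (A : Finset P) (s : ℕ) :
    μ.real {ω | treatedCount (fun j => D j ω) A = s} = binomProb p s A.card := by
  classical
  -- Each set of `s` treated units has the same probability.
  have hpat : ∀ T ∈ A.powersetCard s, μ.real {ω | A.filter (fun j => D j ω = true) = T} =
      p ^ s * (1 - p) ^ (A.card - s) := by
    intro T hT
    obtain ⟨hTA, hTs⟩ := Finset.mem_powersetCard.1 hT
    have e : {ω | A.filter (fun j => D j ω = true) = T} =
        ⋂ j ∈ A, D j ⁻¹' {decide (j ∈ T)} := by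
      ext ω
      simp only [Set.mem_ofPred_eq, Set.mem_iInter, Set.mem_preimage, Set.mem_singleton_iff]
      constructor
      · rintro rfl j hj
        simp [hj]
      · intro h
        ext j
        rw [Finset.mem_filter]
        constructor
        · rintro ⟨hj, hD⟩
          rw [h j hj] at hD
          simpa using hD
        · intro hj
          exact ⟨hTA hj, by rw [h j (hTA hj)]; simpa using hj⟩
    rw [e, measureReal_def, hind.measure_inter_preimage_eq_mul _ (fun j _ =>
      measurableSet_singleton _), ENNReal.toReal_prod]
    have h1 : ∀ j ∈ A, (μ (D j ⁻¹' {decide (j ∈ T)})).toReal = if j ∈ T then p else 1 - p := by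
      intro j _
      have := measureReal_treatment hm hp j (decide (j ∈ T))
      simp only [bernProb, decide_eq_true_eq] at this
      exact this
    rw [Finset.prod_congr rfl h1, Finset.prod_ite, Finset.prod_const, Finset.prod_const,
      Finset.filter_mem_eq_inter, Finset.inter_eq_right.2 hTA, Finset.filter_notMem_eq_sdiff,
      Finset.card_sdiff_of_subset hTA, hTs]
  have e : {ω | treatedCount (fun j => D j ω) A = s} =
      ⋃ T ∈ A.powersetCard s, {ω | A.filter (fun j => D j ω = true) = T} := by
    ext ω
    simp only [Set.mem_ofPred_eq, treatedCount, Set.mem_iUnion, Finset.mem_powersetCard,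
      exists_prop, exists_eq_right', Finset.filter_subset, true_and]
  have hms : ∀ T, MeasurableSet {ω | A.filter (fun j => D j ω = true) = T} := fun T =>
    measurable_pi_lambda (fun ω j => D j ω) hm (measurableSet_filter_eq A T)
  have hdis : Set.PairwiseDisjoint (A.powersetCard s : Set (Finset P))
      (fun T => {ω | A.filter (fun j => D j ω = true) = T}) := fun T _ T' _ hTT' =>
    Set.disjoint_left.2 fun ω h1 h2 => hTT' ((show _ = T from h1).symm.trans h2)
  rw [e, measureReal_biUnion_finset hdis (fun T _ => hms T), Finset.sum_congr rfl hpat,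
    Finset.sum_const, Finset.card_powersetCard, nsmul_eq_mul, binomProb, mul_assoc]

theorem measureReal_treated_and_treatedCount (hm : ∀ j, Measurable (D j)) (hind : iIndepFun D μ)
    (hp : ∀ j, μ.real {ω | D j ω = true} = p) {i : P} {A : Finset P} (hi : i ∉ A) (d : Bool)
    (s : ℕ) :
    μ.real {ω | D i ω = d ∧ treatedCount (fun j => D j ω) A = s} =
      bernProb p d * binomProb p s A.card := by
  have := measureReal_and_of_disjoint (μ := μ) hm hind (S := {i}) (T := A)
    (Finset.disjoint_singleton_left.2 hi) (φ := fun x => x i = d)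
    (ψ := fun x => treatedCount x A = s)
    (fun x y h => by rw [h i (Finset.mem_singleton_self i)])
    (fun x y h => by rw [treatedCount_congr h])
  rw [this, measureReal_treatment hm hp, measureReal_treatedCount hm hind hp]

/-- For nested sets of units, the numbers of treated units in the smaller set and in the
complement are independent binomials. -/
theorem measureReal_treatedCount_nested (hm : ∀ j, Measurable (D j)) (hind : iIndepFun D μ)
    (hp : ∀ j, μ.real {ω | D j ω = true} = p) {i : P} {A B : Finset P} (hAB : A ⊆ B)
    (hi : i ∉ B) (d : Bool) (s t : ℕ) :
    μ.real {ω | D i ω = d ∧ treatedCount (fun j => D j ω) A = s ∧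
        treatedCount (fun j => D j ω) B = t} =
      bernProb p d * (binomProb p s A.card *
        if s ≤ t then binomProb p (t - s) (B.card - A.card) else 0) := by
  classical
  have hsum : ∀ x : P → Bool, treatedCount x B = treatedCount x A + treatedCount x (B \ A) := by
    intro x
    rw [← treatedCount_union x Finset.disjoint_sdiff, Finset.union_sdiff_of_subset hAB]
  have h1 := measureReal_and_of_disjoint (μ := μ) hm hind (S := {i}) (T := B)
    (Finset.disjoint_singleton_left.2 hi) (φ := fun x => x i = d)
    (ψ := fun x => treatedCount x A = s ∧ treatedCount x B = t)
    (fun x y h => by rw [h i (Finset.mem_singleton_self i)])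
    (fun x y h => by
      rw [treatedCount_congr h, treatedCount_congr fun j hj => h j (hAB hj)])
  rw [h1, measureReal_treatment hm hp]
  congr 1
  split_ifs with hst
  · have h2 := measureReal_and_of_disjoint (μ := μ) hm hind (S := A) (T := B \ A)
      Finset.disjoint_sdiff (φ := fun x => treatedCount x A = s)
      (ψ := fun x => treatedCount x (B \ A) = t - s)
      (fun x y h => by rw [treatedCount_congr h]) (fun x y h => by rw [treatedCount_congr h])
    rw [measureReal_treatedCount hm hind hp, measureReal_treatedCount hm hind hp,
      Finset.card_sdiff_of_subset hAB] at h2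
    rw [← h2]
    congr 1
    ext ω
    simp only [Set.mem_ofPred_eq, hsum]
    refine and_congr_right fun h => ?_
    omega
  · rw [mul_zero]
    have : {ω | treatedCount (fun j => D j ω) A = s ∧ treatedCount (fun j => D j ω) B = t} = ∅ := by
      ext ω
      simp only [Set.mem_ofPred_eq, hsum, Set.mem_empty_iff_false, iff_false]
      omega
    rw [this, measureReal_empty]

end treatments

section randomization

variable {Ω 𝓓 𝓦 ξ β : Type*} [MeasurableSpace Ω] [MeasurableSpace 𝓓] [MeasurableSpace 𝓦]
  [MeasurableSpace ξ] [MeasurableSpace β] {μ : Measure Ω}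

theorem SameMean.comp {W : Ω → 𝓦} {U : Set Ω} {X₁ X₂ : Ω → ℝ} (h : SameMean μ U W X₁ X₂)
    {f : 𝓦 → β} (hf : Measurable f) : SameMean μ U (fun ω => f (W ω)) X₁ X₂ :=
  fun _ hB => h _ (hf hB)

/-- Let `D` be independent of `W`, and let `x W` be discrete. If the probability of the event
`D ∈ G v` is the same number `c` for all values `v` that `x W` takes with positive probability
within an event determined by `W`, then `c` is the conditional probability of `D ∈ G (x W)` given
that event and `W`. -/
theorem sameMean_of_indepFun [IsFiniteMeasure μ] [Countable ξ] [MeasurableSingletonClass ξ]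
    {D : Ω → 𝓓} {W : Ω → 𝓦} (hD : Measurable D) (hW : Measurable W) (h : IndepFun D W μ)
    {x : 𝓦 → ξ} (hx : Measurable x) {G : ξ → Set 𝓓} (hG : ∀ v, MeasurableSet (G v))
    {U : Set 𝓦} (hU : MeasurableSet U) {c : ℝ}
    (hc : ∀ v, μ (W ⁻¹' U ∩ {ω | x (W ω) = v}) ≠ 0 → μ.real (D ⁻¹' G v) = c) :
    SameMean μ (W ⁻¹' U) W ({ω | D ω ∈ G (x (W ω))}.indicator fun _ => 1) fun _ => c := by
  intro B hB
  have hxs : ∀ v, MeasurableSet {w | x w = v} := fun v => hx (measurableSet_singleton v)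
  have hmeas : MeasurableSet {ω | D ω ∈ G (x (W ω))} := by
    have : {ω | D ω ∈ G (x (W ω))} = ⋃ v, D ⁻¹' G v ∩ W ⁻¹' {w | x w = v} := by
      ext ω; simp
    rw [this]
    exact MeasurableSet.iUnion fun v => (hD (hG v)).inter (hW (hxs v))
  rw [setIntegral_indicator hmeas, setIntegral_const, setIntegral_const, smul_eq_mul, mul_one,
    smul_eq_mul]
  have e1 : W ⁻¹' U ∩ W ⁻¹' B ∩ {ω | D ω ∈ G (x (W ω))} =
      ⋃ v, D ⁻¹' G v ∩ W ⁻¹' (U ∩ B ∩ {w | x w = v}) := by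
    ext ω
    simp only [Set.mem_inter_iff, Set.mem_preimage, Set.mem_ofPred_eq, Set.mem_iUnion]
    constructor
    · rintro ⟨h1, h2⟩; exact ⟨_, h2, h1, rfl⟩
    · rintro ⟨v, h1, h2, rfl⟩; exact ⟨h2, h1⟩
  have e2 : W ⁻¹' U ∩ W ⁻¹' B = ⋃ v, W ⁻¹' (U ∩ B ∩ {w | x w = v}) := by
    ext ω
    simp
  have hms : ∀ v, MeasurableSet (W ⁻¹' (U ∩ B ∩ {w | x w = v})) := fun v =>
    hW ((hU.inter hB).inter (hxs v))
  have hdis : Pairwise (Function.onFun Disjoint fun v => W ⁻¹' (U ∩ B ∩ {w | x w = v})) := by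
    intro v v' hv
    refine Set.disjoint_left.2 fun ω h1 h2 => hv ?_
    exact (show x (W ω) = v from h1.2).symm.trans h2.2
  have hdis' : Pairwise (Function.onFun Disjoint fun v =>
      D ⁻¹' G v ∩ W ⁻¹' (U ∩ B ∩ {w | x w = v})) := fun v v' hv =>
    (hdis hv).mono Set.inter_subset_right Set.inter_subset_right
  have hne : ∀ v, μ (W ⁻¹' (U ∩ B ∩ {w | x w = v})) ≠ 0 →
      μ (W ⁻¹' U ∩ {ω | x (W ω) = v}) ≠ 0 := by
    intro v h0 h1
    have hsub : W ⁻¹' (U ∩ B ∩ {w | x w = v}) ⊆ W ⁻¹' U ∩ {ω | x (W ω) = v} :=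
      fun ω hω => ⟨hω.1.1, hω.2⟩
    exact h0 (measure_mono_null hsub h1)
  have hmul : ∀ v, μ (D ⁻¹' G v ∩ W ⁻¹' (U ∩ B ∩ {w | x w = v})) =
      ENNReal.ofReal c * μ (W ⁻¹' (U ∩ B ∩ {w | x w = v})) := by
    intro v
    rw [h.measure_inter_preimage_eq_mul _ _ (hG v) ((hU.inter hB).inter (hxs v))]
    by_cases h0 : μ (W ⁻¹' (U ∩ B ∩ {w | x w = v})) = 0
    · rw [h0, mul_zero, mul_zero]
    · rw [← hc v (hne v h0),
        measureReal_def, ENNReal.ofReal_toReal (measure_ne_top _ _)]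
  have hc0 : 0 ≤ c ∨ μ (W ⁻¹' U ∩ W ⁻¹' B) = 0 := by
    by_cases hall : ∀ v, μ (W ⁻¹' (U ∩ B ∩ {w | x w = v})) = 0
    · right; rw [e2]; exact measure_iUnion_null hall
    · push Not at hall
      obtain ⟨v, hv⟩ := hall
      left
      rw [← hc v (hne v hv)]
      exact measureReal_nonneg
  have key : μ (W ⁻¹' U ∩ W ⁻¹' B ∩ {ω | D ω ∈ G (x (W ω))}) =
      ENNReal.ofReal c * μ (W ⁻¹' U ∩ W ⁻¹' B) := by
    rw [e1, measure_iUnion hdis' fun v => (hD (hG v)).inter (hms v)]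
    simp_rw [hmul]
    rw [ENNReal.tsum_mul_left, ← measure_iUnion hdis hms, ← e2]
  rw [measureReal_def, key, ENNReal.toReal_mul]
  rcases hc0 with hc0 | hc0
  · rw [ENNReal.toReal_ofReal hc0, measureReal_def, mul_comm]
  · simp [measureReal_def, hc0]

end randomization

/-! ### Supports, densities and integrals over fibres -/

section supports

theorem exists_indicator_bound {β : Type*} [TopologicalSpace β] {S : Set β} (hS : IsCompact S)
    {f : β → ℝ} (hf : ContinuousOn f S) : ∃ c : ℝ, ∀ z, |S.indicator f z| ≤ c := by
  obtain ⟨c, hc⟩ := hS.exists_bound_of_continuousOn hf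
  refine ⟨max c 0, fun z => ?_⟩
  by_cases hz : z ∈ S
  · rw [Set.indicator_of_mem hz]; exact (hc z hz).trans (le_max_left _ _)
  · rw [Set.indicator_of_notMem hz]; simp

variable {Ω β : Type*} [MeasurableSpace Ω] {μ : Measure Ω} [TopologicalSpace β]
  [MeasurableSpace β] {Z : Ω → β}

theorem ae_mem_support_map [SecondCountableTopology β] (hZ : Measurable Z) :
    ∀ᵐ ω ∂μ, Z ω ∈ (μ.map Z).support :=
  ae_of_ae_map hZ.aemeasurable Measure.support_mem_ae

theorem measurable_indicator_of_continuousOn [BorelSpace β] {S : Set β} (hS : IsClosed S)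
    {f : β → ℝ} (hf : ContinuousOn f S) : Measurable (S.indicator f) := by
  classical
  have := hf.measurable_piecewise (g := fun _ => (0 : ℝ)) continuousOn_const hS.measurableSet
  rwa [show S.piecewise f (fun _ => 0) = S.indicator f from Set.piecewise_eq_indicator] at this

variable [SecondCountableTopology β] [BorelSpace β]

/-- Functions that are continuous on the support of a law are equal there as soon as they are
equal almost everywhere. -/
theorem eqOn_support_of_ae (hZ : Measurable Z) {f g : β → ℝ}
    (hf : ContinuousOn f (μ.map Z).support) (hg : ContinuousOn g (μ.map Z).support)
    (h : ∀ᵐ ω ∂μ, f (Z ω) = g (Z ω)) : Set.EqOn f g (μ.map Z).support := by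
  intro z hz
  by_contra hne
  have hev : ∀ᶠ x in 𝓝[(μ.map Z).support] z, f x - g x ≠ 0 :=
    ((hf.sub hg) z hz).eventually_ne (sub_ne_zero.2 hne)
  obtain ⟨V, hV, hzV, hsub⟩ := mem_nhdsWithin.1 hev
  have hpos := (Measure.mem_support_iff_forall z).1 hz V (hV.mem_nhds hzV)
  rw [Measure.map_apply hZ hV.measurableSet] at hpos
  refine hpos.ne' ?_
  have hnull : ∀ᵐ ω ∂μ, ω ∉ Z ⁻¹' V := by
    filter_upwards [h, ae_mem_support_map hZ] with ω h1 h2 h3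
    exact hsub ⟨h3, h2⟩ (by rw [h1, sub_self])
  have h0 := ae_iff.1 hnull
  simp only [not_not] at h0
  exact h0

/-- Functions that are continuous on the compact support of `Z` and have the same conditional mean
given `Z` are equal on the support. -/
theorem SameMean.eqOn_support [IsFiniteMeasure μ] (hZ : Measurable Z)
    (hS : IsCompact (μ.map Z).support) {f g : β → ℝ}
    (hf : ContinuousOn f (μ.map Z).support) (hg : ContinuousOn g (μ.map Z).support)
    (h : SameMean μ Set.univ Z (fun ω => f (Z ω)) fun ω => g (Z ω)) :
    Set.EqOn f g (μ.map Z).support := by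
  set S := (μ.map Z).support
  have hcl : IsClosed S := Measure.isClosed_support
  have hae : ∀ᵐ ω ∂μ, Z ω ∈ S := ae_mem_support_map hZ
  have hint : ∀ f : β → ℝ, ContinuousOn f S → Integrable (S.indicator f) (μ.map Z) := by
    intro f hf
    obtain ⟨c, hc⟩ := exists_indicator_bound hS hf
    exact Integrable.of_bound (measurable_indicator_of_continuousOn hcl hf).aestronglyMeasurable c
      (Eventually.of_forall hc)
  have hmap : ∀ f : β → ℝ, ContinuousOn f S → ∀ B, MeasurableSet B →
      ∫ z in B, S.indicator f z ∂μ.map Z = ∫ ω in Set.univ ∩ Z ⁻¹' B, f (Z ω) ∂μ := by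
    intro f hf B hB
    rw [setIntegral_map hB (measurable_indicator_of_continuousOn hcl hf).aestronglyMeasurable
      hZ.aemeasurable, Set.univ_inter]
    refine integral_congr_ae (ae_restrict_of_ae ?_)
    filter_upwards [hae] with ω hω
    rw [Set.indicator_of_mem hω]
  have hab : S.indicator f =ᵐ[μ.map Z] S.indicator g := by
    refine (hint f hf).ae_eq_of_forall_setIntegral_eq _ _ (hint g hg) fun B hB _ => ?_
    rw [hmap f hf B hB, hmap g hg B hB]
    exact h B hB
  refine eqOn_support_of_ae hZ hf hg ?_
  filter_upwards [ae_of_ae_map hZ.aemeasurable hab, hae] with ω h1 h2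
  rwa [Set.indicator_of_mem h2, Set.indicator_of_mem h2] at h1

end supports

section densities

variable {Ω α : Type*} [MeasurableSpace Ω] [MeasurableSpace α] {μ : Measure Ω} {A : Set Ω}
  {X : Ω → α} {base : Measure α} {g : α → ℝ}

theorem IsDensityOn.setIntegral_eq (h : IsDensityOn μ A X base g) (hX : Measurable X)
    (hg : AEMeasurable g base) (hg0 : ∀ᵐ x ∂base, 0 ≤ g x)
    {φ : α → ℝ} (hφ : Measurable φ) {B : Set α} (hB : MeasurableSet B) :
    ∫ ω in A ∩ X ⁻¹' B, φ (X ω) ∂μ = ∫ x in B, g x * φ x ∂base := by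
  have e1 : ∫ ω in A ∩ X ⁻¹' B, φ (X ω) ∂μ = ∫ x in B, φ x ∂(μ.restrict A).map X := by
    rw [setIntegral_map hB hφ.aestronglyMeasurable hX.aemeasurable,
      Measure.restrict_restrict (hX hB), Set.inter_comm]
  rw [e1, h, ← integral_indicator hB, integral_withDensity_eq_integral_toReal_smul₀
    hg.ennreal_ofReal (Eventually.of_forall fun x => ENNReal.ofReal_lt_top),
    ← integral_indicator hB]
  refine integral_congr_ae ?_
  filter_upwards [hg0] with x hx
  by_cases hxB : x ∈ B
  · simp [hxB, ENNReal.toReal_ofReal hx]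
  · simp [hxB]

end densities

section geometry

variable {q r : ℕ} {C : Set (ℝ × (Fin q → ℝ))}

theorem isCompact_proj (hC : IsCompact C) : IsCompact (Prod.snd '' C) := hC.image continuous_snd

theorem isCompact_setOf_fst_mem {X : Type*} [TopologicalSpace X] {s : Set X} (hs : IsCompact s) :
    IsCompact {z : X × Fin r | z.1 ∈ s} := by
  have : {z : X × Fin r | z.1 ∈ s} = s ×ˢ Set.univ := by ext; simp
  rw [this]
  exact hs.prod isCompact_univ

theorem continuousOn_setOf_fst_mem {X : Type*} [TopologicalSpace X] {s : Set X} {f : X × Fin r → ℝ}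
    (hf : ∀ d, ContinuousOn (fun x => f (x, d)) s) :
    ContinuousOn f {z : X × Fin r | z.1 ∈ s} :=
  continuousOn_prod_of_discrete_right.2 hf

theorem isCompact_setOf_pair_mem (hC : IsCompact C) :
    IsCompact {w : ℝ × Cov q r | (w.1, w.2.1) ∈ C} := by
  have h := (isCompact_setOf_fst_mem (r := r) hC).image
    (f := fun u => ((u.1.1, (u.1.2, u.2)) : ℝ × Cov q r)) (by fun_prop)
  convert h using 1
  ext w
  constructor
  · intro hw; exact ⟨((w.1, w.2.1), w.2.2), hw, rfl⟩
  · rintro ⟨u, hu, rfl⟩; exact hu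

theorem continuousOn_setOf_pair_mem {f : ℝ → Cov q r → ℝ}
    (hf : ∀ d, ContinuousOn (fun w : ℝ × (Fin q → ℝ) => f w.1 (w.2, d)) C) :
    ContinuousOn (fun w : ℝ × Cov q r => f w.1 w.2) {w | (w.1, w.2.1) ∈ C} := by
  have h := continuousOn_setOf_fst_mem
    (f := fun u : (ℝ × (Fin q → ℝ)) × Fin r => f u.1.1 (u.1.2, u.2)) hf
  exact h.comp (t := {u : (ℝ × (Fin q → ℝ)) × Fin r | u.1 ∈ C})
    (f := fun w : ℝ × Cov q r => ((w.1, w.2.1), w.2.2)) (by fun_prop) fun w hw => hw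

/-- Integrals over the sections of a compact convex set depend continuously on the section along
the segment from a point to any other point of the projection. -/
theorem tendsto_integral_fiber (hC : IsCompact C) (hconv : Convex ℝ C)
    {f : ℝ × (Fin q → ℝ) → ℝ} (hf : ContinuousOn f C) {x x₁ : Fin q → ℝ}
    (hx₁ : x₁ ∈ Prod.snd '' C) {t : ℕ → ℝ} (ht0 : ∀ k, 0 ≤ t k)
    (ht1 : ∀ k, t k < 1) (ht : Tendsto t atTop (𝓝 0)) :
    Tendsto (fun k => ∫ y in {y : ℝ | (y, (1 - t k) • x + t k • x₁) ∈ C},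
      f (y, (1 - t k) • x + t k • x₁)) atTop (𝓝 (∫ y in {y : ℝ | (y, x) ∈ C}, f (y, x))) := by
  have hfib : ∀ u, MeasurableSet {y : ℝ | (y, u) ∈ C} := fun u =>
    (isCompact_fiber hC u).measurableSet
  have hfc : ∀ u, ContinuousOn (fun y => f (y, u)) {y : ℝ | (y, u) ∈ C} := fun u =>
    hf.comp (t := C) (f := fun y : ℝ => (y, u)) (by fun_prop) fun y hy => hy
  obtain ⟨M, hM⟩ := hC.exists_bound_of_continuousOn hf
  have hCy : IsCompact (Prod.fst '' C) := hC.image continuous_fst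
  set u : ℕ → Fin q → ℝ := fun k => (1 - t k) • x + t k • x₁
  have hut : Tendsto u atTop (𝓝 x) := by
    have h1 : Tendsto (fun k => (1 - t k) • x + t k • x₁) atTop
        (𝓝 ((1 - (0 : ℝ)) • x + (0 : ℝ) • x₁)) :=
      ((tendsto_const_nhds.sub ht).smul_const x).add (ht.smul_const x₁)
    simpa using h1
  obtain ⟨⟨y₁, x₁'⟩, hy₁, rfl⟩ := hx₁
  have e : ∀ v, ∫ y in {y : ℝ | (y, v) ∈ C}, f (y, v) =
      ∫ y, {y : ℝ | (y, v) ∈ C}.indicator (fun y => f (y, v)) y := fun v =>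
    (integral_indicator (hfib v)).symm
  change Tendsto (fun k => ∫ y in {y : ℝ | (y, u k) ∈ C}, f (y, u k)) atTop _
  simp_rw [e]
  refine tendsto_integral_of_dominated_convergence
    ((Prod.fst '' C).indicator fun _ => max M 0) ?_ ?_ ?_ ?_
  · intro k
    exact (aestronglyMeasurable_indicator_iff (hfib _)).2
      ((hfc (u k)).aestronglyMeasurable (hfib _))
  · exact (integrable_indicator_iff hCy.measurableSet).2
      (integrableOn_const hCy.measure_ne_top)
  · intro k
    refine Eventually.of_forall fun y => ?_
    by_cases hy : (y, u k) ∈ C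
    · rw [Set.indicator_of_mem (show y ∈ {y : ℝ | (y, u k) ∈ C} from hy),
        Set.indicator_of_mem (show y ∈ Prod.fst '' C from ⟨_, hy, rfl⟩)]
      exact (hM _ hy).trans (le_max_left _ _)
    · rw [Set.indicator_of_notMem (show y ∉ {y : ℝ | (y, u k) ∈ C} from hy), norm_zero]
      exact Set.indicator_nonneg (fun _ _ => le_max_right _ _) _
  · -- The indicators converge off the frontier of the section at `x`, which is a null set because
    -- the section is convex.
    have hcx : Convex ℝ {y : ℝ | (y, x) ∈ C} := by
      intro a ha b hb s s' hs hs' hss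
      have := hconv ha hb hs hs' hss
      simp only [Prod.smul_mk, Prod.mk_add_mk, ← add_smul, hss, one_smul] at this
      exact this
    have hfr : ∀ᵐ y : ℝ, y ∉ frontier {y : ℝ | (y, x) ∈ C} := by
      rw [ae_iff]
      simpa using hcx.addHaar_frontier volume
    filter_upwards [hfr] with y hy
    by_cases hyC : (y, x) ∈ C
    · -- An interior point `y` of the section stays in the sections along the segment: `(y, u k)`
      -- lies on the segment from `(y₁, x₁)` to a point of the section near `(y, x)`.
      have hint : y ∈ interior {y : ℝ | (y, x) ∈ C} := by
        by_contra hni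
        exact hy ⟨subset_closure hyC, hni⟩
      have hev : ∀ᶠ k in atTop, (y, u k) ∈ C := by
        have h1 : Tendsto (fun k => (1 - t k)⁻¹ * (y - t k * y₁)) atTop (𝓝 y) := by
          have h2 : Tendsto (fun k => (1 - t k)⁻¹ * (y - t k * y₁)) atTop
              (𝓝 ((1 - (0 : ℝ))⁻¹ * (y - 0 * y₁))) :=
            ((tendsto_const_nhds.sub ht).inv₀ (by norm_num)).mul
              (tendsto_const_nhds.sub (ht.mul_const y₁))
          simpa using h2
        filter_upwards [h1.eventually (mem_interior_iff_mem_nhds.1 hint)] with k hk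
        have hpos : 0 < 1 - t k := by linarith [ht1 k]
        have h3 := hconv hk hy₁ hpos.le (ht0 k) (by ring)
        simp only [Prod.smul_mk, Prod.mk_add_mk, smul_eq_mul] at h3
        rw [mul_inv_cancel_left₀ hpos.ne', sub_add_cancel] at h3
        exact h3
      rw [Set.indicator_of_mem (show y ∈ {y : ℝ | (y, x) ∈ C} from hyC)]
      have hlim : Tendsto (fun k => (y, u k)) atTop (𝓝[C] (y, x)) :=
        tendsto_nhdsWithin_iff.2 ⟨tendsto_const_nhds.prodMk_nhds hut, hev⟩
      refine ((hf _ hyC).tendsto.comp hlim).congr' ?_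
      filter_upwards [hev] with k hk
      rw [Set.indicator_of_mem (show y ∈ {y : ℝ | (y, u k) ∈ C} from hk)]
      rfl
    · rw [Set.indicator_of_notMem (show y ∉ {y : ℝ | (y, x) ∈ C} from hyC)]
      have hlim : Tendsto (fun k => (y, u k)) atTop (𝓝 (y, x)) :=
        tendsto_const_nhds.prodMk_nhds hut
      refine tendsto_const_nhds.congr' ?_
      filter_upwards [hlim.eventually (hC.isClosed.isOpen_compl.mem_nhds hyC)] with k hk
      rw [Set.indicator_of_notMem (show y ∉ {y : ℝ | (y, u k) ∈ C} from hk)]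

/-- If `Q` holds almost everywhere and `s` has positive measure, then some `x₁ ∈ s` is such that
`Q` holds along a given sequence of points of the segment from `x` to `x₁`. -/
theorem exists_forall_segment_of_ae {Q : (Fin q → ℝ) → Prop} (hQ : ∀ᵐ x : Fin q → ℝ, Q x)
    {s : Set (Fin q → ℝ)} (hs : volume s ≠ 0) (x : Fin q → ℝ) {t : ℕ → ℝ} (ht : ∀ k, t k ≠ 0) :
    ∃ x₁ ∈ s, ∀ k, Q ((1 - t k) • x + t k • x₁) := by
  have h1 : ∀ k, ∀ᵐ x₁ : Fin q → ℝ, Q ((1 - t k) • x + t k • x₁) := by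
    intro k
    rw [ae_iff] at hQ ⊢
    have e : {x₁ | ¬ Q ((1 - t k) • x + t k • x₁)} =
        (fun x₁ => t k • x₁) ⁻¹' ((fun y => (1 - t k) • x + y) ⁻¹' {y | ¬ Q y}) := rfl
    rw [e, Measure.addHaar_preimage_smul _ (ht k), measure_preimage_add, hQ, mul_zero]
  have h2 := ae_all_iff.2 h1
  by_contra! hcon
  refine hs (measure_mono_null (fun x₁ hx₁ => ?_) (ae_iff.1 h2))
  obtain ⟨k, hk⟩ := hcon x₁ hx₁
  exact fun h => hk (h k)

end geometry

/-! ### Densities as conditional probabilities and moments -/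

section observables

variable {Ω : Type*} [MeasurableSpace Ω] {μ : Measure Ω} {q r : ℕ} {C : Set (ℝ × (Fin q → ℝ))}
  {Y : Ω → ℝ} {Z : Ω → Cov q r}

theorem support_subset_proj (hC : IsCompact C) (hZ : Measurable Z)
    (hYC : ∀ᵐ ω ∂μ, (Y ω, (Z ω).1) ∈ C) :
    (μ.map Z).support ⊆ {z | z.1 ∈ Prod.snd '' C} := by
  refine Measure.support_subset_of_isClosed
    ((isCompact_proj hC).isClosed.preimage continuous_fst) ?_
  refine (ae_map_iff hZ.aemeasurable ?_).2 ?_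
  · exact ((isCompact_proj hC).isClosed.preimage continuous_fst).measurableSet
  · filter_upwards [hYC] with ω hω
    exact ⟨_, hω, rfl⟩

theorem isCompact_support_map (hC : IsCompact C) (hZ : Measurable Z)
    (hYC : ∀ᵐ ω ∂μ, (Y ω, (Z ω).1) ∈ C) : IsCompact (μ.map Z).support :=
  (isCompact_setOf_fst_mem (isCompact_proj hC)).of_isClosed_subset Measure.isClosed_support
    (support_subset_proj hC hZ hYC)

theorem aemeasurable_baseZ (hC : IsCompact C) {g : Cov q r → ℝ}
    (hg : ∀ d, ContinuousOn (fun x => g (x, d)) (Prod.snd '' C)) :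
    AEMeasurable g (baseZ r C) :=
  (continuousOn_setOf_fst_mem hg).aemeasurable
    (isCompact_setOf_fst_mem (isCompact_proj hC)).measurableSet

theorem ae_nonneg_baseZ (hC : IsCompact C) {g : Cov q r → ℝ}
    (hg0 : ∀ d, ∀ x ∈ Prod.snd '' C, 0 ≤ g (x, d)) : ∀ᵐ z ∂baseZ r C, 0 ≤ g z :=
  (ae_restrict_iff' (isCompact_setOf_fst_mem (isCompact_proj hC)).measurableSet).2
    (Eventually.of_forall fun z hz => hg0 z.2 z.1 hz)

/-- The ratio of the density of `Z` on `A` to the density of `Z` is the conditional probability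
of `A` given `Z`. -/
theorem sameMean_density_ratio [IsProbabilityMeasure μ] (hC : IsCompact C) (hZ : Measurable Z)
    (hYC : ∀ᵐ ω ∂μ, (Y ω, (Z ω).1) ∈ C) {A : Set Ω} (hA : MeasurableSet A) {g fZ : Cov q r → ℝ}
    (hg : ∀ d, ContinuousOn (fun x => g (x, d)) (Prod.snd '' C))
    (hg0 : ∀ d, ∀ x ∈ Prod.snd '' C, 0 ≤ g (x, d))
    (hf : ∀ d, ContinuousOn (fun x => fZ (x, d)) (Prod.snd '' C))
    (hf0 : ∀ d, ∀ x ∈ Prod.snd '' C, 0 ≤ fZ (x, d))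
    (hgd : IsDensityOn μ A Z (baseZ r C) g) (hfd : IsDensityOn μ Set.univ Z (baseZ r C) fZ)
    (hpos : ∀ z ∈ (μ.map Z).support, 0 < fZ z) :
    ContinuousOn (fun z => g z / fZ z) (μ.map Z).support ∧
      SameMean μ Set.univ Z (A.indicator fun _ => 1) fun ω => g (Z ω) / fZ (Z ω) := by
  set S := (μ.map Z).support
  have hsub : S ⊆ {z | z.1 ∈ Prod.snd '' C} := support_subset_proj hC hZ hYC
  have hcl : IsClosed S := Measure.isClosed_support
  have hae : ∀ᵐ ω ∂μ, Z ω ∈ S := ae_mem_support_map hZ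
  have hcont : ContinuousOn (fun z => g z / fZ z) S :=
    ((continuousOn_setOf_fst_mem hg).mono hsub).div ((continuousOn_setOf_fst_mem hf).mono hsub)
      fun z hz => (hpos z hz).ne'
  refine ⟨hcont, fun B hB => ?_⟩
  set k : Cov q r → ℝ := S.indicator fun z => g z / fZ z with hk
  have hkm : Measurable k := measurable_indicator_of_continuousOn hcl hcont
  have hBS : MeasurableSet (B ∩ S) := hB.inter hcl.measurableSet
  have hrestr := (eventuallyEq_set (l := ae μ) (s := Set.univ ∩ Z ⁻¹' B)
      (t := Set.univ ∩ Z ⁻¹' (B ∩ S))).2 <| by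
    filter_upwards [hae] with ω hω
    simp [hω]
  rw [setIntegral_congr_set hrestr, setIntegral_congr_set hrestr, setIntegral_indicator hA]
  have e1 : ∫ ω in Set.univ ∩ Z ⁻¹' (B ∩ S) ∩ A, (1 : ℝ) ∂μ = ∫ z in B ∩ S, g z ∂baseZ r C := by
    have := hgd.setIntegral_eq hZ (aemeasurable_baseZ hC hg) (ae_nonneg_baseZ hC hg0)
      (φ := fun _ => 1) measurable_const hBS
    simpa [Set.inter_comm] using this
  have e2 : ∫ ω in Set.univ ∩ Z ⁻¹' (B ∩ S), g (Z ω) / fZ (Z ω) ∂μ =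
      ∫ z in B ∩ S, fZ z * k z ∂baseZ r C := by
    rw [← hfd.setIntegral_eq hZ (aemeasurable_baseZ hC hf) (ae_nonneg_baseZ hC hf0) hkm hBS]
    refine integral_congr_ae (ae_restrict_of_ae ?_)
    filter_upwards [hae] with ω hω
    rw [hk, Set.indicator_of_mem hω]
  rw [e1, e2]
  refine setIntegral_congr_fun hBS fun z hz => ?_
  simp only [hk, Set.indicator_of_mem hz.2]
  rw [mul_div_cancel₀ _ (hpos z hz.2).ne']

/-- If `k` is the conditional mean of `Y` on the event `A` given `Z`, then the integral of `y`
against the density of `(Y, Z)` on `A` over the section at `z` is `k z` times the density of `Z`.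
This holds at every point of the support, because both sides depend continuously on the point
along segments in the projection of `C`. -/
theorem integral_fiber_eq [IsProbabilityMeasure μ] (hC : IsCompact C) (hconv : Convex ℝ C)
    (hY : Measurable Y) (hZ : Measurable Z) (hYC : ∀ᵐ ω ∂μ, (Y ω, (Z ω).1) ∈ C) {A : Set Ω}
    {f : ℝ → Cov q r → ℝ} {fZ : Cov q r → ℝ}
    (hf : ∀ d, ContinuousOn (fun w : ℝ × (Fin q → ℝ) => f w.1 (w.2, d)) C)
    (hf0 : ∀ d, ∀ w ∈ C, 0 ≤ f w.1 (w.2, d))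
    (hfZ : ∀ d, ContinuousOn (fun x => fZ (x, d)) (Prod.snd '' C))
    (hfZ0 : ∀ d, ∀ x ∈ Prod.snd '' C, 0 ≤ fZ (x, d))
    (hfd : IsDensityOn μ A (fun ω => (Y ω, Z ω)) (baseYZ r C) fun w => f w.1 w.2)
    (hfZd : IsDensityOn μ Set.univ Z (baseZ r C) fZ)
    (hpos : ∀ z ∈ (μ.map Z).support, 0 < fZ z) {k : Cov q r → ℝ}
    (hk : ContinuousOn k (μ.map Z).support)
    (hkY : ∀ B, MeasurableSet B →
      ∫ ω in A ∩ Z ⁻¹' B, Y ω ∂μ = ∫ ω in Set.univ ∩ Z ⁻¹' B, k (Z ω) ∂μ)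
    {z : Cov q r} (hz : z ∈ (μ.map Z).support) :
    ∫ y in {y : ℝ | (y, z.1) ∈ C}, y * f y z = k z * fZ z := by
  set S := (μ.map Z).support
  set C1 := Prod.snd '' C
  have hC1c : IsCompact C1 := isCompact_proj hC
  have hsub : S ⊆ {z | z.1 ∈ C1} := support_subset_proj hC hZ hYC
  have hScl : IsClosed S := Measure.isClosed_support
  have hSc : IsCompact S := isCompact_support_map hC hZ hYC
  have hae : ∀ᵐ ω ∂μ, Z ω ∈ S := ae_mem_support_map hZ
  set lam : Measure (Cov q r) := (volume : Measure (Fin q → ℝ)).prod Measure.count with hlam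
  set k' : Cov q r → ℝ := S.indicator k with hk'
  have hk'm : Measurable k' := measurable_indicator_of_continuousOn hScl hk
  obtain ⟨c, hc⟩ := exists_indicator_bound hSc hk
  have hproj : MeasurableSet {z : Cov q r | z.1 ∈ C1} :=
    (isCompact_setOf_fst_mem hC1c).measurableSet
  set C2 : Set (ℝ × Cov q r) := {w | (w.1, w.2.1) ∈ C} with hC2
  have hC2c : IsCompact C2 := isCompact_setOf_pair_mem hC
  have hfC2 : ContinuousOn (fun w : ℝ × Cov q r => f w.1 w.2) C2 := continuousOn_setOf_pair_mem hf
  set H : Cov q r → ℝ := fun z => ∫ y in {y : ℝ | (y, z.1) ∈ C}, y * f y z with hH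
  set G : Cov q r → ℝ := {z : Cov q r | z.1 ∈ C1}.indicator fun z => fZ z * k' z with hG
  set F2 : ℝ × Cov q r → ℝ := C2.indicator fun w => f w.1 w.2 * w.1 with hF2
  have hF2i : Integrable F2 ((volume : Measure ℝ).prod lam) :=
    (integrable_indicator_iff hC2c.measurableSet).2
      ((hfC2.mul continuous_fst.continuousOn).integrableOn_compact hC2c)
  have hHF : ∀ z, H z = ∫ y, F2 (y, z) := by
    intro z
    simp only [hH]
    rw [← integral_indicator (isCompact_fiber hC z.1).measurableSet]
    refine integral_congr_ae (Eventually.of_forall fun y => ?_)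
    by_cases hy : (y, z.1) ∈ C
    · simp only [hF2]
      rw [Set.indicator_of_mem (show y ∈ {y : ℝ | (y, z.1) ∈ C} from hy),
        Set.indicator_of_mem (show (y, z) ∈ C2 from hy), mul_comm]
    · simp only [hF2]
      rw [Set.indicator_of_notMem (show y ∉ {y : ℝ | (y, z.1) ∈ C} from hy),
        Set.indicator_of_notMem (show (y, z) ∉ C2 from hy)]
  have hHi : Integrable H lam := by
    have := hF2i.integral_prod_right
    exact this.congr (Eventually.of_forall fun z => (hHF z).symm)
  have hGi : Integrable G lam := by
    refine (integrable_indicator_iff hproj).2 ?_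
    have h1 : IntegrableOn fZ {z : Cov q r | z.1 ∈ C1} lam :=
      (continuousOn_setOf_fst_mem hfZ).integrableOn_compact (isCompact_setOf_fst_mem hC1c)
    exact h1.mul_bdd (c := c) hk'm.aestronglyMeasurable (Eventually.of_forall hc)
  -- Both sides have the same integrals over all measurable sets, so they agree almost everywhere.
  have hHB : ∀ B, MeasurableSet B → ∫ ω in A ∩ Z ⁻¹' B, Y ω ∂μ = ∫ z in B, H z ∂lam := by
    intro B hB
    have h1 := hfd.setIntegral_eq (hY.prodMk hZ) (hfC2.aemeasurable hC2c.measurableSet)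
      ((ae_restrict_iff' hC2c.measurableSet).2
        (Eventually.of_forall fun w hw => hf0 w.2.2 _ hw)) measurable_fst
      (MeasurableSet.univ.prod hB)
    have h2 : A ∩ (fun ω => (Y ω, Z ω)) ⁻¹' (Set.univ ×ˢ B) = A ∩ Z ⁻¹' B := by
      ext ω; simp
    rw [h2] at h1
    rw [h1, baseYZ, Measure.restrict_restrict (MeasurableSet.univ.prod hB), ← hC2]
    have h3 : ∀ w, (Set.univ ×ˢ B ∩ C2).indicator (fun w : ℝ × Cov q r => f w.1 w.2 * w.1) w =
        (Set.univ ×ˢ B).indicator F2 w := fun w => by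
      rw [hF2, Set.indicator_indicator]
    rw [← integral_indicator ((MeasurableSet.univ.prod hB).inter hC2c.measurableSet),
      integral_congr_ae (Eventually.of_forall h3), integral_prod_symm _
        (hF2i.indicator (MeasurableSet.univ.prod hB)), ← integral_indicator hB]
    refine integral_congr_ae (Eventually.of_forall fun z => ?_)
    by_cases hzB : z ∈ B
    · simp only [Set.indicator_of_mem hzB, hHF]
      refine integral_congr_ae (Eventually.of_forall fun y => ?_)
      simp [hzB, Set.indicator]
    · simp only [Set.indicator_of_notMem hzB]
      rw [← integral_zero ℝ ℝ (μ := volume)]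
      refine integral_congr_ae (Eventually.of_forall fun y => ?_)
      simp [hzB, Set.indicator]
  have hGB : ∀ B, MeasurableSet B →
      ∫ ω in Set.univ ∩ Z ⁻¹' B, k (Z ω) ∂μ = ∫ z in B, G z ∂lam := by
    intro B hB
    have h1 := hfZd.setIntegral_eq hZ (aemeasurable_baseZ hC hfZ) (ae_nonneg_baseZ hC hfZ0)
      hk'm hB
    rw [baseZ, Measure.restrict_restrict hB, ← setIntegral_indicator hproj] at h1
    rw [← h1]
    refine integral_congr_ae (ae_restrict_of_ae ?_)
    filter_upwards [hae] with ω hω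
    rw [hk', Set.indicator_of_mem hω]
  have hHG : H =ᵐ[lam] G := hHi.ae_eq_of_forall_setIntegral_eq _ _ hGi fun B hB _ => by
    rw [← hHB B hB, ← hGB B hB, hkY B hB]
  -- Almost every point of positive density is in the support.
  have hin : ∀ᵐ z ∂lam, z.1 ∈ C1 → 0 < fZ z → z ∈ S := by
    have h1 : (μ.map Z) Sᶜ = 0 := Measure.measure_compl_support
    have h2 := hfZd
    rw [IsDensityOn, Measure.restrict_univ] at h2
    rw [h2, withDensity_apply _ hScl.measurableSet.compl,
      lintegral_eq_zero_iff' ((aemeasurable_baseZ hC hfZ).ennreal_ofReal.mono_measure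
        Measure.restrict_le_self)] at h1
    have h3 := (ae_restrict_iff' hScl.measurableSet.compl).1 h1
    have h4 := (ae_restrict_iff' hproj).1 h3
    filter_upwards [h4] with z hz hz1 hzp
    by_contra hzS
    have := hz hz1 hzS
    simp only [Pi.zero_apply, ENNReal.ofReal_eq_zero] at this
    linarith
  have hslice : ∀ᵐ x : Fin q → ℝ, H (x, z.2) = G (x, z.2) ∧
      (x ∈ C1 → 0 < fZ (x, z.2) → (x, z.2) ∈ S) := by
    have h1 : lam {w | ¬ (H w = G w ∧ (w.1 ∈ C1 → 0 < fZ w → w ∈ S))} = 0 :=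
      ae_iff.1 (hHG.and hin)
    rw [ae_iff]
    have h2 : {x : Fin q → ℝ | ¬ (H (x, z.2) = G (x, z.2) ∧
        (x ∈ C1 → 0 < fZ (x, z.2) → (x, z.2) ∈ S))} ×ˢ {z.2} ⊆
          {w : Cov q r | ¬ (H w = G w ∧ (w.1 ∈ C1 → 0 < fZ w → w ∈ S))} := by
      rintro ⟨x, d⟩ ⟨hx, hd⟩
      have hd' : d = z.2 := hd
      subst hd'
      exact hx
    have h3 := measure_mono_null h2 h1
    rw [hlam, Measure.prod_prod, Measure.count_singleton, mul_one] at h3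
    exact h3
  have hvol : volume C1 ≠ 0 := by
    intro h0
    have h1 : baseZ r C = 0 := by
      refine Measure.restrict_eq_zero.2 ?_
      have h2 : {z : Cov q r | z.1 ∈ C1} = C1 ×ˢ Set.univ := by ext; simp
      rw [h2, Measure.prod_prod, h0, zero_mul]
    have h2 := hfZd
    rw [IsDensityOn, Measure.restrict_univ, h1, withDensity_zero_left] at h2
    have h3 : (μ.map Z) Set.univ = 1 := by
      rw [Measure.map_apply hZ MeasurableSet.univ]
      simp
    rw [h2] at h3
    simp at h3
  -- The weights tend to zero inside `(0, 1)`: `t n < 1` is needed for sections along the segment,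
  -- `t n ≠ 0` for the choice of a generic end point.
  set t : ℕ → ℝ := fun n => 1 / ((n : ℝ) + 2) with ht
  have ht0 : ∀ n, 0 < t n := fun n => by positivity
  have ht1 : ∀ n, t n < 1 := fun n => by
    rw [ht, div_lt_one (by positivity)]
    have : (0 : ℝ) ≤ n := n.cast_nonneg
    linarith
  have htl : Tendsto t atTop (𝓝 0) := by
    have h1 := (tendsto_add_atTop_iff_nat 1).2 (tendsto_one_div_add_atTop_nhds_zero_nat (𝕜 := ℝ))
    refine h1.congr fun n => ?_
    simp only [ht]
    push_cast
    ring
  -- Points `u n` of the projection that tend to `z` and at which the almost sure identity holds.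
  obtain ⟨x₁, hx₁, hseg⟩ := exists_forall_segment_of_ae hslice hvol z.1 fun n => (ht0 n).ne'
  set u : ℕ → Fin q → ℝ := fun n => (1 - t n) • z.1 + t n • x₁
  have hzC1 : z.1 ∈ C1 := hsub hz
  have hC1conv : Convex ℝ C1 := hconv.linear_image (LinearMap.snd ℝ ℝ (Fin q → ℝ))
  have huC1 : ∀ n, u n ∈ C1 := fun n =>
    hC1conv hzC1 hx₁ (by linarith [ht1 n]) (ht0 n).le (by ring)
  have hut : Tendsto u atTop (𝓝 z.1) := by
    have h1 : Tendsto (fun n => (1 - t n) • z.1 + t n • x₁) atTop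
        (𝓝 ((1 - (0 : ℝ)) • z.1 + (0 : ℝ) • x₁)) :=
      ((tendsto_const_nhds.sub htl).smul_const z.1).add (htl.smul_const x₁)
    simpa using h1
  have hlimH : Tendsto (fun n => H (u n, z.2)) atTop (𝓝 (H z)) :=
    tendsto_integral_fiber hC hconv (f := fun w => w.1 * f w.1 (w.2, z.2))
      (continuous_fst.continuousOn.mul (hf z.2)) hx₁ (fun n => (ht0 n).le) ht1 htl
  have hlimf : Tendsto (fun n => fZ (u n, z.2)) atTop (𝓝 (fZ z)) :=
    ((hfZ z.2 z.1 hzC1).tendsto).comp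
      (tendsto_nhdsWithin_iff.2 ⟨hut, Eventually.of_forall huC1⟩)
  have hev : ∀ᶠ n in atTop, (u n, z.2) ∈ S := by
    filter_upwards [hlimf.eventually (lt_mem_nhds (hpos z hz))] with n hn
    exact (hseg n).2 (huC1 n) hn
  have hlimk : Tendsto (fun n => k (u n, z.2)) atTop (𝓝 (k z)) :=
    ((hk z hz).tendsto).comp (tendsto_nhdsWithin_iff.2
      ⟨hut.prodMk_nhds tendsto_const_nhds, hev⟩)
  refine tendsto_nhds_unique hlimH ((hlimk.mul hlimf).congr' ?_)
  filter_upwards [hev] with n hn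
  rw [(hseg n).1, hG, Set.indicator_of_mem (show (u n, z.2) ∈ {z : Cov q r | z.1 ∈ C1} from huC1 n),
    hk', Set.indicator_of_mem hn, mul_comm]

end observables

/-! ### Weighted identities, measurability and the law of the network -/

section weights

variable {Ω β : Type*} [MeasurableSpace Ω] {μ : Measure Ω}
  [TopologicalSpace β] [SecondCountableTopology β] [MeasurableSpace β]
  {Z : Ω → β} {U : Set Ω} {X X₁ X₂ : Ω → ℝ}

theorem comp_ae_eq_indicator_support (hZ : Measurable Z) (f : β → ℝ) :
    ∀ᵐ ω ∂μ, (μ.map Z).support.indicator f (Z ω) = f (Z ω) := by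
  filter_upwards [ae_mem_support_map hZ] with ω hω
  rw [Set.indicator_of_mem hω]

variable [IsFiniteMeasure μ] [BorelSpace β]

theorem integrable_comp_of_continuousOn (hZ : Measurable Z) (hS : IsCompact (μ.map Z).support)
    {f : β → ℝ} (hf : ContinuousOn f (μ.map Z).support) : Integrable (fun ω => f (Z ω)) μ := by
  obtain ⟨c, hc⟩ := exists_indicator_bound hS hf
  have h1 : Integrable (fun ω => (μ.map Z).support.indicator f (Z ω)) μ :=
    Integrable.of_bound ((measurable_indicator_of_continuousOn Measure.isClosed_support hf).comp
      hZ).aestronglyMeasurable c (Eventually.of_forall fun ω => hc _)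
  exact h1.congr (comp_ae_eq_indicator_support hZ f)

/-- Weights that are continuous on the compact support of `Z` preserve equality of conditional
means given `Z`. -/
theorem SameMean.weight (h : SameMean μ U Z X₁ X₂) (hU : MeasurableSet U) (hZ : Measurable Z)
    (hS : IsCompact (μ.map Z).support) (h₁ : IntegrableOn X₁ U μ) (h₂ : IntegrableOn X₂ U μ)
    {w : β → ℝ} (hw : ContinuousOn w (μ.map Z).support) :
    SameMean μ U Z (fun ω => w (Z ω) * X₁ ω) (fun ω => w (Z ω) * X₂ ω) := by
  obtain ⟨c, hc⟩ := exists_indicator_bound hS hw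
  have h' := h.mul_left hZ h₁ h₂
    (measurable_indicator_of_continuousOn Measure.isClosed_support hw) hc
  refine (SameMean.of_ae hU ?_).trans (h'.trans (SameMean.of_ae hU ?_))
  all_goals
    filter_upwards [comp_ae_eq_indicator_support hZ w] with ω hω _
    rw [hω]

/-- A conditional mean given an event and `Z`, times the conditional probability of that event
given `Z`, is the conditional mean given `Z` of the variable cut off outside that event. -/
theorem SameMean.lift (hU : MeasurableSet U) (hZ : Measurable Z)
    (hS : IsCompact (μ.map Z).support) {f p : β → ℝ} (hf : ContinuousOn f (μ.map Z).support)
    (hp : ContinuousOn p (μ.map Z).support) (h : SameMean μ U Z X fun ω => f (Z ω))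
    (hpU : SameMean μ Set.univ Z (U.indicator fun _ => 1) fun ω => p (Z ω)) :
    SameMean μ Set.univ Z (U.indicator X) fun ω => f (Z ω) * p (Z ω) := by
  have h1 : SameMean μ Set.univ Z (U.indicator X) (U.indicator fun ω => f (Z ω)) := by
    rw [sameMean_indicator_iff hU, Set.univ_inter]
    exact h
  have h2 := hpU.weight MeasurableSet.univ hZ hS
    ((integrable_const (1 : ℝ)).indicator hU).integrableOn
    (integrable_comp_of_continuousOn hZ hS hp).integrableOn hf
  have e : (U.indicator fun ω => f (Z ω)) = fun ω => f (Z ω) * U.indicator (fun _ => 1) ω := by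
    ext ω
    by_cases hω : ω ∈ U <;> simp [hω]
  rw [e] at h1
  exact h1.trans h2

/-- Law of total probability over the values of a degree that is almost surely less than `K`. -/
theorem SameMean.total {K : ℕ} {deg : Ω → ℕ} (hdeg : Measurable deg)
    (hK : ∀ᵐ ω ∂μ, deg ω < K) (hZ : Measurable Z) (hS : IsCompact (μ.map Z).support)
    (hX : Integrable X μ) {f : Fin K → β → ℝ} (hf : ∀ m, ContinuousOn (f m) (μ.map Z).support)
    (h : ∀ m : Fin K, SameMean μ Set.univ Z ({ω | deg ω = m}.indicator X) fun ω => f m (Z ω)) :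
    SameMean μ Set.univ Z X fun ω => ∑ m, f m (Z ω) := by
  have hU : ∀ m : Fin K, MeasurableSet {ω | deg ω = m} := fun m =>
    hdeg (measurableSet_singleton _)
  have h1 := SameMean.sum Finset.univ (fun m _ => h m)
    (fun m _ => (hX.indicator (hU m)).integrableOn)
    (fun m _ => (integrable_comp_of_continuousOn hZ hS (hf m)).integrableOn)
  refine SameMean.trans (SameMean.of_ae MeasurableSet.univ ?_) h1
  filter_upwards [hK] with ω hω _
  rw [Finset.sum_eq_single ⟨deg ω, hω⟩]
  · rw [Set.indicator_of_mem]; rfl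
  · intro m _ hm
    refine Set.indicator_of_notMem (fun hmem => hm ?_) _
    exact Fin.ext (show deg ω = m from hmem).symm
  · simp

variable {α γ : Type*} [MeasurableSpace α] [MeasurableSpace γ]

/-- The form of `IndepGiven.sameMean` for conditional probabilities that are continuous on the
compact support of `Z`. -/
theorem IndepGiven.sameMean_of_continuousOn {deg : Ω → ℕ} {V : Ω → α} {W : Ω → γ}
    (h : IndepGiven μ V W fun ω => (Z ω, deg ω)) (hV : Measurable V) (hW : Measurable W)
    (hZ : Measurable Z) (hdeg : Measurable deg) (hS : IsCompact (μ.map Z).support) {m : ℕ}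
    {H : Set γ} (hH : MeasurableSet H) {f : β → ℝ} (hf : ContinuousOn f (μ.map Z).support)
    (hfH : SameMean μ {ω | deg ω = m} Z ((W ⁻¹' H).indicator fun _ => 1) fun ω => f (Z ω))
    {G : Set α} (hG : MeasurableSet G) :
    SameMean μ ({ω | deg ω = m} ∩ V ⁻¹' G) Z ((W ⁻¹' H).indicator fun _ => 1)
      fun ω => f (Z ω) := by
  have hU : MeasurableSet {ω | deg ω = m} := hdeg (measurableSet_singleton m)
  obtain ⟨c, hc⟩ := exists_indicator_bound hS hf
  have hae := comp_ae_eq_indicator_support (μ := μ) hZ f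
  have h1 := h.sameMean hV hW hZ hdeg (m := m) hH
    (measurable_indicator_of_continuousOn Measure.isClosed_support hf) hc
    (hfH.trans (SameMean.of_ae hU (hae.mono fun ω hω _ => hω.symm))) hG
  exact h1.trans (SameMean.of_ae (hU.inter (hV hG)) (hae.mono fun ω hω _ => hω))

end weights

namespace Model

variable {P Ω E : Type*} {q r : ℕ}

/-- The errors, covariates and networks of all units: everything but the treatments. -/
def world (M : Model P Ω E q r) (ω : Ω) : P → E × Cov q r × Finset P × Finset P × Finset P :=
  fun j => (M.eps j ω, M.Z j ω, M.Nstar j ω, M.N j ω, M.Nt j ω)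

variable [MeasurableSpace Ω] [MeasurableSpace E] {M : Model P Ω E q r} {μ : Measure Ω}

theorem Regular.measurable_world (h : M.Regular) : Measurable M.world :=
  measurable_pi_lambda _ fun j => (h.measEps j).prodMk ((h.measZ j).prodMk
    ((h.measNstar j).prodMk ((h.measN j).prodMk (h.measNt j))))

theorem Regular.measurable_D (h : M.Regular) : Measurable fun ω j => M.D j ω :=
  measurable_pi_lambda _ h.measD

theorem Nondifferential.indepFun_world (h : M.Nondifferential μ) :
    IndepFun (fun ω j => M.D j ω) M.world μ := h.randomized

theorem Regular.measurable_Y (h : M.Regular) (i : P) : Measurable (M.Y i) :=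
  (h.measRt i).comp (h.measurable_D.prodMk ((measurable_pi_lambda _ h.measNstar).prodMk
    ((measurable_pi_lambda _ h.measZ).prodMk (h.measEps i))))

theorem Regular.measurable_YZc (h : M.Regular) (i : P) : Measurable (M.YZc i) :=
  (h.measurable_Y i).prodMk (measurable_fst.comp (h.measZ i))

theorem measurable_treatedCount (A : Finset P) :
    Measurable fun x : P → Bool => treatedCount x A := by
  have e : (fun x : P → Bool => treatedCount x A) =
      fun x => ∑ j ∈ A, if x j = true then 1 else 0 := by
    ext x
    simp [treatedCount]
  rw [e]
  refine Finset.measurable_sum _ fun j _ => ?_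
  exact Measurable.ite (measurableSet_eval j true) measurable_const measurable_const

theorem Unconfounded.measureReal_eq (h : M.Unconfounded μ) (i j : P) :
    μ.real {ω | M.D j ω = true} = μ.real {ω | M.D i ω = true} := by
  have := (h.identD j i).measure_mem_eq (measurableSet_singleton true)
  exact congrArg ENNReal.toReal this

variable [Countable P]

theorem measurable_card {f : Ω → Finset P} (hf : Measurable f) : Measurable fun ω => (f ω).card :=
  (Measurable.of_discrete (f := Finset.card)).comp hf

theorem measurable_treatedCount_comp {D : Ω → P → Bool} (hD : Measurable D) {A : Ω → Finset P}
    (hA : Measurable A) : Measurable fun ω => treatedCount (D ω) (A ω) := by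
  have h : Measurable fun x : (P → Bool) × Finset P => treatedCount x.1 x.2 :=
    measurable_from_prod_countable_left fun A => measurable_treatedCount A
  exact h.comp (hD.prodMk hA)

theorem measurable_filter_comp {D : Ω → P → Bool} (hD : Measurable D) {A : Ω → Finset P}
    (hA : Measurable A) : Measurable fun ω => (A ω).filter fun j => D ω j = true := by
  have h : Measurable fun x : (P → Bool) × Finset P => x.2.filter fun j => x.1 j = true :=
    measurable_from_prod_countable_left fun A =>
      measurable_to_countable' fun T => measurableSet_filter_eq A T
  exact h.comp (hD.prodMk hA)

theorem Regular.measurable_S (h : M.Regular) (i : P) : Measurable (M.S i) :=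
  measurable_treatedCount_comp h.measurable_D (h.measN i)

theorem Regular.measurable_Sstar (h : M.Regular) (i : P) : Measurable (M.Sstar i) :=
  measurable_treatedCount_comp h.measurable_D (h.measNstar i)

end Model

/-! ### Treated neighbours of a unit -/

namespace Model

variable {P Ω E : Type*} {q r : ℕ} [MeasurableSpace Ω] [MeasurableSpace E]
  {M : Model P Ω E q r} {μ : Measure Ω} {p : ℝ} {i : P}

/-- On the event of a given latent degree, the outcome is a function of the error and the
covariates once own treatment and the number of treated neighbours are fixed. The function may be
truncated at a bound for the outcome, which makes it integrable. -/
theorem exists_outcome_function [TopologicalSpace E] [SecondCountableTopology E] [BorelSpace E]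
    (hreg : M.Regular) (hinterf : M.Interference μ) {R : ℝ} (hR : ∀ᵐ ω ∂μ, |M.Y i ω| ≤ R)
    (m : ℕ) (d : Bool) (s : ℕ) :
    ∃ ρ : E × Cov q r → ℝ, Measurable ρ ∧ (∀ x, |ρ x| ≤ |R|) ∧ ∀ᵐ ω ∂μ,
      (M.Nstar i ω).card = m → M.D i ω = d → M.Sstar i ω = s →
        M.Y i ω = ρ (M.eps i ω, M.Z i ω) := by
  classical
  by_cases hex : ∃ ω₀, (M.Nstar i ω₀).card = m ∧ s ≤ m
  · obtain ⟨ω₀, hm, hs⟩ := hex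
    obtain ⟨T, hT, hTs⟩ := Finset.exists_subset_card_eq (hm ▸ hs)
    have hi : i ∉ M.Nstar i ω₀ := (hreg.network ω₀).2 i
    -- The outcome at a network of the given latent degree, with treatments that realize `d` and `s`
    -- and with the same covariates for all units.
    set D₀ : P → Bool := fun j => if j = i then d else decide (j ∈ T) with hD₀
    have htc : treatedCount D₀ (M.Nstar i ω₀) = s := by
      rw [treatedCount, ← hTs]
      congr 1
      ext j
      rw [Finset.mem_filter]
      constructor
      · rintro ⟨hj, h⟩
        have hji : j ≠ i := fun h => hi (h ▸ hj)
        simpa [hD₀, hji] using h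
      · intro hj
        have hji : j ≠ i := fun h => hi (h ▸ hT hj)
        exact ⟨hT hj, by simpa [hD₀, hji] using hj⟩
    set ρ₀ : E × Cov q r → ℝ := fun x =>
      M.rt i D₀ (fun j => M.Nstar j ω₀) (fun _ => x.2) x.1
    have hρ₀m : Measurable ρ₀ := by
      have h1 : Measurable fun x : E × Cov q r =>
          (D₀, (fun j => M.Nstar j ω₀), (fun _ : P => x.2), x.1) :=
        measurable_const.prodMk (measurable_const.prodMk
          ((measurable_pi_lambda _ fun _ => measurable_snd).prodMk measurable_fst))
      exact (hreg.measRt i).comp h1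
    refine ⟨{x | |ρ₀ x| ≤ R}.indicator ρ₀, hρ₀m.indicator ?_, fun x => ?_, ?_⟩
    · exact measurableSet_le hρ₀m.abs measurable_const
    · by_cases hx : |ρ₀ x| ≤ R
      · rw [Set.indicator_of_mem (show x ∈ {x | |ρ₀ x| ≤ R} from hx)]
        exact hx.trans (le_abs_self R)
      · rw [Set.indicator_of_notMem (show x ∉ {x | |ρ₀ x| ≤ R} from hx)]
        simp
    · filter_upwards [hR, ae_mem_support_map (hreg.measEps i)] with ω hω heps h1 h2 h3
      have hY : M.Y i ω = ρ₀ (M.eps i ω, M.Z i ω) := by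
        refine hinterf i i _ _ _ _ _ _ (hreg.network ω) (hreg.network ω₀) _ (Or.inl heps) ?_
          (h1.trans hm.symm) ?_ rfl
        · simpa [hD₀] using h2
        · rw [htc]; exact h3
      have hmem : (M.eps i ω, M.Z i ω) ∈ {x | |ρ₀ x| ≤ R} := by
        change |ρ₀ (M.eps i ω, M.Z i ω)| ≤ R
        rw [← hY]; exact hω
      rw [Set.indicator_of_mem hmem, hY]
  · refine ⟨fun _ => 0, measurable_const, fun _ => by simp, Eventually.of_forall
      fun ω h1 _ h3 => absurd ⟨ω, h1, ?_⟩ hex⟩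
    rw [← h1, ← h3]
    exact Finset.card_filter_le _ _

variable [Countable P] [IsProbabilityMeasure μ]

/-- Given everything but the treatments, own treatment and the number of treated latent neighbours
are an independent Bernoulli and binomial variable. -/
theorem sameMean_D_Sstar (hreg : M.Regular) (hD : iIndepFun (fun i => M.D i) μ)
    (hW : IndepFun (fun ω j => M.D j ω) M.world μ)
    (hp : ∀ j, μ.real {ω | M.D j ω = true} = p) (d : Bool) (s m : ℕ) :
    SameMean μ {ω | (M.Nstar i ω).card = m} M.world
      ({ω | M.D i ω = d ∧ M.Sstar i ω = s}.indicator fun _ => 1)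
      fun _ => bernProb p d * binomProb p s m := by
  have hx : Measurable fun w : P → E × Cov q r × Finset P × Finset P × Finset P => (w i).2.2.1 := by
    fun_prop
  refine sameMean_of_indepFun (x := fun w => (w i).2.2.1)
    (G := fun A => {x : P → Bool | x i = d ∧ treatedCount x A = s})
    (U := {w | (w i).2.2.1.card = m}) hreg.measurable_D hreg.measurable_world hW hx
    (fun A => ?_) (measurable_card hx (measurableSet_singleton m)) fun A hA => ?_
  · exact (measurableSet_eval i d).inter
      (measurable_treatedCount A (measurableSet_singleton s))
  · obtain ⟨ω, h1, h2⟩ := nonempty_of_measure_ne_zero hA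
    have hA' : M.Nstar i ω = A := h2
    have hm : (M.Nstar i ω).card = m := h1
    rw [hA'] at hm
    have hi : i ∉ A := hA' ▸ (hreg.network ω).2 i
    rw [← hm]
    exact measureReal_treated_and_treatedCount hreg.measD hD hp hi d s

/-- The analogue of `sameMean_D_Sstar` for the first proxy. -/
theorem sameMean_D_S (hreg : M.Regular) (hD : iIndepFun (fun i => M.D i) μ)
    (hW : IndepFun (fun ω j => M.D j ω) M.world μ)
    (hp : ∀ j, μ.real {ω | M.D j ω = true} = p) (d : Bool) (s n : ℕ) :
    SameMean μ {ω | (M.N i ω).card = n} M.world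
      ({ω | M.D i ω = d ∧ M.S i ω = s}.indicator fun _ => 1)
      fun _ => bernProb p d * binomProb p s n := by
  have hx : Measurable fun w : P → E × Cov q r × Finset P × Finset P × Finset P =>
      (w i).2.2.2.1 := by
    fun_prop
  refine sameMean_of_indepFun (x := fun w => (w i).2.2.2.1)
    (G := fun A => {x : P → Bool | x i = d ∧ treatedCount x A = s})
    (U := {w | (w i).2.2.2.1.card = n}) hreg.measurable_D hreg.measurable_world hW hx
    (fun A => ?_) (measurable_card hx (measurableSet_singleton n)) fun A hA => ?_
  · exact (measurableSet_eval i d).inter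
      (measurable_treatedCount A (measurableSet_singleton s))
  · obtain ⟨ω, h1, h2⟩ := nonempty_of_measure_ne_zero hA
    have hA' : M.N i ω = A := h2
    have hm : (M.N i ω).card = n := h1
    rw [hA'] at hm
    have hi : i ∉ A := hA' ▸ (hreg.noSelf i ω).1
    rw [← hm]
    exact measureReal_treated_and_treatedCount hreg.measD hD hp hi d s

theorem sameMean_S (hreg : M.Regular) (hD : iIndepFun (fun i => M.D i) μ)
    (hW : IndepFun (fun ω j => M.D j ω) M.world μ)
    (hp : ∀ j, μ.real {ω | M.D j ω = true} = p) (s n : ℕ) :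
    SameMean μ {ω | (M.N i ω).card = n} M.world
      ({ω | M.S i ω = s}.indicator fun _ => 1) fun _ => binomProb p s n := by
  have hx : Measurable fun w : P → E × Cov q r × Finset P × Finset P × Finset P =>
      (w i).2.2.2.1 := by
    fun_prop
  refine sameMean_of_indepFun (x := fun w => (w i).2.2.2.1)
    (G := fun A => {x : P → Bool | treatedCount x A = s})
    (U := {w | (w i).2.2.2.1.card = n}) hreg.measurable_D hreg.measurable_world hW hx
    (fun A => ?_) (measurable_card hx (measurableSet_singleton n)) fun A hA => ?_
  · exact measurable_treatedCount A (measurableSet_singleton s)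
  · obtain ⟨ω, h1, h2⟩ := nonempty_of_measure_ne_zero hA
    have hA' : M.N i ω = A := h2
    have hm : (M.N i ω).card = n := h1
    rw [hA'] at hm
    rw [← hm]
    exact measureReal_treatedCount hreg.measD hD hp A s

/-- The probability of own treatment `d`, of `s'` treated units among the `n'` latent neighbours
and of `s` treated units among the `n` reported neighbours, if one of the two neighbour sets
contains the other. -/
def nestedProb (p : ℝ) (d : Bool) (s' n' s n : ℕ) : ℝ :=
  bernProb p d * if n' ≤ n then
    binomProb p s' n' * if s' ≤ s then binomProb p (s - s') (n - n') else 0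
  else binomProb p s n * if s ≤ s' then binomProb p (s' - s) (n' - n) else 0

/-- With one type of measurement error, the joint law of own treatment and the two numbers of
treated neighbours given everything but the treatments. -/
theorem sameMean_D_Sstar_S (hreg : M.Regular) (hD : iIndepFun (fun i => M.D i) μ)
    (hW : IndepFun (fun ω j => M.D j ω) M.world μ)
    (hp : ∀ j, μ.real {ω | M.D j ω = true} = p)
    (hone : ∀ᵐ ω ∂μ, M.N i ω ⊆ M.Nstar i ω ∨ M.Nstar i ω ⊆ M.N i ω)
    (d : Bool) (s' n' s n : ℕ) :
    SameMean μ {ω | (M.Nstar i ω).card = n' ∧ (M.N i ω).card = n} M.world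
      ({ω | M.D i ω = d ∧ M.Sstar i ω = s' ∧ M.S i ω = s}.indicator fun _ => 1)
      fun _ => nestedProb p d s' n' s n := by
  have hx : Measurable fun w : P → E × Cov q r × Finset P × Finset P × Finset P =>
      ((w i).2.2.1, (w i).2.2.2.1) := by
    fun_prop
  have hU : MeasurableSet {w : P → E × Cov q r × Finset P × Finset P × Finset P |
      (w i).2.2.1.card = n' ∧ (w i).2.2.2.1.card = n} :=
    (measurable_card (measurable_fst.comp hx) (measurableSet_singleton n')).inter
      (measurable_card (measurable_snd.comp hx) (measurableSet_singleton n))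
  refine sameMean_of_indepFun (x := fun w => ((w i).2.2.1, (w i).2.2.2.1))
    (G := fun A => {x : P → Bool | x i = d ∧ treatedCount x A.1 = s' ∧ treatedCount x A.2 = s})
    (U := {w | (w i).2.2.1.card = n' ∧ (w i).2.2.2.1.card = n})
    hreg.measurable_D hreg.measurable_world hW hx (fun A => ?_) hU fun A hA => ?_
  · exact (measurableSet_eval i d).inter
      ((measurable_treatedCount A.1 (measurableSet_singleton s')).inter
        (measurable_treatedCount A.2 (measurableSet_singleton s)))
  · obtain ⟨ω, ⟨h1, h2⟩, h3⟩ : ∃ ω, ω ∈ (M.world ⁻¹' {w | (w i).2.2.1.card = n' ∧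
        (w i).2.2.2.1.card = n} ∩ {ω | ((M.world ω i).2.2.1, (M.world ω i).2.2.2.1) = A}) ∧
        (M.N i ω ⊆ M.Nstar i ω ∨ M.Nstar i ω ⊆ M.N i ω) := by
      by_contra! hcon
      refine hA (measure_mono_null (fun ω hω => ?_) (ae_iff.1 hone))
      exact fun h => (not_or.2 (hcon ω hω)) h
    obtain ⟨rfl, hn⟩ : (M.Nstar i ω).card = n' ∧ (M.N i ω).card = n := h1
    subst hn
    have hA' : (M.Nstar i ω, M.N i ω) = A := h2
    subst hA'
    have hi' : i ∉ M.Nstar i ω := (hreg.network ω).2 i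
    have hi : i ∉ M.N i ω := (hreg.noSelf i ω).1
    unfold nestedProb
    split_ifs with hle h4 h4
    · have hsub : M.Nstar i ω ⊆ M.N i ω := by
        rcases h3 with h3 | h3
        · exact (Finset.eq_of_subset_of_card_le h3 hle).symm.subset
        · exact h3
      have := measureReal_treatedCount_nested hreg.measD hD hp hsub hi d s' s
      rw [if_pos h4] at this
      exact this
    · have hsub : M.Nstar i ω ⊆ M.N i ω := by
        rcases h3 with h3 | h3
        · exact (Finset.eq_of_subset_of_card_le h3 hle).symm.subset
        · exact h3
      have := measureReal_treatedCount_nested hreg.measD hD hp hsub hi d s' s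
      rw [if_neg h4] at this
      exact this
    all_goals
      have hsub : M.N i ω ⊆ M.Nstar i ω := by
        rcases h3 with h3 | h3
        · exact h3
        · exact absurd (Finset.card_le_card h3) hle
      have h5 := measureReal_treatedCount_nested hreg.measD hD hp hsub hi' d s s'
      simp only [h4, if_true, if_false] at h5
      rw [← h5]
      refine congrArg _ ?_
      ext ω'
      exact and_congr_right fun _ => and_comm

/-- On the event of a given latent degree, the mean of the outcome given everything but the
treatments is a bounded function of the error and the covariates. -/
theorem exists_averaged_outcome [TopologicalSpace E] [SecondCountableTopology E] [BorelSpace E]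
    (hreg : M.Regular) (hinterf : M.Interference μ) (hD : iIndepFun (fun i => M.D i) μ)
    (hW : IndepFun (fun ω j => M.D j ω) M.world μ)
    (hp : ∀ j, μ.real {ω | M.D j ω = true} = p)
    {R : ℝ} (hR : ∀ᵐ ω ∂μ, |M.Y i ω| ≤ R) (m : ℕ) :
    ∃ ρ : E × Cov q r → ℝ, Measurable ρ ∧ (∃ c, ∀ x, |ρ x| ≤ c) ∧
      SameMean μ {ω | (M.Nstar i ω).card = m} M.world (M.Y i)
        fun ω => ρ (M.eps i ω, M.Z i ω) := by
  -- `ρ (d, s)` is the outcome at own treatment `d` with `s` treated neighbours, to be weighted by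
  -- the probability of that treatment assignment.
  choose ρ hρm hρR hρ using fun ds : Bool × ℕ =>
    exists_outcome_function (i := i) hreg hinterf hR m ds.1 ds.2
  set I : Finset (Bool × ℕ) := Finset.univ ×ˢ Finset.range (m + 1)
  set a : Bool × ℕ → ℝ := fun ds => bernProb p ds.1 * binomProb p ds.2 m
  have hUm : MeasurableSet {ω | (M.Nstar i ω).card = m} :=
    measurable_card (hreg.measNstar i) (measurableSet_singleton m)
  have hev : ∀ ds : Bool × ℕ, MeasurableSet {ω | M.D i ω = ds.1 ∧ M.Sstar i ω = ds.2} := fun ds =>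
    (hreg.measD i (measurableSet_singleton _)).inter
      (hreg.measurable_Sstar i (measurableSet_singleton _))
  have hw : Measurable fun w : P → E × Cov q r × Finset P × Finset P × Finset P =>
      ((w i).1, (w i).2.1) := by fun_prop
  have hez : Measurable fun ω => (M.eps i ω, M.Z i ω) := (hreg.measEps i).prodMk (hreg.measZ i)
  refine ⟨fun x => ∑ ds ∈ I, ρ ds x * a ds, ?_, ⟨∑ ds ∈ I, |R| * |a ds|, fun x => ?_⟩, ?_⟩
  · exact Finset.measurable_sum _ fun ds _ => (hρm ds).mul_const _
  · refine (Finset.abs_sum_le_sum_abs _ _).trans (Finset.sum_le_sum fun ds _ => ?_)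
    rw [abs_mul]
    exact mul_le_mul_of_nonneg_right (hρR ds x) (abs_nonneg _)
  · have h1 : ∀ ds ∈ I, SameMean μ {ω | (M.Nstar i ω).card = m} M.world
        (fun ω => ρ ds (M.eps i ω, M.Z i ω) *
          {ω | M.D i ω = ds.1 ∧ M.Sstar i ω = ds.2}.indicator (fun _ => 1) ω)
        (fun ω => ρ ds (M.eps i ω, M.Z i ω) * a ds) := fun ds _ =>
      (sameMean_D_Sstar hreg hD hW hp ds.1 ds.2 m).mul_left hreg.measurable_world
        ((integrable_const (1 : ℝ)).indicator (hev ds)).integrableOn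
        (integrable_const _).integrableOn ((hρm ds).comp hw) fun w => hρR ds _
    have hρi : ∀ ds, Integrable (fun ω => ρ ds (M.eps i ω, M.Z i ω)) μ := fun ds =>
      Integrable.of_bound ((hρm ds).comp hez).aestronglyMeasurable |R|
        (Eventually.of_forall fun ω => hρR ds _)
    have h2 := SameMean.sum I h1
      (fun ds _ => by
        refine Integrable.integrableOn ?_
        refine ((hρi ds).indicator (hev ds)).congr (Eventually.of_forall fun ω => ?_)
        by_cases hω : ω ∈ {ω | M.D i ω = ds.1 ∧ M.Sstar i ω = ds.2}
        · simp only [Set.indicator_of_mem hω, mul_one]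
        · simp only [Set.indicator_of_notMem hω, mul_zero])
      (fun ds _ => ((hρi ds).mul_const _).integrableOn)
    refine SameMean.trans (SameMean.of_ae hUm ?_) h2
    filter_upwards [ae_all_iff.2 hρ] with ω hω hm
    have hs : M.Sstar i ω ≤ m := by
      rw [← show (M.Nstar i ω).card = m from hm]
      exact Finset.card_filter_le _ _
    rw [Finset.sum_eq_single (M.D i ω, M.Sstar i ω)]
    · rw [Set.indicator_of_mem (by exact ⟨rfl, rfl⟩), mul_one]
      exact hω _ hm rfl rfl
    · rintro ds - hds
      rw [Set.indicator_of_notMem, mul_zero]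
      exact fun h => hds (Prod.ext h.1.symm h.2.symm)
    · intro h
      exact absurd (Finset.mem_product.2 ⟨Finset.mem_univ _, Finset.mem_range.2 (by omega)⟩) h

end Model

/-! ### The latent degree -/

namespace Model

theorem ae_card_lt {P Ω : Type*} [MeasurableSpace Ω] {μ : Measure Ω} {K : ℕ} {f : Ω → Finset P}
    (h : ∀ n : ℕ, 0 < μ {ω | (f ω).card = n} ↔ n < K) : ∀ᵐ ω ∂μ, (f ω).card < K := by
  have h1 : ∀ n : ℕ, K ≤ n → ∀ᵐ ω ∂μ, (f ω).card ≠ n := by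
    intro n hn
    rw [ae_iff]
    have := mt (h n).1 (not_lt.2 hn)
    simpa using this
  have h2 : ∀ᵐ ω ∂μ, ∀ n : ℕ, K ≤ n → (f ω).card ≠ n :=
    ae_all_iff.2 fun n => by
      by_cases hn : K ≤ n
      · filter_upwards [h1 n hn] with ω hω _ using hω
      · exact Eventually.of_forall fun ω h => absurd h hn
  filter_upwards [h2] with ω hω
  by_contra hc
  exact hω _ (not_lt.1 hc) rfl

variable {P Ω E : Type*} {q r K : ℕ} [Countable P] [MeasurableSpace Ω] [MeasurableSpace E]
  {M : Model P Ω E q r} {μ : Measure Ω} [IsProbabilityMeasure μ] {i : P}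
  {pS : Fin K → Cov q r → ℝ} {F Ft : Fin K → Fin K → Cov q r → ℝ} {T : Fin K → Cov q r → ℝ}

theorem measurableSet_card_eq {f : Ω → Finset P} (hf : Measurable f) (n : ℕ) :
    MeasurableSet {ω | (f ω).card = n} :=
  measurable_card hf (measurableSet_singleton n)

theorem integrable_indicator_one {A : Set Ω} (hA : MeasurableSet A) :
    Integrable (A.indicator fun _ => (1 : ℝ)) μ :=
  (integrable_const 1).indicator hA

section latent

variable (hreg : M.Regular) (hlat : M.IsLatent μ i K pS F Ft T)
  (hS : IsCompact (M.suppZ μ i))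

include hreg hlat hS

theorem sameMean_Nstar_N (n m : Fin K) :
    SameMean μ Set.univ (M.Z i) ({ω | (M.Nstar i ω).card = m}.indicator
      ({ω | (M.N i ω).card = n}.indicator fun _ => 1)) fun ω => F n m (M.Z i ω) * pS m (M.Z i ω) :=
  SameMean.lift (measurableSet_card_eq (hreg.measNstar i) m) (hreg.measZ i) hS (hlat.condN n m).1
    (hlat.condNstar m).1 (hlat.condN n m).2 (hlat.condNstar m).2

theorem sameMean_N (hsparse : M.Sparse μ K) (n : Fin K) :
    SameMean μ Set.univ (M.Z i) ({ω | (M.N i ω).card = n}.indicator fun _ => 1)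
      fun ω => ∑ m, F n m (M.Z i ω) * pS m (M.Z i ω) :=
  SameMean.total (f := fun m z => F n m z * pS m z) (measurable_card (hreg.measNstar i))
    (ae_card_lt fun n => (hsparse i n).1) (hreg.measZ i) hS
    (integrable_indicator_one (measurableSet_card_eq (hreg.measN i) n))
    (fun m => (hlat.condN n m).1.mul (hlat.condNstar m).1)
    fun m => sameMean_Nstar_N hreg hlat hS n m

/-- The columns of the matrix of conditional probabilities of the reported degree have sum one. -/
theorem sum_condN_eq_one (hsparse : M.Sparse μ K) (m : Fin K) {z : Cov q r}
    (hz : z ∈ M.suppZ μ i) : ∑ n, F n m z = 1 := by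
  have hm := measurableSet_card_eq (hreg.measNstar i) m
  have h1 : SameMean μ {ω | (M.Nstar i ω).card = m} (M.Z i) (fun _ => 1)
      fun ω => ∑ n, F n m (M.Z i ω) := by
    have h2 := SameMean.sum Finset.univ
      (fun n _ => (hlat.condN n m).2)
      (fun n _ => (integrable_indicator_one (measurableSet_card_eq (hreg.measN i) n)).integrableOn)
      (fun n _ => (integrable_comp_of_continuousOn (hreg.measZ i) hS
        (hlat.condN n m).1).integrableOn)
    refine SameMean.trans (SameMean.of_ae hm ?_) h2
    filter_upwards [ae_card_lt fun n => (hsparse i n).2.1] with ω hω _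
    rw [Finset.sum_eq_single (⟨(M.N i ω).card, hω⟩ : Fin K)]
    · rw [Set.indicator_of_mem]; rfl
    · intro n _ hn
      refine Set.indicator_of_notMem (fun hmem => hn ?_) _
      exact Fin.ext (show (M.N i ω).card = n from hmem).symm
    · simp
  have hc : ContinuousOn (fun z => ∑ n, F n m z) (M.suppZ μ i) :=
    continuousOn_finsetSum _ fun n _ => (hlat.condN n m).1
  have h3 := SameMean.lift hm (hreg.measZ i) hS hc (hlat.condNstar m).1 h1 (hlat.condNstar m).2
  have h4 := (SameMean.symm (hlat.condNstar m).2).trans h3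
  have h5 := SameMean.eqOn_support (hreg.measZ i) hS (hlat.condNstar m).1
    (hc.mul (hlat.condNstar m).1) h4 hz
  have hpos := hlat.pos m z hz
  exact mul_right_cancel₀ hpos.ne' (by rw [one_mul]; exact h5.symm)

/-- The two reported degrees are independent given the latent degree and the covariates. -/
theorem sameMean_Nt_N_of_Nstar (hexcl : M.Exclusion μ) (a n m : Fin K) :
    SameMean μ {ω | (M.Nstar i ω).card = m} (M.Z i)
      ({ω | (M.Nt i ω).card = a ∧ (M.N i ω).card = n}.indicator fun _ => 1)
      fun ω => Ft a m (M.Z i ω) * F n m (M.Z i ω) := by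
  have hN := measurableSet_card_eq (hreg.measN i) n
  have h1 := (hexcl i).sameMean_of_continuousOn (measurable_card (hreg.measN i))
    (measurable_card (hreg.measNt i)) (hreg.measZ i) (measurable_card (hreg.measNstar i)) hS
    (m := m) (measurableSet_singleton (a : ℕ)) (hlat.condNt a m).1 (hlat.condNt a m).2
    (measurableSet_singleton (n : ℕ))
  have h2 := (sameMean_indicator_iff (U := {ω | (M.Nstar i ω).card = m})
    (V := {ω | (M.N i ω).card = n}) hN).2 h1
  have h3 : SameMean μ {ω | (M.Nstar i ω).card = m} (M.Z i) _ _ :=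
    SameMean.weight (hlat.condN n m).2 (measurableSet_card_eq (hreg.measNstar i) m) (hreg.measZ i)
      hS (integrable_indicator_one hN).integrableOn
      (integrable_comp_of_continuousOn (hreg.measZ i) hS (hlat.condN n m).1).integrableOn
      (hlat.condNt a m).1
  refine SameMean.trans ?_ h3
  convert h2 using 1
  · rw [Set.indicator_indicator]
    congr 1
    ext ω
    exact and_comm
  · ext ω
    by_cases hω : ω ∈ {ω | (M.N i ω).card = n} <;> simp [hω]

theorem sameMean_Nt_N (hexcl : M.Exclusion μ) (hsparse : M.Sparse μ K) (a n : Fin K) :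
    SameMean μ Set.univ (M.Z i)
      ({ω | (M.Nt i ω).card = a ∧ (M.N i ω).card = n}.indicator fun _ => 1)
      fun ω => ∑ m, Ft a m (M.Z i ω) * F n m (M.Z i ω) * pS m (M.Z i ω) := by
  have hc : ∀ m, ContinuousOn (fun z => Ft a m z * F n m z) (M.suppZ μ i) := fun m =>
    (hlat.condNt a m).1.mul (hlat.condN n m).1
  exact SameMean.total (f := fun m z => Ft a m z * F n m z * pS m z)
    (measurable_card (hreg.measNstar i))
    (ae_card_lt fun n => (hsparse i n).1) (hreg.measZ i) hS
    (integrable_indicator_one ((measurableSet_card_eq (hreg.measNt i) a).inter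
      (measurableSet_card_eq (hreg.measN i) n)))
    (fun m => (hc m).mul (hlat.condNstar m).1) fun m =>
      SameMean.lift (measurableSet_card_eq (hreg.measNstar i) m) (hreg.measZ i) hS (hc m)
        (hlat.condNstar m).1 (sameMean_Nt_N_of_Nstar hreg hlat hS hexcl a n m)
        (hlat.condNstar m).2

/-- The mean of the outcome does not depend on the reported degrees once the latent degree and the
covariates are given. -/
theorem sameMean_Y_of_Nstar [TopologicalSpace E] [SecondCountableTopology E] [BorelSpace E]
    {p : ℝ} (hinterf : M.Interference μ) (hD : iIndepFun (fun i => M.D i) μ)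
    (hp : ∀ j, μ.real {ω | M.D j ω = true} = p) (hnondiff : M.Nondifferential μ)
    {R : ℝ} (hR : ∀ᵐ ω ∂μ, |M.Y i ω| ≤ R) (hexcl : M.Exclusion μ) (a n m : Fin K) :
    SameMean μ {ω | (M.Nstar i ω).card = m} (M.Z i)
      ({ω | (M.Nt i ω).card = a ∧ (M.N i ω).card = n}.indicator (M.Y i))
      fun ω => Ft a m (M.Z i ω) * F n m (M.Z i ω) * T m (M.Z i ω) := by
  obtain ⟨ρ, hρm, ⟨c, hc⟩, hρ⟩ := exists_averaged_outcome hreg hinterf hD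
    hnondiff.indepFun_world hp hR m
  have hU := measurableSet_card_eq (hreg.measNstar i) m
  have hZ := hreg.measZ i
  have hez : Measurable fun ω => (M.eps i ω, M.Z i ω) := (hreg.measEps i).prodMk hZ
  have hHm : MeasurableSet {ω | (M.Nt i ω).card = a ∧ (M.N i ω).card = n} :=
    (measurableSet_card_eq (hreg.measNt i) a).inter (measurableSet_card_eq (hreg.measN i) n)
  have hwc : ContinuousOn (fun z => Ft a m z * F n m z) (M.suppZ μ i) :=
    (hlat.condNt a m).1.mul (hlat.condN n m).1
  have hwi : Integrable (fun ω => Ft a m (M.Z i ω) * F n m (M.Z i ω)) μ :=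
    integrable_comp_of_continuousOn hZ hS hwc
  have hρi : Integrable (fun ω => ρ (M.eps i ω, M.Z i ω)) μ :=
    Integrable.of_bound (hρm.comp hez).aestronglyMeasurable c (Eventually.of_forall fun ω => hc _)
  have hYi : Integrable (M.Y i) μ :=
    Integrable.of_bound (hreg.measurable_Y i).aestronglyMeasurable R hR
  have hTi := integrable_comp_of_continuousOn hZ hS (hlat.condY m).1
  -- The error is independent of the reported degrees given the covariates and the latent degree.
  have h1 : SameMean μ {ω | (M.Nstar i ω).card = m} (fun ω => (M.eps i ω, M.Z i ω))
      ({ω | (M.Nt i ω).card = a ∧ (M.N i ω).card = n}.indicator fun _ => 1)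
      fun ω => Ft a m (M.Z i ω) * F n m (M.Z i ω) := by
    refine SameMean.of_rectangles (hreg.measEps i) hZ hU
      (integrable_indicator_one hHm).integrableOn hwi.integrableOn fun G hG => ?_
    have hV : Measurable fun ω => (M.Nstar i ω, M.treatedIn M.Nstar i ω, M.N i ω,
        M.treatedIn M.N i ω, M.Nt i ω, M.treatedIn M.Nt i ω) :=
      (hreg.measNstar i).prodMk ((measurable_filter_comp hreg.measurable_D
        (hreg.measNstar i)).prodMk ((hreg.measN i).prodMk ((measurable_filter_comp
          hreg.measurable_D (hreg.measN i)).prodMk ((hreg.measNt i).prodMk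
            (measurable_filter_comp hreg.measurable_D (hreg.measNt i))))))
    have hH : MeasurableSet {v : Finset P × Finset P × Finset P × Finset P × Finset P × Finset P |
        v.2.2.2.2.1.card = a ∧ v.2.2.1.card = n} :=
      (measurableSet_card_eq (by fun_prop) _).inter (measurableSet_card_eq (by fun_prop) _)
    exact (hnondiff.network i).sameMean_of_continuousOn (hreg.measEps i) hV hZ
      (measurable_card (hreg.measNstar i)) hS hH hwc
      (sameMean_Nt_N_of_Nstar hreg hlat hS hexcl a n m) hG
  -- Hence the averaged outcome may be multiplied by the probability of the reported degrees.
  have h2 : SameMean μ {ω | (M.Nstar i ω).card = m} (M.Z i) _ _ :=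
    (h1.mul_left hez (integrable_indicator_one hHm).integrableOn hwi.integrableOn hρm hc).comp
      measurable_snd
  have hHw : MeasurableSet {w : P → E × Cov q r × Finset P × Finset P × Finset P |
      (w i).2.2.2.2.card = a ∧ (w i).2.2.2.1.card = n} :=
    (measurableSet_card_eq (by fun_prop) _).inter (measurableSet_card_eq (by fun_prop) _)
  have hcov : Measurable fun w : P → E × Cov q r × Finset P × Finset P × Finset P =>
      (w i).2.1 := by fun_prop
  -- The reported degrees do not involve treatments, so the outcome may be averaged over the latter
  -- on events of given reported degrees.
  have h3 : SameMean μ {ω | (M.Nstar i ω).card = m} (M.Z i) _ _ :=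
    (hρ.mul_left hreg.measurable_world hYi.integrableOn hρi.integrableOn
      (w := {w : P → E × Cov q r × Finset P × Finset P × Finset P |
        (w i).2.2.2.2.card = a ∧ (w i).2.2.2.1.card = n}.indicator fun _ => 1)
      (measurable_const.indicator hHw) (c := 1) (fun w => by
        by_cases hw : w ∈ {w : P → E × Cov q r × Finset P × Finset P × Finset P |
          (w i).2.2.2.2.card = a ∧ (w i).2.2.2.1.card = n} <;> simp [hw])).comp hcov
  -- The conditional mean of the averaged outcome is that of the outcome.
  have h4 : SameMean μ {ω | (M.Nstar i ω).card = m} (M.Z i) _ _ :=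
    ((hρ.comp hcov).symm.trans (hlat.condY m).2).weight hU hZ hS hρi.integrableOn
      hTi.integrableOn hwc
  have e1 : ∀ ω, M.world ω ∈ {w : P → E × Cov q r × Finset P × Finset P × Finset P |
      (w i).2.2.2.2.card = a ∧ (w i).2.2.2.1.card = n} ↔
      ω ∈ {ω | (M.Nt i ω).card = a ∧ (M.N i ω).card = n} := fun ω => Iff.rfl
  refine SameMean.trans (SameMean.of_ae hU (Eventually.of_forall fun ω _ => ?_)) (h3.trans
    (SameMean.trans (SameMean.of_ae hU (Eventually.of_forall fun ω _ => ?_)) (h2.trans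
      (SameMean.trans (SameMean.of_ae hU (Eventually.of_forall fun ω _ => ?_)) h4))))
  · by_cases hω : ω ∈ {ω | (M.Nt i ω).card = a ∧ (M.N i ω).card = n}
    · rw [Set.indicator_of_mem hω, Set.indicator_of_mem ((e1 ω).2 hω), one_mul]
    · rw [Set.indicator_of_notMem hω, Set.indicator_of_notMem (mt (e1 ω).1 hω), zero_mul]
  · by_cases hω : ω ∈ {ω | (M.Nt i ω).card = a ∧ (M.N i ω).card = n}
    · rw [Set.indicator_of_mem hω, Set.indicator_of_mem ((e1 ω).2 hω), mul_comm]
    · rw [Set.indicator_of_notMem hω, Set.indicator_of_notMem (mt (e1 ω).1 hω), mul_comm]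
  · exact mul_comm _ _

/-- The conditional mean, given the covariates, of the outcome on the event of two given reported
degrees. -/
theorem sameMean_Y [TopologicalSpace E] [SecondCountableTopology E] [BorelSpace E]
    {p : ℝ} (hinterf : M.Interference μ) (hD : iIndepFun (fun i => M.D i) μ)
    (hp : ∀ j, μ.real {ω | M.D j ω = true} = p) (hnondiff : M.Nondifferential μ)
    {R : ℝ} (hR : ∀ᵐ ω ∂μ, |M.Y i ω| ≤ R) (hexcl : M.Exclusion μ) (hsparse : M.Sparse μ K)
    (a n : Fin K) :
    SameMean μ Set.univ (M.Z i)
      ({ω | (M.Nt i ω).card = a ∧ (M.N i ω).card = n}.indicator (M.Y i))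
      fun ω => ∑ m, Ft a m (M.Z i ω) * F n m (M.Z i ω) * T m (M.Z i ω) * pS m (M.Z i ω) := by
  have hc : ∀ m, ContinuousOn (fun z => Ft a m z * F n m z * T m z) (M.suppZ μ i) := fun m =>
    ((hlat.condNt a m).1.mul (hlat.condN n m).1).mul (hlat.condY m).1
  have hYi : Integrable (M.Y i) μ :=
    Integrable.of_bound (hreg.measurable_Y i).aestronglyMeasurable R hR
  exact SameMean.total (f := fun m z => Ft a m z * F n m z * T m z * pS m z)
    (measurable_card (hreg.measNstar i))
    (ae_card_lt fun n => (hsparse i n).1) (hreg.measZ i) hS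
    (hYi.indicator ((measurableSet_card_eq (hreg.measNt i) a).inter
      (measurableSet_card_eq (hreg.measN i) n)))
    (fun m => (hc m).mul (hlat.condNstar m).1) fun m =>
      SameMean.lift (measurableSet_card_eq (hreg.measNstar i) m) (hreg.measZ i) hS (hc m)
        (hlat.condNstar m).1
        (sameMean_Y_of_Nstar hreg hlat hS hinterf hD hp hnondiff hR hexcl a n m)
        (hlat.condNstar m).2

end latent

end Model

/-! ### Identification of the latent distribution -/

theorem det_ne_zero_of_rank_eq {K : ℕ} {A : Matrix (Fin K) (Fin K) ℝ} (h : A.rank = K) :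
    A.det ≠ 0 := by
  refine isUnit_iff_ne_zero.1 ((Matrix.isUnit_iff_isUnit_det A).1
    (Matrix.linearIndependent_cols_iff_isUnit.1 ?_))
  rw [linearIndependent_iff_card_eq_finrank_span, Fintype.card_fin]
  exact h.symm.trans (Matrix.rank_eq_finrank_span_cols A)

/-- The values of the probability functions at `z` are generated by latent quantities: the columns
of `A` and `At` are the distributions of the two reported degrees given the latent degree, `w` is
the distribution of the latent degree, `t` are the means of the outcome given the latent degree, and
numbers of treated units are binomial with parameter `p`. -/
structure LatentFactors {q r K : ℕ} (C : Set (ℝ × (Fin q → ℝ))) (g : Nuisance q r) (z : Cov q r)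
    (p : ℝ) (A At : Matrix (Fin K) (Fin K) ℝ) (w t : Fin K → ℝ) : Prop where
  p_pos : 0 < p
  p_lt_one : p < 1
  fZ_pos : 0 < g.fZ z
  fNZ_pos : ∀ n : Fin K, 0 < g.fNZ n z
  fSNZ : ∀ (n : Fin K) (s : ℕ), s ≤ n → g.fSNZ s n z = binomProb p s n * g.fNZ n z
  fNgZ : ∀ n : Fin K, g.fNZ n z / g.fZ z = ∑ m, A n m * w m
  fNNZ : ∀ a b : Fin K, g.fNNZ a b z / g.fZ z = ∑ m, At a m * A b m * w m
  moment : ∀ a b : Fin K, ∫ y in {y : ℝ | (y, z.1) ∈ C}, y * g.fNNYZ a b y z =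
    (∑ m, At a m * A b m * t m * w m) * g.fZ z
  w_pos : ∀ m, 0 < w m
  det_A : A.det ≠ 0
  det_At : At.det ≠ 0
  t_injective : Function.Injective t
  sum_A : ∀ m, ∑ n, A n m = 1
  max_A : ∀ m n, n ≠ m → A n m < A m m

namespace LatentFactors

variable {q r K : ℕ} {C : Set (ℝ × (Fin q → ℝ))} {g : Nuisance q r} {z : Cov q r} {p : ℝ}
  {A At : Matrix (Fin K) (Fin K) ℝ} {w t : Fin K → ℝ}

theorem matF_transpose (h : LatentFactors C g z p A At w t) :
    (g.matF K z).transpose = A * (Matrix.diagonal w * At.transpose) := by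
  ext b a
  rw [Matrix.transpose_apply, Nuisance.matF, Matrix.of_apply, h.fNNZ, Matrix.mul_apply]
  refine Finset.sum_congr rfl fun m _ => ?_
  rw [Matrix.diagonal_mul, Matrix.transpose_apply]
  ring

theorem matE_transpose (h : LatentFactors C g z p A At w t) :
    (g.matE K C z).transpose = A * (Matrix.diagonal t * (Matrix.diagonal w * At.transpose)) := by
  ext b a
  rw [Matrix.transpose_apply, Nuisance.matE_eq, Matrix.smul_apply, Matrix.of_apply, smul_eq_mul,
    Matrix.mul_apply]
  simp only [Nuisance.localValues]
  rw [h.moment, mul_comm, mul_assoc, mul_inv_cancel₀ h.fZ_pos.ne', mul_one]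
  refine Finset.sum_congr rfl fun m _ => ?_
  rw [Matrix.diagonal_mul, Matrix.diagonal_mul, Matrix.transpose_apply]
  ring

theorem det_right (h : LatentFactors C g z p A At w t) :
    (Matrix.diagonal w * At.transpose).det ≠ 0 := by
  rw [Matrix.det_mul, Matrix.det_diagonal, Matrix.det_transpose]
  exact mul_ne_zero (Finset.prod_ne_zero_iff.2 fun m _ => (h.w_pos m).ne') h.det_At

/-- The latent distributions of the reported degree are the eigenvectors of `matB`; the eigenvalues
are the latent means of the outcome. -/
theorem isEigenSystem (h : LatentFactors C g z p A At w t) :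
    IsEigenSystem (g.matB K C z) A := by
  refine ⟨⟨t, h.t_injective, ?_⟩, h.sum_A, h.max_A⟩
  set X := Matrix.diagonal w * At.transpose
  have hXu : IsUnit X.det := isUnit_iff_ne_zero.2 h.det_right
  have hAXu : IsUnit (A * X).det := by
    rw [Matrix.det_mul]
    exact (isUnit_iff_ne_zero.2 h.det_A).mul hXu
  have h1 : g.matB K C z * A * X = A * Matrix.diagonal t * X := by
    rw [Nuisance.matB, h.matF_transpose, h.matE_transpose, Matrix.mul_assoc _ A X,
      Matrix.nonsing_inv_mul_cancel_right _ _ hAXu, Matrix.mul_assoc]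
  have h2 := congrArg (fun B => B * X⁻¹) h1
  simpa only [Matrix.mul_nonsing_inv_cancel_right _ _ hXu] using h2

theorem psi_eq (h : LatentFactors C g z p A At w t) : g.psi K C z = A := by
  rw [Nuisance.psi_eq_eigMat, h.isEigenSystem.eigMat_eq h.det_A]

/-- The latent degree distribution is recovered by inverting the matrix of conditional
probabilities of the reported degree. -/
theorem fNstar_eq (h : LatentFactors C g z p A At w t) : g.fNstar K C z = w := by
  have h1 : (fun n : Fin K => g.fNgZ n z) = A.mulVec w := by
    ext n
    exact h.fNgZ n
  rw [Nuisance.fNstar, h.psi_eq, h1, Matrix.mulVec_mulVec,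
    Matrix.nonsing_inv_mul _ (isUnit_iff_ne_zero.2 h.det_A), Matrix.one_mulVec]

theorem binS_eq (h : LatentFactors C g z p A At w t) {s n : ℕ} (hs : s ≤ n) (hn : n < K) :
    g.binS s n z = binomProb p s n := by
  have h1 := h.fSNZ ⟨n, hn⟩ s hs
  have h2 := (h.fNZ_pos ⟨n, hn⟩).ne'
  rw [Nuisance.binS]
  exact (div_eq_iff h2).2 h1

/-- The plug-in map returns the latent distribution, as a ratio of the joint probability of the
latent and reported quantities to that of the reported ones. -/
theorem phi_mul_eq (h : LatentFactors C g z p A At w t) (d : Bool) {s' s : ℕ} {n' n : Fin K}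
    (hs' : s' ≤ n') (hs : s ≤ n) :
    g.phi K C s' n' s n z * (bernProb p d * binomProb p s n) * (g.fNZ n z / g.fZ z) =
      Model.nestedProb p d s' n' s n * (A n n' * w n') := by
  have hb := (binomProb_pos h.p_pos h.p_lt_one hs).ne'
  have hb' := (binomProb_pos h.p_pos h.p_lt_one hs').ne'
  have hf := h.fZ_pos.ne'
  have hn := (h.fNZ_pos n).ne'
  have key : g.fSgS s' n' s n z * binomProb p s' n' * bernProb p d =
      Model.nestedProb p d s' n' s n := by
    unfold Nuisance.fSgS Model.nestedProb
    by_cases h1 : (n' : ℕ) ≤ n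
    · rw [if_pos h1, if_pos h1]
      by_cases h2 : s' ≤ s
      · rw [if_pos h2]
        by_cases h3 : s - s' ≤ n - n'
        · rw [if_pos ⟨h2, h3⟩, h.binS_eq h3 ((Nat.sub_le _ _).trans_lt n.2)]
          ring
        · rw [if_neg (fun h4 => h3 h4.2), binomProb_eq_zero p (not_le.1 h3)]
          ring
      · rw [if_neg h2, if_neg (fun h4 => h2 h4.1)]
        ring
    · rw [if_neg h1, if_neg h1]
      by_cases h2 : s ≤ s'
      · rw [if_pos h2]
        by_cases h3 : s' - s ≤ n' - n
        · rw [if_pos ⟨h2, h3⟩, h.binS_eq h3 ((Nat.sub_le _ _).trans_lt n'.2), h.binS_eq hs n.2,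
            h.binS_eq hs' n'.2]
          field_simp
        · rw [if_neg (fun h4 => h3 h4.2), binomProb_eq_zero p (not_le.1 h3)]
          ring
      · rw [if_neg h2, if_neg (fun h4 => h2 h4.1)]
        ring
  rw [Nuisance.phi, h.psi_eq, h.fNstar_eq, h.binS_eq hs n.2, h.binS_eq hs' n'.2, Nuisance.fNgZ,
    ← key]
  field_simp

/-- Local values that come from latent quantities are points of differentiability of the plug-in
map. -/
theorem nondegenerate (h : LatentFactors C g z p A At w t) :
    (g.localValues K C z).Nondegenerate where
  fZ := h.fZ_pos.ne'
  fNZ n := (h.fNZ_pos n).ne'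
  fSNZ s n hs := by
    simp only [Nuisance.localValues, if_pos hs]
    rw [h.fSNZ n s hs]
    exact mul_ne_zero (binomProb_pos h.p_pos h.p_lt_one hs).ne' (h.fNZ_pos n).ne'
  fNNZ := by
    have h1 : (g.matF K z).det ≠ 0 := by
      rw [← Matrix.det_transpose, h.matF_transpose, Matrix.det_mul]
      exact mul_ne_zero h.det_A h.det_right
    rw [Nuisance.matF_eq C, Matrix.det_smul] at h1
    exact (mul_ne_zero_iff.1 h1).2
  eigen := ⟨A, by rw [← Nuisance.matB_eq]; exact h.isEigenSystem, h.det_A⟩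

end LatentFactors

theorem SmoothNear.continuousOn {V : Type*} [NormedAddCommGroup V] [NormedSpace ℝ V] {f : V → ℝ}
    {S : Set V} (h : SmoothNear f S) : ContinuousOn f S := by
  obtain ⟨O, -, hSO, hf, -⟩ := h
  exact hf.continuousOn.mono hSO

namespace Model

variable {P Ω E : Type*} {q r K : ℕ} [Countable P] [MeasurableSpace Ω] [MeasurableSpace E]
  {M : Model P Ω E q r} {μ : Measure Ω} [IsProbabilityMeasure μ] {i : P}
  {pS : Fin K → Cov q r → ℝ} {F Ft : Fin K → Fin K → Cov q r → ℝ} {T : Fin K → Cov q r → ℝ}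
  {g0 : Nuisance q r}

/-- Under the assumptions of the model, the true probability functions are generated by the latent
ones at every point of the support of the covariates. -/
theorem latentFactors [TopologicalSpace E] [SecondCountableTopology E] [BorelSpace E]
    (hreg : M.Regular) (hinterf : M.Interference μ) (hunconf : M.Unconfounded μ)
    (hnondiff : M.Nondifferential μ) (hexcl : M.Exclusion μ) (hsparse : M.Sparse μ K)
    (hlat : M.IsLatent μ i K pS F Ft T) (hrank : RankCondition (M.suppZ μ i) F Ft)
    (heigen : EigenCondition (M.suppZ μ i) F Ft T) (htrue : IsTrueNuisance M μ i K g0)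
    (hcompact : IsCompact (M.suppC μ i)) (hconvex : Convex ℝ (M.suppC μ i))
    (hsmooth : SmoothNuisance (M.suppC μ i) K g0) (hposZ : ∀ z ∈ M.suppZ μ i, 0 < g0.fZ z)
    (hposN : ∀ n : Fin K, ∀ z ∈ M.suppZ μ i, 0 < g0.fNZ n z) {z : Cov q r}
    (hz : z ∈ M.suppZ μ i) :
    LatentFactors (M.suppC μ i) g0 z (μ.real {ω | M.D i ω = true})
      (Matrix.of fun n m => F n m z) (Matrix.of fun n m => Ft n m z) (fun m => pS m z)
      (fun m => T m z) := by
  set C := M.suppC μ i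
  set p := μ.real {ω | M.D i ω = true}
  have hp : ∀ j, μ.real {ω | M.D j ω = true} = p := fun j => hunconf.measureReal_eq i j
  have hZ := hreg.measZ i
  have hYC : ∀ᵐ ω ∂μ, (M.Y i ω, (M.Z i ω).1) ∈ C := ae_mem_support_map (hreg.measurable_YZc i)
  have hS : IsCompact (M.suppZ μ i) := isCompact_support_map hcompact hZ hYC
  obtain ⟨R, hR⟩ : ∃ R : ℝ, ∀ᵐ ω ∂μ, |M.Y i ω| ≤ R := by
    obtain ⟨R, hR⟩ := hcompact.exists_bound_of_continuousOn
      (f := fun w : ℝ × (Fin q → ℝ) => w.1) continuous_fst.continuousOn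
    exact ⟨R, hYC.mono fun ω hω => hR _ hω⟩
  have hNm := fun n : ℕ => measurableSet_card_eq (hreg.measN i) n
  have hNtm := fun n : ℕ => measurableSet_card_eq (hreg.measNt i) n
  have hSm : ∀ s : ℕ, MeasurableSet {ω | M.S i ω = s} := fun s =>
    hreg.measurable_S i (measurableSet_singleton s)
  have hcZ : ∀ d, ContinuousOn (fun x => g0.fZ (x, d)) (Prod.snd '' C) := fun d =>
    (hsmooth.z d).2.continuousOn
  have hnZ : ∀ d, ∀ x ∈ Prod.snd '' C, 0 ≤ g0.fZ (x, d) := fun d => (hsmooth.z d).1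
  have hN := fun n : Fin K => sameMean_density_ratio hcompact hZ hYC (hNm n)
    (fun d => (hsmooth.nz n n.2 d).2.continuousOn) (fun d => (hsmooth.nz n n.2 d).1) hcZ hnZ
    (htrue.nz n n.2) htrue.z hposZ
  have hNN := fun a b : Fin K => sameMean_density_ratio hcompact hZ hYC ((hNtm a).inter (hNm b))
    (fun d => (hsmooth.nnz a a.2 b b.2 d).2.continuousOn)
    (fun d => (hsmooth.nnz a a.2 b b.2 d).1) hcZ hnZ
    (htrue.nnz a a.2 b b.2) htrue.z hposZ
  have hSN := fun (n : Fin K) (s : ℕ) (hs : s ≤ n) =>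
    sameMean_density_ratio hcompact hZ hYC ((hSm s).inter (hNm n))
    (fun d => (hsmooth.snz n n.2 s hs d).2.continuousOn)
    (fun d => (hsmooth.snz n n.2 s hs d).1) hcZ hnZ
    (htrue.snz n n.2 s hs) htrue.z hposZ
  have hpS := fun m => (hlat.condNstar m).1
  have hF := fun n m => (hlat.condN n m).1
  have hFt := fun n m => (hlat.condNt n m).1
  have hT := fun m => (hlat.condY m).1
  refine
    { p_pos := ENNReal.toReal_pos (hunconf.overlap i).1.ne' (measure_ne_top _ _)
      p_lt_one := ?_
      fZ_pos := hposZ z hz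
      fNZ_pos := fun n => hposN n z hz
      fSNZ := fun n s hs => ?_
      fNgZ := fun n => ?_
      fNNZ := fun a b => ?_
      moment := fun a b => ?_
      w_pos := fun m => hlat.pos m z hz
      det_A := det_ne_zero_of_rank_eq (hrank z hz).1
      det_At := det_ne_zero_of_rank_eq (hrank z hz).2
      t_injective := fun m m' h => by_contra fun hne => (heigen z hz).1 m m' hne h
      sum_A := fun m => sum_condN_eq_one hreg hlat hS hsparse m hz
      max_A := fun m n hnm => ((heigen z hz).2 m n hnm).1 }
  · have h1 : μ.real {ω | M.D i ω = false} = 1 - p := measureReal_treatment hreg.measD hp i false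
    have h2 : 0 < μ.real {ω | M.D i ω = false} :=
      ENNReal.toReal_pos (hunconf.overlap i).2.ne' (measure_ne_top _ _)
    linarith
  · have h1 : SameMean μ {ω | (M.N i ω).card = n} (M.Z i)
        ({ω | M.S i ω = s}.indicator fun _ => 1) fun _ => binomProb p s n :=
      (sameMean_S hreg hunconf.indepD hnondiff.indepFun_world hp s n).comp
        (f := fun w => (w i).2.1) (by fun_prop)
    have h2 := SameMean.lift (hNm n) hZ hS (f := fun _ => binomProb p s n) continuousOn_const
      (hN n).1 h1 (hN n).2
    have h3 := (hSN n s hs).2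
    rw [Set.indicator_indicator, Set.inter_comm] at h2
    have h4 : g0.fSNZ s n z / g0.fZ z = binomProb p s n * (g0.fNZ n z / g0.fZ z) :=
      SameMean.eqOn_support hZ hS (hSN n s hs).1 (continuousOn_const.mul (hN n).1)
        (h3.symm.trans h2) hz
    have hf := (hposZ z hz).ne'
    rw [← mul_div_assoc, div_left_inj' hf] at h4
    exact h4
  · exact SameMean.eqOn_support hZ hS (hN n).1
      (continuousOn_finsetSum _ fun m _ => (hF n m).mul (hpS m))
      ((hN n).2.symm.trans (sameMean_N hreg hlat hS hsparse n)) hz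
  · exact SameMean.eqOn_support hZ hS (hNN a b).1
      (continuousOn_finsetSum _ fun m _ => ((hFt a m).mul (hF b m)).mul (hpS m))
      ((hNN a b).2.symm.trans (sameMean_Nt_N hreg hlat hS hexcl hsparse a b)) hz
  · have h1 := sameMean_Y hreg hlat hS hinterf hunconf.indepD hp hnondiff hR hexcl hsparse a b
    refine integral_fiber_eq hcompact hconvex (hreg.measurable_Y i) hZ hYC
      (A := {ω | (M.Nt i ω).card = a ∧ (M.N i ω).card = b})
      (fun d => (hsmooth.nnyz a a.2 b b.2 d).2.continuousOn)
      (fun d => (hsmooth.nnyz a a.2 b b.2 d).1) hcZ hnZ (htrue.nnyz a a.2 b b.2) htrue.z hposZ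
      (k := fun z => ∑ m, Ft a m z * F b m z * T m z * pS m z)
      (continuousOn_finsetSum _ fun m _ => (((hFt a m).mul (hF b m)).mul (hT m)).mul (hpS m))
      (fun B hB => ?_) hz
    have hH : MeasurableSet {ω | (M.Nt i ω).card = (a : ℕ) ∧ (M.N i ω).card = (b : ℕ)} :=
      (hNtm a).inter (hNm b)
    rw [← h1 B hB, setIntegral_indicator hH, Set.univ_inter, Set.inter_comm]

/-- The plug-in map at the true probability functions is the true latent distribution. -/
theorem isLatentDist_phi (hreg : M.Regular) (hunconf : M.Unconfounded μ)
    (hnondiff : M.Nondifferential μ) (hone : M.OneType μ)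
    (hlat : M.IsLatent μ i K pS F Ft T) {C : Set (ℝ × (Fin q → ℝ))}
    (hS : IsCompact (M.suppZ μ i))
    (hfac : ∀ z ∈ M.suppZ μ i, LatentFactors C g0 z (μ.real {ω | M.D i ω = true})
      (Matrix.of fun n m => F n m z) (Matrix.of fun n m => Ft n m z) (fun m => pS m z)
      (fun m => T m z))
    (hN : ∀ n : Fin K, ContinuousOn (fun z => g0.fNZ n z / g0.fZ z) (M.suppZ μ i) ∧
      SameMean μ Set.univ (M.Z i) ({ω | (M.N i ω).card = n}.indicator fun _ => 1)
        fun ω => g0.fNZ n (M.Z i ω) / g0.fZ (M.Z i ω)) :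
    IsLatentDist M μ i K (g0.phi K C) := by
  intro d n' s' n s hs' hs
  set p := μ.real {ω | M.D i ω = true}
  have hp : ∀ j, μ.real {ω | M.D j ω = true} = p := fun j => hunconf.measureReal_eq i j
  have hZ := hreg.measZ i
  have hW := hnondiff.indepFun_world
  have hNm := measurableSet_card_eq (hreg.measN i) n
  have hNsm := measurableSet_card_eq (hreg.measNstar i) n'
  have hDS : MeasurableSet {ω | M.D i ω = d ∧ M.S i ω = s} :=
    (hreg.measD i (measurableSet_singleton d)).inter
      (hreg.measurable_S i (measurableSet_singleton s))
  have hU : MeasurableSet {ω | M.D i ω = d ∧ M.S i ω = s ∧ (M.N i ω).card = n} :=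
    (hreg.measD i (measurableSet_singleton d)).inter
      ((hreg.measurable_S i (measurableSet_singleton s)).inter hNm)
  have hcov : Measurable fun w : P → E × Cov q r × Finset P × Finset P × Finset P =>
      (w i).2.1 := by fun_prop
  set c := bernProb p d * binomProb p s n
  set c' := nestedProb p d s' n' s n
  have hval : ∀ z ∈ M.suppZ μ i, g0.phi K C s' n' s n z * c * (g0.fNZ n z / g0.fZ z) =
      c' * (F n n' z * pS n' z) := fun z hz => (hfac z hz).phi_mul_eq d hs' hs
  -- The factors of `c` are known to be positive only if the support has a point; otherwise nothing
  -- is to be shown.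
  have hc : c ≠ 0 ∨ ¬ (M.suppZ μ i).Nonempty := by
    by_cases hne : (M.suppZ μ i).Nonempty
    · left
      obtain ⟨z, hz⟩ := hne
      have h0 := (hfac z hz).p_pos
      have h1 := (hfac z hz).p_lt_one
      have h2 := binomProb_pos h0 h1 hs
      have h3 : 0 < bernProb p d := by
        unfold bernProb
        split_ifs
        · exact h0
        · linarith
      exact (mul_pos h3 h2).ne'
    · exact Or.inr hne
  have hFp : ContinuousOn (fun z => F n n' z * pS n' z) (M.suppZ μ i) :=
    (hlat.condN n n').1.mul (hlat.condNstar n').1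
  have hphi : ContinuousOn (g0.phi K C s' n' s n) (M.suppZ μ i) := by
    rcases hc with hc | hc
    · have h1 : ContinuousOn (fun z => c' * (F n n' z * pS n' z) /
          (c * (g0.fNZ n z / g0.fZ z))) (M.suppZ μ i) :=
        (continuousOn_const.mul hFp).div (continuousOn_const.mul (hN n).1) fun z hz =>
          mul_ne_zero hc (div_pos ((hfac z hz).fNZ_pos n) (hfac z hz).fZ_pos).ne'
      refine h1.congr fun z hz => ?_
      have hf := (div_pos ((hfac z hz).fNZ_pos n) (hfac z hz).fZ_pos).ne'
      show g0.phi K C s' n' s n z =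
        c' * (F n n' z * pS n' z) / (c * (g0.fNZ n z / g0.fZ z))
      rw [← hval z hz, eq_div_iff (mul_ne_zero hc hf), ← mul_assoc]
    · rw [Set.not_nonempty_iff_eq_empty.1 hc]
      exact continuousOn_empty _
  refine ⟨hphi, ?_⟩
  change SameMean μ _ (M.Z i) _ fun ω => g0.phi K C s' n' s n (M.Z i ω)
  rw [← Set.univ_inter {ω | M.D i ω = d ∧ M.S i ω = s ∧ (M.N i ω).card = n},
    ← sameMean_indicator_iff hU]
  -- The joint probability of the latent and the reported quantities.
  have h1 : SameMean μ {ω | (M.Nstar i ω).card = n' ∧ (M.N i ω).card = n} (M.Z i)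
      ({ω | M.D i ω = d ∧ M.Sstar i ω = s' ∧ M.S i ω = s}.indicator fun _ => 1) fun _ => c' :=
    (sameMean_D_Sstar_S hreg hunconf.indepD hW hp ((hone i).elim
      (fun h => h.mono fun ω hω => Or.inl hω) fun h => h.mono fun ω hω => Or.inr hω)
      d s' n' s n).comp hcov
  have h2 : SameMean μ Set.univ (M.Z i)
      ({ω | (M.Nstar i ω).card = n' ∧ (M.N i ω).card = n}.indicator fun _ => 1)
      fun ω => F n n' (M.Z i ω) * pS n' (M.Z i ω) := by
    have := sameMean_Nstar_N hreg hlat hS n n'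
    rwa [Set.indicator_indicator] at this
  have h3 := SameMean.lift (hNsm.inter hNm) hZ hS (f := fun _ => c') continuousOn_const hFp h1 h2
  -- The probability of the reported quantities, weighted by the plug-in map.
  have h4 : SameMean μ {ω | (M.N i ω).card = n} (M.Z i)
      (fun ω => g0.phi K C s' n' s n (M.Z i ω) *
        {ω | M.D i ω = d ∧ M.S i ω = s}.indicator (fun _ => 1) ω)
      fun ω => g0.phi K C s' n' s n (M.Z i ω) * c :=
    SameMean.weight ((sameMean_D_S hreg hunconf.indepD hW hp d s n).comp hcov) hNm hZ hS
      (integrable_indicator_one hDS).integrableOn (integrable_const _).integrableOn hphi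
  have h5 := SameMean.lift hNm hZ hS (f := fun z => g0.phi K C s' n' s n z * c)
    (hphi.mul continuousOn_const) (hN n).1 h4 (hN n).2
  refine SameMean.trans ?_ (h3.trans (SameMean.trans (SameMean.of_ae MeasurableSet.univ ?_)
    (h5.symm.trans ?_)))
  · refine SameMean.of_ae MeasurableSet.univ (Eventually.of_forall fun ω _ => ?_)
    rw [Set.indicator_indicator, Set.indicator_indicator]
    refine congrArg (fun V : Set Ω => V.indicator (fun _ => (1 : ℝ)) ω) ?_
    ext ω
    simp only [Set.mem_inter_iff, Set.mem_ofPred_eq]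
    tauto
  · filter_upwards [ae_mem_support_map hZ] with ω hω _
    exact (hval _ hω).symm
  · refine SameMean.of_ae MeasurableSet.univ (Eventually.of_forall fun ω _ => ?_)
    by_cases h6 : (M.N i ω).card = n <;> by_cases h7 : M.D i ω = d ∧ M.S i ω = s
    · rw [Set.indicator_of_mem (show ω ∈ {ω | (M.N i ω).card = n} from h6),
        Set.indicator_of_mem (show ω ∈ {ω | M.D i ω = d ∧ M.S i ω = s} from h7),
        Set.indicator_of_mem (show ω ∈ {ω | M.D i ω = d ∧ M.S i ω = s ∧ (M.N i ω).card = n} from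
          ⟨h7.1, h7.2, h6⟩), mul_one]
    · rw [Set.indicator_of_mem (show ω ∈ {ω | (M.N i ω).card = n} from h6),
        Set.indicator_of_notMem (show ω ∉ {ω | M.D i ω = d ∧ M.S i ω = s} from h7),
        Set.indicator_of_notMem (show ω ∉ {ω | M.D i ω = d ∧ M.S i ω = s ∧ (M.N i ω).card = n} from
          fun h => h7 ⟨h.1, h.2.1⟩), mul_zero]
    all_goals
      rw [Set.indicator_of_notMem (show ω ∉ {ω | (M.N i ω).card = n} from h6),
        Set.indicator_of_notMem (show ω ∉ {ω | M.D i ω = d ∧ M.S i ω = s ∧ (M.N i ω).card = n} from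
          fun h => h6 h.2.2)]

end Model

end NetMis

end

theorem corollary1 {P Ω E : Type*} [Countable P] [MeasurableSpace Ω]
    [TopologicalSpace E] [SecondCountableTopology E] [MeasurableSpace E] [BorelSpace E]
    {q r K : ℕ} (μ : Measure Ω) [IsProbabilityMeasure μ] (M : NetMis.Model P Ω E q r)
    (hreg : M.Regular) (hinterf : M.Interference μ) (hunconf : M.Unconfounded μ)
    (hdistr : M.Distribution μ) (hnondiff : M.Nondifferential μ) (hexcl : M.Exclusion μ)
    (hsparse : M.Sparse μ K) (hone : M.OneType μ)
    (i : P)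
    (pS : Fin K → NetMis.Cov q r → ℝ) (F Ft : Fin K → Fin K → NetMis.Cov q r → ℝ)
    (T : Fin K → NetMis.Cov q r → ℝ) (hlatent : M.IsLatent μ i K pS F Ft T)
    (hrank : NetMis.RankCondition (M.suppZ μ i) F Ft)
    (heigen : NetMis.EigenCondition (M.suppZ μ i) F Ft T)
    (g0 : NetMis.Nuisance q r) (htrue : NetMis.IsTrueNuisance M μ i K g0)
    (hcompact : IsCompact (M.suppC μ i)) (hconvex : Convex ℝ (M.suppC μ i))
    (hsmooth : NetMis.SmoothNuisance (M.suppC μ i) K g0)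
    (κ : ℝ → ℝ) (hκ : NetMis.IsKernel κ) (unit : ℕ → P) (h : ℕ → ℝ) (hh : ∀ N, 0 < h N)
    (hposZ : ∀ z ∈ M.suppZ μ i, 0 < g0.fZ z)
    (hlower : ∃ ε : ℝ, 0 < ε ∧ ∀ n : Fin K, ∀ z ∈ M.suppZ μ i, ε < g0.fNZ n z / g0.fZ z) :
    NetMis.IsLatentDist M μ i K (g0.phi K (M.suppC μ i)) ∧
    ∃ c : ℝ≥0, ∀ η : ℕ → ℝ≥0, Tendsto η atTop (𝓝 0) →
      (∀ᶠ N in atTop, ∀ g : NetMis.Nuisance q r, g.Admissible →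
        g.dist K (M.suppC μ i) (M.suppZ μ i) g0 ≤ η N →
        NetMis.latentDist (M.suppZ μ i) (g.phi K (M.suppC μ i)) (g0.phi K (M.suppC μ i)) ≤
          c * g.dist K (M.suppC μ i) (M.suppZ μ i) g0) ∧
      NetMis.IsBigOp μ
        (fun N ω => ⨆ _ : (NetMis.gammaHat M unit κ (h N) N ω).dist K
            (M.suppC μ i) (M.suppZ μ i) g0 ≤ η N,
          NetMis.latentDist (M.suppZ μ i)
            ((NetMis.gammaHat M unit κ (h N) N ω).phi K (M.suppC μ i))
            (g0.phi K (M.suppC μ i)))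
        (fun N ω => (NetMis.gammaHat M unit κ (h N) N ω).dist K
          (M.suppC μ i) (M.suppZ μ i) g0) := by
  obtain ⟨ε, hε, hlow⟩ := hlower
  have hposN : ∀ n : Fin K, ∀ z ∈ M.suppZ μ i, 0 < g0.fNZ n z := fun n z hz =>
    (div_pos_iff_of_pos_right (hposZ z hz)).1 (hε.trans (hlow n z hz))
  have hZ := hreg.measZ i
  have hYC : ∀ᵐ ω ∂μ, (M.Y i ω, (M.Z i ω).1) ∈ M.suppC μ i :=
    NetMis.ae_mem_support_map (hreg.measurable_YZc i)
  have hS : IsCompact (M.suppZ μ i) := NetMis.isCompact_support_map hcompact hZ hYC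
  have hsub : M.suppZ μ i ⊆ {z | z.1 ∈ Prod.snd '' M.suppC μ i} :=
    NetMis.support_subset_proj hcompact hZ hYC
  have hfac := fun z (hz : z ∈ M.suppZ μ i) => M.latentFactors hreg hinterf hunconf hnondiff hexcl
    hsparse hlatent hrank heigen htrue hcompact hconvex hsmooth hposZ hposN hz
  have hN := fun n : Fin K => NetMis.sameMean_density_ratio hcompact hZ hYC
    (NetMis.Model.measurableSet_card_eq (hreg.measN i) n)
    (fun d => (hsmooth.nz n n.2 d).2.continuousOn) (fun d => (hsmooth.nz n n.2 d).1)
    (fun d => (hsmooth.z d).2.continuousOn) (fun d => (hsmooth.z d).1)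
    (htrue.nz n n.2) htrue.z hposZ
  refine ⟨NetMis.Model.isLatentDist_phi hreg hunconf hnondiff hone hlatent hS hfac hN, ?_⟩
  have hcZ : ContinuousOn g0.fZ (M.suppZ μ i) :=
    (NetMis.continuousOn_setOf_fst_mem fun d => (hsmooth.z d).2.continuousOn).mono hsub
  -- The moments are continuous in `z` because they are identified with continuous latent functions.
  have hcont : ContinuousOn (g0.localValues K (M.suppC μ i)) (M.suppZ μ i) := by
    refine ContinuousOn.prodMk ?_ (ContinuousOn.prodMk ?_ (ContinuousOn.prodMk ?_
      (ContinuousOn.prodMk ?_ hcZ)))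
    · refine continuousOn_pi.2 fun a => continuousOn_pi.2 fun b => ?_
      have h1 : ContinuousOn (fun z => (∑ m, Ft a m z * F b m z * T m z * pS m z) * g0.fZ z)
          (M.suppZ μ i) :=
        (continuousOn_finsetSum _ fun m _ => (((hlatent.condNt a m).1.mul
          (hlatent.condN b m).1).mul (hlatent.condY m).1).mul (hlatent.condNstar m).1).mul hcZ
      exact h1.congr fun z hz => (hfac z hz).moment a b
    · exact continuousOn_pi.2 fun a => continuousOn_pi.2 fun b =>
        (NetMis.continuousOn_setOf_fst_mem
          fun d => (hsmooth.nnz a a.2 b b.2 d).2.continuousOn).mono hsub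
    · refine continuousOn_pi.2 fun s => continuousOn_pi.2 fun n => ?_
      by_cases hs : s ≤ n
      · simp only [if_pos hs]
        exact (NetMis.continuousOn_setOf_fst_mem
          fun d => (hsmooth.snz n n.2 s hs d).2.continuousOn).mono hsub
      · simp only [if_neg hs]
        exact continuousOn_const
    · exact continuousOn_pi.2 fun n => (NetMis.continuousOn_setOf_fst_mem
        fun d => (hsmooth.nz n n.2 d).2.continuousOn).mono hsub
  obtain ⟨c, δ, hδ, hlip⟩ := NetMis.exists_latentDist_le hcompact hS
    (fun a ha b hb d => (hsmooth.nnyz a ha b hb d).2.continuousOn) hcont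
    fun z hz => (hfac z hz).nondegenerate
  exact ⟨c, fun η hη =>
    NetMis.latentDist_bounds μ M hκ.diff.continuous unit h hδ hlip η hη⟩
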